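/- **Setting.** For each $N\ge 1$ let $E_N$ be a countable set and $R_N:E_N\times E_N\to\mathbb R$ a matrix with $R_N(\eta,\xi)\ge 0$ for $\eta\ne\xi$, $-\infty<R_N(\eta,\eta)\le 0$ and $\sum_{\xi}R_N(\eta,\xi)=0$. Let $\{\eta^N_t:t\ge 0\}$ be the minimal right-continuous Markov chain with rates $R_N$; assume that it does not explode, that it is irreducible and positive recurrent, and let $\mu_N$ be its unique invariant probability measure. Write $\mathbf P_\eta$, $\mathbf E_\eta$ for the law of the chain started from $\eta\in E_N$ and the corresponding expectation, and, for $A,F\subseteq E_N$, $\tau_A=\inf\{s>0:\eta^N_s\in A\}$ and $\tau_A(F)=\int_0^{\tau_A}\mathbf 1\{\eta^N_s\in F\}\,ds$. Let $S$ be a finite set with at least two elements and let $\mathcal E^x_N$, $x\in S$, be pairwise disjoint subsets of $E_N$. Put $\mathcal E_N=\bigcup_x\mathcal E^x_N$, $\Delta_N=E_N\setminus\mathcal E_N$, $\breve{\mathcal E}^x_N=\mathcal E_N\setminus\mathcal E^x_N$. Let $\eta^{\mathcal E_N}_t=\eta^N_{s(t)}$, $s(t)=\sup\{s\ge0:\int_0^s\mathbf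 1\{\eta^N_u\in\mathcal E_N\}\,du\le t\}$, be the trace of the chain on $\mathcal E_N$ (set equal to a cemetery point $\mathfrak d$ if $s(t)=\infty$), let $X^N_t\in S\cup\{\mathfrak d\}$ be the label $x$ of the set $\mathcal E^x_N$ that contains $\eta^{\mathcal E_N}_t$ (and $\mathfrak d$ if $\eta^{\mathcal E_N}_t=\mathfrak d$), and let $R^{\mathcal E}_N(\eta,\xi)=\lim_{t\downarrow0}t^{-1}\mathbf P_\eta[\eta^{\mathcal E_N}_t=\xi]$, $\eta\neq\xi\in\mathcal E_N$, be the transition rates of the trace process. For $x\ne y$ and $\eta\in\mathcal E^x_N$ let $R^{x,y}_N(\eta)=\sum_{\xi\in\mathcal E^y_N}R^{\mathcal E}_N(\eta,\xi)$ and $R^x_N=\sum_{y\ne x}R^{x,y}_N$, and let $r_N(\mathcal E^x,\mathcal E^y)$ and $r_N(\mathcal E^x,\breve{\mathcal E}^x)$ in $[0,\infty]$ be the means of $R^{x,y}_N$ and $R^x_N$ with respect to $\mu_N$ conditioned on $\mathcal E^x_N$. **Theorem.** Let $\xi^N_x\in\mathcal E^x_N$ ($x\in S$, $N\ge1$) be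 points such that, for every $x\in S$ and every sequence $\eta^N\in\mathcal E^x_N$, $$\textbf{(C2)}\quad \lim_{N\to\infty}\mathbf E_{\eta^N}\Big[\int_0^{\tau_{\xi^N_x}}R^x_N(\eta^N_s)\,\mathbf 1\{\eta^N_s\in\mathcal E^x_N\}\,ds\Big]=0,$$ $$\textbf{(C3)}\quad \lim_{N\to\infty}r_N(\mathcal E^x,\breve{\mathcal E}^x)\,\mathbf E_{\eta^N}\big[\tau_{\xi^N_x}(\mathcal E^x_N)\big]=0 .$$ Let $\theta_N>0$ be a sequence such that, for all $x\ne y$ in $S$, the limit $$\textbf{(H0)}\quad r(x,y)=\lim_{N\to\infty}\theta_N\,r_N(\mathcal E^x,\mathcal E^y)\in[0,\infty)$$ exists. Call $x$ absorbing if $r(x,y)=0$ for all $y\ne x$. Assume that every absorbing $x$ satisfies $$\textbf{(M3)}\quad \lim_{N\to\infty}\sup_{\eta\in\mathcal E^x_N}\mathbf E_\eta\Big[\int_0^t\mathbf 1\{\eta^N_{s\theta_N}\in\Delta_N\}\,ds\Big]=0\quad\text{for every }t>0,$$ and that every non-absorbing $x$ satisfies $$\textbf{(C1)}\quad \lim_{N\to\infty}\sup_{\eta\in\mathcal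 E^x_N}\mathbf P_\eta\Big[\tfrac1{\theta_N}\tau_{\breve{\mathcal E}^x_N}(\Delta_N)>\delta\Big]=0\quad\text{for every }\delta>0 .$$ Then the chains exhibit a tunneling behaviour on the time scale $(\theta_N)$, with metastates $\mathcal E^x$, metapoints $\xi_x$ and asymptotic dynamics given by the Markov chain on $S$ with rates $r$; that is, for every $x\in S$: * (M1) $\displaystyle\lim_{N\to\infty}\inf_{\eta\in\mathcal E^x_N}\mathbf P_\eta\big[\tau_{\xi^N_x}<\tau_{\breve{\mathcal E}^x_N}\big]=1$; * (M2) for every sequence $\eta^N\in\mathcal E^x_N$, the law of $\{X^N_{t\theta_N}:t\ge0\}$ under $\mathbf P_{\eta^N}$ converges weakly, in the Skorohod space $D(\mathbb R_+,S\cup\{\mathfrak d\})$, to the law of the Markov chain on $S$ with rates $r$ started from $x$; * (M3) holds at $x$. -/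

import Mathlib

open Set Filter Topology MeasureTheory ProbabilityTheory
open scoped NNReal ENNReal

noncomputable section

namespace Tunnel

/-! ### Continuous-time Markov chains on a countable set -/

/-- Matrices of transition rates: nonnegative off the diagonal, with finite nonpositive
diagonal entries and rows that sum to zero. -/
structure RateMatrix (E : Type*) where
  rate : E → E → ℝ
  rate_nonneg : ∀ η ξ, η ≠ ξ → 0 ≤ rate η ξ
  rate_diag_nonpos : ∀ η, rate η η ≤ 0
  hasSum_rate : ∀ η, HasSum (rate η) 0

namespace RateMatrix

section Basic

variable {E : Type*} (Q : RateMatrix E)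

/-- The holding rate `λ(η) = - R(η, η)`. -/
def hold (η : E) : ℝ := - Q.rate η η

open Classical in
/-- The jump probability `p(η, ξ) = R(η, ξ) / λ(η)` for `ξ ≠ η`, and `p(η, η) = 0`. -/
def jumpProb (η ξ : E) : ℝ := if ξ = η then 0 else Q.rate η ξ / Q.hold η

theorem hold_nonneg (η : E) : 0 ≤ Q.hold η := neg_nonneg.mpr (Q.rate_diag_nonpos η)

theorem jumpProb_nonneg (η ξ : E) : 0 ≤ Q.jumpProb η ξ := by
  unfold jumpProb
  split_ifs with h
  · exact le_rfl
  · exact div_nonneg (Q.rate_nonneg η ξ (Ne.symm h)) (Q.hold_nonneg η)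

theorem hasSum_jumpProb (η : E) (h : Q.hold η ≠ 0) : HasSum (Q.jumpProb η) 1 := by
  classical
  have h1 := ((Q.hasSum_rate η).update η 0).div_const (Q.hold η)
  have h2 : (0 - Q.rate η η + 0) / Q.hold η = 1 := by
    rw [zero_sub, add_zero]; exact div_self h
  have h3 : (fun ξ => Function.update (Q.rate η) η 0 ξ / Q.hold η) = Q.jumpProb η := by
    funext ξ
    by_cases hx : ξ = η
    · subst hx; simp [jumpProb]
    · simp [jumpProb, hx]
  rw [h3] at h1
  exact h2 ▸ h1

open Classical in
/-- The law of the next state of the jump chain; an absorbing state is never left. -/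
def jumpPMF (η : E) : PMF E :=
  if h : Q.hold η = 0 then PMF.pure η
  else ⟨fun ξ => ENNReal.ofReal (Q.jumpProb η ξ), by
    have hs := Q.hasSum_jumpProb η h
    have h1 : ∑' ξ, ENNReal.ofReal (Q.jumpProb η ξ) = 1 := by
      rw [← ENNReal.ofReal_tsum_of_nonneg (Q.jumpProb_nonneg η) hs.summable, hs.tsum_eq,
        ENNReal.ofReal_one]
    exact h1 ▸ ENNReal.summable.hasSum⟩

/-- Irreducibility: every state can be reached from every other one through jumps of
positive rate. -/
def IsIrreducible : Prop :=
  ∀ η ξ : E, Relation.ReflTransGen (fun a b => a ≠ b ∧ 0 < Q.rate a b) η ξ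

/-- `holding ω n` is the time spent at the `n`-th state of the jump chain. The first component
of `ω` is the jump chain, the second one the sequence of mean one exponential variables; the
holding time at an absorbing state is infinite. -/
def holding (ω : (ℕ → E) × (ℕ → ℝ)) (n : ℕ) : ℝ≥0∞ :=
  ENNReal.ofReal (ω.2 n) / ENNReal.ofReal (Q.hold (ω.1 n))

/-- The trajectory `η_t = Y_{α(t)}`, with `α(t) = min {n : T_0 + ⋯ + T_n > t}`. -/
def path (ω : (ℕ → E) × (ℕ → ℝ)) (t : ℝ≥0) : E :=
  ω.1 (sInf {n : ℕ | (t : ℝ≥0∞) < ∑ i ∈ Finset.range (n + 1), Q.holding ω i})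

end Basic

section Law

variable {E : Type*} [MeasurableSpace E] [DiscreteMeasurableSpace E] [Countable E]
  (Q : RateMatrix E)

/-- The transition kernel of the jump chain. -/
def jumpKernel : Kernel E E where
  toFun η := (Q.jumpPMF η).toMeasure
  measurable' := Measurable.of_discrete

instance : IsMarkovKernel Q.jumpKernel :=
  ⟨fun η => inferInstanceAs (IsProbabilityMeasure (Q.jumpPMF η).toMeasure)⟩

/-- The law of the jump chain started from `η`. -/
def jumpChainLaw (η : E) : Measure (ℕ → E) :=
  Kernel.traj (X := fun _ : ℕ => E)
    (fun n => Q.jumpKernel.comap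
      (fun h : (i : Finset.Iic n) → E => h ⟨n, Finset.mem_Iic.mpr le_rfl⟩)
      (measurable_pi_apply _)) 0 (fun _ => η)

instance (η : E) : IsProbabilityMeasure (Q.jumpChainLaw η) := by
  unfold jumpChainLaw; infer_instance

instance : IsProbabilityMeasure (expMeasure 1) := isProbabilityMeasure_expMeasure one_pos

/-- The probability `𝐏_η`: the jump chain started from `η`, together with an independent
sequence of i.i.d. mean one exponential variables. -/
def law (η : E) : Measure ((ℕ → E) × (ℕ → ℝ)) :=
  (Q.jumpChainLaw η).prod (Measure.infinitePi fun _ : ℕ => expMeasure 1)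

instance (η : E) : IsProbabilityMeasure (Q.law η) := by
  unfold law; infer_instance

/-- There is no explosion: the holding times sum up to infinity, almost surely. -/
def NonExplosive : Prop := ∀ η, ∀ᵐ ω ∂Q.law η, ∑' n, Q.holding ω n = ∞

end Law

end RateMatrix

/-! ### Functionals of trajectories -/

section Paths

variable {E : Type*}

/-- The hitting time `τ_A = inf {s > 0 : e_s ∈ A}`. -/
def hitTime (e : ℝ≥0 → E) (A : Set E) : ℝ≥0∞ :=
  ⨅ (s : ℝ≥0) (_ : 0 < s ∧ e s ∈ A), (s : ℝ≥0∞)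

/-- The return time `inf {s > 0 : e_s ∈ A, e_u ≠ e_0 for some 0 < u < s}`. -/
def returnTime (e : ℝ≥0 → E) (A : Set E) : ℝ≥0∞ :=
  ⨅ (s : ℝ≥0) (_ : 0 < s ∧ e s ∈ A ∧ ∃ u, 0 < u ∧ u < s ∧ e u ≠ e 0), (s : ℝ≥0∞)

/-- The integral `∫_0^T f(e_s) ds`. -/
def timeIntegral (e : ℝ≥0 → E) (f : E → ℝ≥0∞) (T : ℝ≥0∞) : ℝ≥0∞ :=
  ∫⁻ s in {s : ℝ | 0 ≤ s ∧ ENNReal.ofReal s < T}, f (e s.toNNReal)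

/-- The time spent in `A` before `T`. -/
def occupation (e : ℝ≥0 → E) (A : Set E) (T : ℝ≥0∞) : ℝ≥0∞ :=
  timeIntegral e (A.indicator 1) T

/-- The generalized inverse `sup {s ≥ 0 : occupation of A up to s is at most t}`. -/
def inverseOccupation (e : ℝ≥0 → E) (A : Set E) (t : ℝ≥0) : ℝ≥0∞ :=
  ⨆ (s : ℝ≥0) (_ : occupation e A s ≤ t), (s : ℝ≥0∞)

open Classical in
/-- The trace of the trajectory `e` on `A`; `none` is the artificial cemetery point. -/
def tracePath (e : ℝ≥0 → E) (A : Set E) (t : ℝ≥0) : Option E :=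
  if inverseOccupation e A t = ∞ then none else some (e (inverseOccupation e A t).toNNReal)

end Paths

/-! ### Skorohod space over a discrete set -/

/-- Right-continuous trajectories with left limits in a set `S` with its discrete topology. -/
def IsCadlag {S : Type*} (e : ℝ≥0 → S) : Prop :=
  ∀ t, (∀ᶠ s in 𝓝[≥] t, e s = e t) ∧ ∃ l, ∀ᶠ s in 𝓝[<] t, e s = l

/-- The path space `D(ℝ₊, S)` of a discrete set `S`. -/
def SkorohodSpace (S : Type*) : Type _ := {e : ℝ≥0 → S // IsCadlag e}

namespace SkorohodSpace

variable {S : Type*}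

/-- `Close T ε e e'`: some increasing bijection `φ` of `ℝ₊` satisfies `|φ(t) - t| ≤ ε` and
`e'(φ(t)) = e(t)` for all `t ≤ T`. -/
def Close (T ε : ℝ≥0) (e e' : SkorohodSpace S) : Prop :=
  ∃ φ : ℝ≥0 ≃o ℝ≥0, ∀ t ≤ T, dist (φ t) t ≤ ε ∧ e'.1 (φ t) = e.1 t

theorem Close.mono {T T' ε ε' : ℝ≥0} (hT : T' ≤ T) (hε : ε ≤ ε') {e e' : SkorohodSpace S}
    (h : Close T ε e e') : Close T' ε' e e' := by
  obtain ⟨φ, hφ⟩ := h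
  exact ⟨φ, fun t ht => ⟨(hφ t (ht.trans hT)).1.trans (NNReal.coe_le_coe.mpr hε),
    (hφ t (ht.trans hT)).2⟩⟩

/-- The Skorohod topology on `D(ℝ₊, S)`. The sets `{(e, e') : Close T ε e e'}` form a basis of
a metrizable uniformity, whose topology this is: `e_n → e` if and only if, for every `T`, there
are increasing bijections `φ_n` of `ℝ₊` such that `φ_n → id` uniformly on `[0, T]` and
`e_n ∘ φ_n = e` on `[0, T]` for `n` large. -/
instance : TopologicalSpace (SkorohodSpace S) where
  IsOpen U := ∀ e ∈ U, ∃ T ε : ℝ≥0, 0 < ε ∧ ∀ e', Close T ε e e' → e' ∈ U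
  isOpen_univ := fun _ _ => ⟨0, 1, one_pos, fun _ _ => mem_univ _⟩
  isOpen_inter := by
    rintro U V hU hV e ⟨heU, heV⟩
    obtain ⟨T, ε, hε, h⟩ := hU e heU
    obtain ⟨T', ε', hε', h'⟩ := hV e heV
    exact ⟨max T T', min ε ε', lt_min hε hε', fun e' he' =>
      ⟨h e' (he'.mono (le_max_left _ _) (min_le_left _ _)),
        h' e' (he'.mono (le_max_right _ _) (min_le_right _ _))⟩⟩
  isOpen_sUnion := by
    rintro s hs e ⟨U, hU, heU⟩
    obtain ⟨T, ε, hε, h⟩ := hs U hU e heU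
    exact ⟨T, ε, hε, fun e' he' => ⟨U, hU, h e' he'⟩⟩

instance : MeasurableSpace (SkorohodSpace S) := borel _

instance : BorelSpace (SkorohodSpace S) := ⟨rfl⟩

open Classical in
/-- A trajectory as an element of the path space of `S ∪ {𝔡}`; trajectories that are not
right-continuous with left limits, which occur with probability zero below, are sent to the
constant trajectory `𝔡`. -/
def ofFun (e : ℝ≥0 → Option S) : SkorohodSpace (Option S) :=
  if h : IsCadlag e then ⟨e, h⟩
  else ⟨fun _ => none, fun _ => ⟨Eventually.of_forall fun _ => rfl,
    none, Eventually.of_forall fun _ => rfl⟩⟩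

end SkorohodSpace

/-! ### Recurrence, invariant measures and the rates of the trace process -/

section Chain

variable {E : Type*} [MeasurableSpace E] [DiscreteMeasurableSpace E] [Countable E]

/-- Positive recurrence: the mean return time to each state is finite. -/
def RateMatrix.IsPositiveRecurrent (Q : RateMatrix E) : Prop :=
  ∀ η, ∫⁻ ω, returnTime (Q.path ω) {η} ∂Q.law η < ∞

/-- The measure `μ` is invariant: `∑_η μ(η) R(η, ξ) = 0` for every `ξ`. -/
def RateMatrix.IsInvariant (Q : RateMatrix E) (μ : Measure E) : Prop :=
  ∀ ξ, HasSum (fun η => μ.real {η} * Q.rate η ξ) 0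

/-- The transition rate from `η` to `ξ` of the trace of the chain on `F`, that is, the limit of
`𝐏_η[η^F_t = ξ] / t` as `t` decreases to zero. -/
def traceRate (Q : RateMatrix E) (F : Set E) (η ξ : E) : ℝ≥0∞ :=
  limUnder (𝓝[>] (0 : ℝ≥0)) fun t =>
    Q.law η {ω | tracePath (Q.path ω) F t = some ξ} / (t : ℝ≥0∞)

end Chain

/-! ### Wells -/

section Wells

variable {E S : Type*}

/-- The union of the wells. -/
def wells (W : S → Set E) : Set E := ⋃ x, W x

/-- The union of the wells other than the well of `x`. -/
def otherWells (W : S → Set E) (x : S) : Set E := wells W \ W x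

/-- The complement of the wells. -/
def outside (W : S → Set E) : Set E := (wells W)ᶜ

open Classical in
/-- The label of the well that contains `η`. -/
def label (W : S → Set E) (η : E) : Option S :=
  if h : ∃ x, η ∈ W x then some h.choose else none

/-- The process `X_t`, the projection on the set of labels of the trace on the wells. -/
def projTrace (W : S → Set E) (e : ℝ≥0 → E) (t : ℝ≥0) : Option S :=
  (tracePath e (wells W) t).bind (label W)

variable [MeasurableSpace E] [DiscreteMeasurableSpace E] [Countable E]

/-- The rate at which the trace process on the wells jumps from the state `η` to the well
of `y`. -/
def jumpRateTo (Q : RateMatrix E) (W : S → Set E) (y : S) (η : E) : ℝ≥0∞ :=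
  ∑' ξ : W y, traceRate Q (wells W) η ξ

/-- The rate at which the trace process on the wells jumps from the state `η`, in the well
of `x`, to another well. -/
def exitRate [Fintype S] [DecidableEq S] (Q : RateMatrix E) (W : S → Set E) (x : S) (η : E) :
    ℝ≥0∞ :=
  ∑ y ∈ Finset.univ.erase x, jumpRateTo Q W y η

/-- The mean of `f` with respect to the measure `μ` conditioned on `A`. -/
def condMean (μ : Measure E) (A : Set E) (f : E → ℝ≥0∞) : ℝ≥0∞ :=
  (∑' η : A, f η * μ {(η : E)}) / μ A

/-- The mean rate `r(W^x, W^y)`. -/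
def meanRate (Q : RateMatrix E) (μ : Measure E) (W : S → Set E) (x y : S) : ℝ≥0∞ :=
  condMean μ (W x) (jumpRateTo Q W y)

/-- The mean rate from the well of `x` to the union of the other wells. -/
def meanExitRate [Fintype S] [DecidableEq S] (Q : RateMatrix E) (μ : Measure E)
    (W : S → Set E) (x : S) : ℝ≥0∞ :=
  condMean μ (W x) (exitRate Q W x)

end Wells

/-! ### Sequences of chains -/

section Sequences

variable {E : ℕ → Type*} [∀ N, MeasurableSpace (E N)] [∀ N, DiscreteMeasurableSpace (E N)]
  [∀ N, Countable (E N)] {S : Type*}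

/-- Condition (C1) at `x`: before reaching another well, the time spent outside the wells is
negligible on the scale `θ`. -/
def CondC1 (Q : ∀ N, RateMatrix (E N)) (W : ∀ N, S → Set (E N)) (θ : ℕ → ℝ≥0) (x : S) : Prop :=
  ∀ δ : ℝ≥0, 0 < δ → Tendsto (fun N => ⨆ η ∈ W N x, (Q N).law η
    {ω | (δ : ℝ≥0∞) < occupation ((Q N).path ω) (outside (W N))
      (hitTime ((Q N).path ω) (otherWells (W N) x)) / (θ N : ℝ≥0∞)}) atTop (𝓝 0)

/-- Condition (C2) at `x`, with attractor `a`. -/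
def CondC2 [Fintype S] [DecidableEq S] (Q : ∀ N, RateMatrix (E N)) (W : ∀ N, S → Set (E N))
    (x : S) (a : ∀ N, E N) : Prop :=
  ∀ η : ∀ N, E N, (∀ N, η N ∈ W N x) → Tendsto (fun N => ∫⁻ ω,
    timeIntegral ((Q N).path ω) ((W N x).indicator (exitRate (Q N) (W N) x))
      (hitTime ((Q N).path ω) {a N}) ∂(Q N).law (η N)) atTop (𝓝 0)

/-- Condition (C3) at `x`, with attractor `a`. -/
def CondC3 [Fintype S] [DecidableEq S] (Q : ∀ N, RateMatrix (E N)) (μ : ∀ N, Measure (E N))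
    (W : ∀ N, S → Set (E N)) (x : S) (a : ∀ N, E N) : Prop :=
  ∀ η : ∀ N, E N, (∀ N, η N ∈ W N x) → Tendsto (fun N =>
    meanExitRate (Q N) (μ N) (W N) x * ∫⁻ ω, occupation ((Q N).path ω) (W N x)
      (hitTime ((Q N).path ω) {a N}) ∂(Q N).law (η N)) atTop (𝓝 0)

/-- Condition (H0): the mean rates between the wells, multiplied by `θ`, converge to the
(finite) rates `r`. -/
def CondH0 (Q : ∀ N, RateMatrix (E N)) (μ : ∀ N, Measure (E N)) (W : ∀ N, S → Set (E N))
    (θ : ℕ → ℝ≥0) (r : RateMatrix S) : Prop :=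
  ∀ x y, x ≠ y → Tendsto (fun N => (θ N : ℝ≥0∞) * meanRate (Q N) (μ N) (W N) x y) atTop
    (𝓝 (ENNReal.ofReal (r.rate x y)))

/-- A state that the chain with rates `r` never leaves. -/
def IsAbsorbing (r : RateMatrix S) (x : S) : Prop := ∀ y, y ≠ x → r.rate x y = 0

/-- Property (M1) at `x`: the point `a` is an attractor in the well of `x`. -/
def PropM1 (Q : ∀ N, RateMatrix (E N)) (W : ∀ N, S → Set (E N)) (x : S) (a : ∀ N, E N) : Prop :=
  Tendsto (fun N => ⨅ η ∈ W N x, (Q N).law η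
    {ω | hitTime ((Q N).path ω) {a N} < hitTime ((Q N).path ω) (otherWells (W N) x)})
    atTop (𝓝 1)

/-- Property (M2) at `x`: from any starting point in the well of `x`, the law of the speeded up
process `X_{tθ}` converges, in the Skorohod space of `S ∪ {𝔡}`, to the law of the Markov chain
with rates `r` started from `x`. -/
def PropM2 [Countable S] [MeasurableSpace S] [DiscreteMeasurableSpace S]
    (Q : ∀ N, RateMatrix (E N)) (W : ∀ N, S → Set (E N)) (θ : ℕ → ℝ≥0) (r : RateMatrix S)
    (x : S) : Prop :=
  ∀ η : ∀ N, E N, (∀ N, η N ∈ W N x) →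
    TendstoInDistribution
      (fun N ω => SkorohodSpace.ofFun fun t => projTrace (W N) ((Q N).path ω) (t * θ N))
      atTop
      (fun ω => SkorohodSpace.ofFun fun t => some (r.path ω t))
      (fun N => (Q N).law (η N)) (r.law x)

/-- Property (M3) at `x`: on the scale `θ`, the time spent outside the wells is negligible. -/
def PropM3 (Q : ∀ N, RateMatrix (E N)) (W : ∀ N, S → Set (E N)) (θ : ℕ → ℝ≥0) (x : S) : Prop :=
  ∀ t : ℝ≥0, 0 < t → Tendsto (fun N => ⨆ η ∈ W N x, ∫⁻ ω,
    occupation (fun s => (Q N).path ω (s * θ N)) (outside (W N)) t ∂(Q N).law η) atTop (𝓝 0)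

/-- Tunneling on the time scale `θ`, with metastates `W`, metapoints `a` and asymptotic dynamics
given by the Markov chain with rates `r`. -/
structure ExhibitsTunneling [Countable S] [MeasurableSpace S] [DiscreteMeasurableSpace S]
    (Q : ∀ N, RateMatrix (E N)) (θ : ℕ → ℝ≥0) (W : ∀ N, S → Set (E N)) (a : S → ∀ N, E N)
    (r : RateMatrix S) : Prop where
  attractor : ∀ x, PropM1 Q W x (a x)
  convergence : ∀ x, PropM2 Q W θ r x
  negligible : ∀ x, PropM3 Q W θ x

end Sequences

end Tunnel

end

open Tunnel

open Set Filter Topology MeasureTheory ProbabilityTheory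
open scoped NNReal ENNReal

noncomputable section

namespace Tunnel

set_option linter.unusedSectionVars false

/-! The projected trace is a pure jump process, so its law is that of the successive labels and of
the change times, read on the clock that runs only in the wells. Everything rests on the first
change. For `k > 0` let `u_y` be the mean of `exp (-k T / θ)` on the event that the next well is
that of `y`, where `T` is the time spent in the well of `x` before another well is reached. The core
of the proof (`tendsto_pot_escWeight`) is that `u_y` converges to `r(x,y) / (λ(x) + k)`, with `λ(x)
= ∑ r(x,y)`, along every sequence of starting points in the well of `x`.

All expectations are written as potentials `∑ (m P)ⁿ f` of the jump chain `P` with weights `m ≤ 1`.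
Put `α = k / θ` and let `G f` (`escMean`) be the mean of the integral of `f` over the time in the
well before the escape, discounted at rate `α`. The rates of the trace process are computed in
`traceRate_eq`, and they give `u_y = G R^{x,y}` (`pot_well_eq_escMean`). Next, the trajectory is cut
at the visits to `ξ_x`: if the mean integral of `f` until `ξ_x` is reached is at most `ε`, then `G
f` is within `ε` of the mean of `f` over a cycle at `ξ_x` times a factor that does not depend on `f`
(`escMean_bounds`). By (C2) this applies to `R^{x,y}`, by (C3) to the constant `r_N(x,y)`. The cycle
formula for the invariant measure (`tsum_eq_mul_cyc`, `cyc_condMean`) says that these two functions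
have the same cycle mean, hence `u_y ≈ r_N(x,y) G 1` (`escape_bounds`). With the conservation law `∑
u_y + α G 1 = 1` and (H0) this identifies the limits of `G 1 / θ` and of `u_y`.

For (M2), the strong Markov property at the changes of well extends this limit to all products of
the variables `exp (-J_n) 1{y_n = s}`, where `J_n` are the change times and `y_n` the labels
(`tendsto_moment`). These variables live in a compact cube, where moments determine weak convergence
by Stone–Weierstrass (`tendsto_of_tendsto_moments`). Open sets of the Skorohod space correspond to
open sets of the cube (`exists_isOpen_mem_iff`), and the portmanteau theorem transfers the
convergence to trajectories.

For (M1), the probability of reaching another well before `ξ_x` is at most the mean integral of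
`R^x` until `ξ_x` is reached, which is small by (C2) (`one_sub_le_law_hitTime`). For (M3), the
discounted time outside the wells is split at the first change of well. The part before the change
is small by (C1), and the part after it carries the total weight `∑ u_y` at `k = 1`, which tends to
`λ(x) / (λ(x) + 1) < 1`; this contraction bounds the supremum over the non-absorbing wells
(`propM3`). -/

/-! ### The Markov property at the jump times -/

section Markov

/-- Prepend a term to a sequence. -/
def consSeq {α : Type*} (a : α) (y : ℕ → α) : ℕ → α
  | 0 => a
  | n + 1 => y n

@[simp] theorem consSeq_zero {α : Type*} (a : α) (y : ℕ → α) : consSeq a y 0 = a := rfl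

@[simp] theorem consSeq_succ {α : Type*} (a : α) (y : ℕ → α) (n : ℕ) :
    consSeq a y (n + 1) = y n := rfl

theorem measurable_consSeq {α : Type*} [MeasurableSpace α] :
    Measurable fun p : α × (ℕ → α) => consSeq p.1 p.2 := by
  refine measurable_pi_lambda _ fun n => ?_
  cases n with
  | zero => exact measurable_fst
  | succ n => exact (measurable_pi_apply n).comp measurable_snd

variable {E : Type*} [MeasurableSpace E] [DiscreteMeasurableSpace E] [Countable E]

/-- A finite set of coordinates lies in an initial segment, and on the countable space of initial
segments a measure is determined by its values at points. -/
theorem measure_seq_ext {μ ν : Measure (ℕ → E)} [IsFiniteMeasure μ] [IsFiniteMeasure ν]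
    (h : ∀ (n : ℕ) (a : ℕ → E), μ {y | ∀ i ≤ n, y i = a i} = ν {y | ∀ i ≤ n, y i = a i}) :
    μ = ν := by
  have hproj : IsProjectiveLimit μ (fun I : Finset ℕ => μ.map I.restrict) := fun I => rfl
  refine hproj.unique ?_
  intro I
  have key : ∀ n : ℕ, ν.map (Preorder.frestrictLe n) = μ.map (Preorder.frestrictLe (π := fun _ => E) n) := by
    intro n
    refine Measure.ext_of_singleton fun b => ?_
    have hb : ∃ a : ℕ → E, ∀ i : Finset.Iic n, a i = b i := by
      refine ⟨fun i => if hi : i ≤ n then b ⟨i, Finset.mem_Iic.mpr hi⟩ else b ⟨n, by simp⟩, ?_⟩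
      rintro ⟨i, hi⟩
      simp [Finset.mem_Iic.mp hi]
    obtain ⟨a, ha⟩ := hb
    have hs : Preorder.frestrictLe (π := fun _ => E) n ⁻¹' {b} = {y : ℕ → E | ∀ i ≤ n, y i = a i} := by
      ext y
      simp only [mem_preimage, mem_singleton_iff, mem_ofPred_eq, funext_iff]
      constructor
      · intro hy i hi
        have := hy ⟨i, Finset.mem_Iic.mpr hi⟩
        rw [← ha] at this
        simpa using this
      · rintro hy ⟨i, hi⟩
        rw [← ha]
        simpa using hy i (Finset.mem_Iic.mp hi)
    rw [Measure.map_apply (by fun_prop) (measurableSet_singleton b),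
      Measure.map_apply (by fun_prop) (measurableSet_singleton b), hs, h]
  have hI : I ⊆ Finset.Iic (I.sup id) := fun i hi => Finset.mem_Iic.mpr (Finset.le_sup (f := id) hi)
  have h1 : (I.restrict : (ℕ → E) → _) =
      Finset.restrict₂ (π := fun _ => E) hI ∘ Preorder.frestrictLe (I.sup id) := rfl
  rw [h1, ← Measure.map_map (by fun_prop) (by fun_prop), key,
    Measure.map_map (by fun_prop) (by fun_prop)]
  rfl

variable (Q : RateMatrix E)

open Classical in
theorem jumpChainLaw_cylinder (η : E) (a : ℕ → E) (n : ℕ) :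
    Q.jumpChainLaw η {y | ∀ i ≤ n, y i = a i} =
      (if a 0 = η then 1 else 0) * ∏ i ∈ Finset.range n, Q.jumpKernel (a i) {a (i + 1)} := by
  induction n with
  | zero =>
    have h := Kernel.traj_map_frestrictLe_apply (X := fun _ : ℕ => E)
      (κ := fun n => Q.jumpKernel.comap
      (fun h : (i : Finset.Iic n) → E => h ⟨n, Finset.mem_Iic.mpr le_rfl⟩)
      (measurable_pi_apply _)) 0 0 (fun _ => η)
    rw [Kernel.partialTraj_self, Kernel.id_apply] at h
    have h2 : {y : ℕ → E | ∀ i ≤ 0, y i = a i} =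
        Preorder.frestrictLe 0 ⁻¹' {b : (i : Finset.Iic 0) → E | b ⟨0, by simp⟩ = a 0} := by
      ext y; simp
    have hm : MeasurableSet {b : (i : Finset.Iic 0) → E | b ⟨0, by simp⟩ = a 0} :=
      measurableSet_eq_fun (measurable_pi_apply _) measurable_const
    rw [h2, ← Measure.map_apply (by fun_prop) hm, RateMatrix.jumpChainLaw, h,
      Measure.dirac_apply' _ hm]
    simp [indicator, eq_comm]
  | succ n ih =>
    have h := Kernel.partialTraj_compProd_eq_map_traj (X := fun _ : ℕ => E)
      (κ := fun n => Q.jumpKernel.comap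
      (fun h : (i : Finset.Iic n) → E => h ⟨n, Finset.mem_Iic.mpr le_rfl⟩)
      (measurable_pi_apply _)) (Nat.zero_le n) (x₀ := fun _ => η)
    rw [← Kernel.traj_map_frestrictLe_apply] at h
    change (Q.jumpChainLaw η).map _ ⊗ₘ _ = (Q.jumpChainLaw η).map _ at h
    set A : Set ((i : Finset.Iic n) → E) := {Preorder.frestrictLe (π := fun _ => E) n a}
    have hA : MeasurableSet A := measurableSet_singleton _
    have hs : {y : ℕ → E | ∀ i ≤ n + 1, y i = a i} =
        (fun x => (Preorder.frestrictLe (π := fun _ => E) n x, x (n + 1))) ⁻¹'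
          (A ×ˢ {a (n + 1)}) := by
      ext y
      simp only [mem_ofPred_eq, A, mem_preimage, mem_prod, mem_singleton_iff, funext_iff]
      constructor
      · intro hy
        refine ⟨?_, hy _ le_rfl⟩
        rintro ⟨i, hi⟩
        exact hy i ((Finset.mem_Iic.mp hi).trans (Nat.le_succ n))
      · rintro ⟨h1, h2⟩ i hi
        rcases Nat.lt_or_ge n i with h3 | h3
        · obtain rfl : i = n + 1 := by omega
          exact h2
        · exact h1 ⟨i, Finset.mem_Iic.mpr h3⟩
    have hs' : {y : ℕ → E | ∀ i ≤ n, y i = a i} =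
        Preorder.frestrictLe (π := fun _ => E) n ⁻¹' A := by
      ext y
      simp only [mem_ofPred_eq, A, mem_preimage, mem_singleton_iff, funext_iff]
      exact ⟨fun hy ⟨i, hi⟩ => hy i (Finset.mem_Iic.mp hi),
        fun hy i hi => hy ⟨i, Finset.mem_Iic.mpr hi⟩⟩
    rw [hs, ← Measure.map_apply (by fun_prop) (hA.prod (measurableSet_singleton _)), ← h,
      Measure.compProd_apply_prod hA (measurableSet_singleton _), Finset.prod_range_succ,
      ← mul_assoc, ← ih, hs', ← Measure.map_apply (by fun_prop) hA]
    have h3 : ∀ x ∈ A, (Q.jumpKernel.comap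
      (fun h : (i : Finset.Iic n) → E => h ⟨n, Finset.mem_Iic.mpr le_rfl⟩)
      (measurable_pi_apply _)) x {a (n + 1)} = Q.jumpKernel (a n) {a (n + 1)} := by
      intro x hx
      obtain rfl : x = _ := hx
      rfl
    rw [setLIntegral_congr_fun hA h3, setLIntegral_const, mul_comm]

theorem jumpChainLaw_eq_map (η : E) :
    Q.jumpChainLaw η =
      ((Q.jumpKernel η).bind Q.jumpChainLaw).map (consSeq η) := by
  classical
  have hm : Measurable (consSeq η : (ℕ → E) → _) := measurable_consSeq.comp measurable_prodMk_left
  have hb : Measurable Q.jumpChainLaw := Measurable.of_discrete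
  have hmeas : ∀ (n : ℕ) (a : ℕ → E), MeasurableSet {y : ℕ → E | ∀ i ≤ n, y i = a i} := by
    intro n a
    have : {y : ℕ → E | ∀ i ≤ n, y i = a i} = ⋂ i, ⋂ (_ : i ≤ n), {y | y i = a i} := by
      ext; simp
    rw [this]
    exact MeasurableSet.iInter fun i => MeasurableSet.iInter fun _ =>
      measurableSet_eq_fun (measurable_pi_apply i) measurable_const
  have : IsProbabilityMeasure ((Q.jumpKernel η).bind Q.jumpChainLaw) :=
    isProbabilityMeasure_bind hb.aemeasurable (.of_forall fun _ => inferInstance)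
  refine measure_seq_ext fun n a => ?_
  rw [jumpChainLaw_cylinder, Measure.map_apply hm (hmeas n a),
    Measure.bind_apply (hm (hmeas n a)) hb.aemeasurable]
  cases n with
  | zero =>
    by_cases h : a 0 = η
    · have : consSeq η ⁻¹' {y : ℕ → E | ∀ i ≤ 0, y i = a i} = univ := by
        ext y; simp [h]
      rw [this]
      simp [h]
    · have : consSeq η ⁻¹' {y : ℕ → E | ∀ i ≤ 0, y i = a i} = ∅ := by
        ext y; simp [Ne.symm h]
      rw [this]
      simp [h]
  | succ n =>
    by_cases h : a 0 = η
    · have : consSeq η ⁻¹' {y : ℕ → E | ∀ i ≤ n + 1, y i = a i} =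
          {y | ∀ i ≤ n, y i = a (i + 1)} := by
        ext y
        simp only [mem_preimage, mem_ofPred_eq]
        constructor
        · intro hy i hi
          exact hy (i + 1) (by omega)
        · intro hy i hi
          cases i with
          | zero => exact h.symm
          | succ i => exact hy i (by omega)
      simp_rw [this, jumpChainLaw_cylinder Q _ (fun i => a (i + 1))]
      rw [lintegral_mul_const _ Measurable.of_discrete, Finset.prod_range_succ']
      have h2 : (fun ζ => if a (0 + 1) = ζ then (1 : ℝ≥0∞) else 0) = ({a 1} : Set E).indicator 1 := by
        ext ζ; simp [indicator, eq_comm]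
      rw [h2, lintegral_indicator_one (measurableSet_singleton _), if_pos h, one_mul, mul_comm, h]
    · have : consSeq η ⁻¹' {y : ℕ → E | ∀ i ≤ n + 1, y i = a i} = ∅ := by
        ext y
        simp only [mem_preimage, mem_ofPred_eq, mem_empty_iff_false, iff_false, not_forall]
        exact ⟨0, by simp, fun h' => h h'.symm⟩
      simp [this, h]

theorem infinitePi_eq_map (ν : Measure ℝ) [IsProbabilityMeasure ν] :
    Measure.infinitePi (fun _ : ℕ => ν) =
      (ν.prod (Measure.infinitePi fun _ : ℕ => ν)).map fun p => consSeq p.1 p.2 := by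
  symm
  refine Measure.eq_infinitePi _ fun s t ht => ?_
  rw [Measure.map_apply measurable_consSeq (.pi s.countable_toSet fun i _ => ht i)]
  classical
  set s' : Finset ℕ := (s.erase 0).image Nat.pred
  have hs' : ∀ i, i ∈ s' ↔ i + 1 ∈ s := by
    intro i
    simp only [s', Finset.mem_image, Finset.mem_erase]
    constructor
    · rintro ⟨j, ⟨h0, hj⟩, rfl⟩
      rwa [← Nat.succ_eq_add_one, Nat.succ_pred h0]
    · intro h
      exact ⟨i + 1, ⟨by omega, h⟩, rfl⟩
  have hset : (fun p : ℝ × (ℕ → ℝ) => consSeq p.1 p.2) ⁻¹' (Set.pi s t) =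
      (if 0 ∈ s then t 0 else univ) ×ˢ Set.pi s' (fun i => t (i + 1)) := by
    ext ⟨u, v⟩
    simp only [mem_preimage, Set.mem_pi, Finset.mem_coe, mem_prod, hs']
    constructor
    · intro h
      refine ⟨?_, fun i hi => h (i + 1) hi⟩
      split_ifs with h0
      · exact h 0 h0
      · trivial
    · rintro ⟨h0, h1⟩ i hi
      cases i with
      | zero => simpa [hi] using h0
      | succ i => exact h1 i hi
  rw [hset, Measure.prod_prod, Measure.infinitePi_pi _ fun i _ => ht _]
  have himg : (s.erase 0) = s'.map ⟨Nat.succ, Nat.succ_injective⟩ := by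
    ext j
    simp only [Finset.mem_erase, Finset.mem_map, Function.Embedding.coeFn_mk, hs']
    constructor
    · rintro ⟨h0, hj⟩
      exact ⟨j - 1, by rwa [Nat.sub_add_cancel (Nat.pos_of_ne_zero h0)], by
        simpa using Nat.sub_add_cancel (Nat.pos_of_ne_zero h0)⟩
    · rintro ⟨i, hi, rfl⟩
      exact ⟨by simp, hi⟩
  by_cases h0 : 0 ∈ s
  · rw [if_pos h0, ← Finset.mul_prod_erase s _ h0, himg, Finset.prod_map]; rfl
  · rw [if_neg h0, measure_univ, one_mul, ← Finset.erase_eq_of_notMem h0, himg, Finset.prod_map]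
    rfl

/-- Forget the first jump. -/
def shift {E : Type*} (ω : (ℕ → E) × (ℕ → ℝ)) : (ℕ → E) × (ℕ → ℝ) :=
  (fun n => ω.1 (n + 1), fun n => ω.2 (n + 1))

theorem measurable_shift : Measurable (shift : (ℕ → E) × (ℕ → ℝ) → _) :=
  (measurable_pi_lambda _ fun _ => (measurable_pi_apply _).comp measurable_fst).prodMk
    (measurable_pi_lambda _ fun _ => (measurable_pi_apply _).comp measurable_snd)

theorem shift_iterate_fst {E : Type*} (n k : ℕ) (ω : (ℕ → E) × (ℕ → ℝ)) :
    (shift^[n] ω).1 k = ω.1 (n + k) := by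
  induction n generalizing ω with
  | zero => simp
  | succ n ih => rw [Function.iterate_succ_apply, ih, Nat.add_right_comm]; rfl

theorem shift_iterate_snd {E : Type*} (n k : ℕ) (ω : (ℕ → E) × (ℕ → ℝ)) :
    (shift^[n] ω).2 k = ω.2 (n + k) := by
  induction n generalizing ω with
  | zero => simp
  | succ n ih => rw [Function.iterate_succ_apply, ih, Nat.add_right_comm]; rfl

/-- The transition operator of the jump chain. -/
def RateMatrix.avg (f : E → ℝ≥0∞) (η : E) : ℝ≥0∞ := ∫⁻ ζ, f ζ ∂Q.jumpKernel η

/-- The Markov property at the first jump: the first exponential variable, the first jump and the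
remaining trajectory are integrated separately, by Fubini. -/
theorem lintegral_law (η : E) {f : (ℕ → E) × (ℕ → ℝ) → ℝ≥0∞} (hf : Measurable f) :
    ∫⁻ ω, f ω ∂Q.law η = ∫⁻ t, Q.avg (fun ζ =>
      ∫⁻ ω, f (consSeq η ω.1, consSeq t ω.2) ∂Q.law ζ) η ∂expMeasure 1 := by
  have hb : Measurable Q.jumpChainLaw := Measurable.of_discrete
  have hm : Measurable (consSeq η : (ℕ → E) → _) := measurable_consSeq.comp measurable_prodMk_left
  have h1 : Measurable fun y : ℕ → E => ∫⁻ e, f (y, e) ∂Measure.infinitePi fun _ : ℕ => expMeasure 1 :=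
    hf.lintegral_prod_right'
  have h2 : ∀ ζ t, ∫⁻ ω, f (consSeq η ω.1, consSeq t ω.2) ∂Q.law ζ =
      ∫⁻ y, ∫⁻ e, f (consSeq η y, consSeq t e) ∂(Measure.infinitePi fun _ : ℕ => expMeasure 1)
        ∂Q.jumpChainLaw ζ := by
    intro ζ t
    rw [RateMatrix.law, lintegral_prod]
    exact (hf.comp ((hm.comp measurable_fst).prodMk
      ((measurable_consSeq.comp measurable_prodMk_left).comp measurable_snd))).aemeasurable
  have hF : Measurable fun p : (ℕ → E) × ℝ => ∫⁻ e, f (consSeq η p.1, consSeq p.2 e)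
      ∂Measure.infinitePi fun _ : ℕ => expMeasure 1 := by
    refine Measurable.lintegral_prod_right' (f := fun q : ((ℕ → E) × ℝ) × (ℕ → ℝ) =>
      f (consSeq η q.1.1, consSeq q.1.2 q.2)) ?_
    exact hf.comp ((hm.comp (measurable_fst.comp measurable_fst)).prodMk
      (measurable_consSeq.comp ((measurable_snd.comp measurable_fst).prodMk measurable_snd)))
  simp_rw [h2, RateMatrix.avg]
  rw [RateMatrix.law, lintegral_prod _ hf.aemeasurable, jumpChainLaw_eq_map,
    lintegral_map h1 hm, Measure.lintegral_bind (f := fun y => ∫⁻ e, f (consSeq η y, e) ∂_) hb.aemeasurable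
      (h1.comp hm).aemeasurable]
  have h3 : ∀ y : ℕ → E, ∫⁻ e, f (consSeq η y, e) ∂(Measure.infinitePi fun _ : ℕ => expMeasure 1) =
      ∫⁻ t, ∫⁻ e, f (consSeq η y, consSeq t e) ∂(Measure.infinitePi fun _ : ℕ => expMeasure 1)
        ∂expMeasure 1 := by
    intro y
    conv_lhs => rw [infinitePi_eq_map]
    rw [lintegral_map (f := fun e => f (consSeq η y, e)) (hf.comp measurable_prodMk_left)
      measurable_consSeq, lintegral_prod]
    exact ((hf.comp measurable_prodMk_left).comp measurable_consSeq).aemeasurable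
  simp_rw [h3]
  have h4 : ∀ ζ, ∫⁻ y, ∫⁻ t, ∫⁻ e, f (consSeq η y, consSeq t e)
      ∂(Measure.infinitePi fun _ : ℕ => expMeasure 1) ∂expMeasure 1 ∂Q.jumpChainLaw ζ =
      ∫⁻ t, ∫⁻ y, ∫⁻ e, f (consSeq η y, consSeq t e)
      ∂(Measure.infinitePi fun _ : ℕ => expMeasure 1) ∂Q.jumpChainLaw ζ ∂expMeasure 1 :=
    fun ζ => lintegral_lintegral_swap hF.aemeasurable
  simp_rw [h4]
  refine lintegral_lintegral_swap (Measurable.aemeasurable ?_)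
  refine measurable_from_prod_countable_right fun ζ => ?_
  exact Measurable.lintegral_prod_right' (ν := Q.jumpChainLaw ζ) (f := fun q : ℝ × (ℕ → E) =>
    ∫⁻ e, f (consSeq η q.2, consSeq q.1 e) ∂Measure.infinitePi fun _ : ℕ => expMeasure 1)
    (hF.comp measurable_swap)

/-- Expectation of a functional of the trajectory, as a function of the starting point. -/
def RateMatrix.mean (Ψ : (ℕ → E) × (ℕ → ℝ) → ℝ≥0∞) (η : E) : ℝ≥0∞ := ∫⁻ ω, Ψ ω ∂Q.law η

/-- One step of the jump chain weighted by `m`. -/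
def RateMatrix.wavg (m f : E → ℝ≥0∞) (η : E) : ℝ≥0∞ := m η * Q.avg f η

theorem mean_mul_shift {w : E → ℝ → ℝ≥0∞} (hw : ∀ η, Measurable (w η))
    {Ψ : (ℕ → E) × (ℕ → ℝ) → ℝ≥0∞} (hΨ : Measurable Ψ) :
    Q.mean (fun ω => w (ω.1 0) (ω.2 0) * Ψ (shift ω)) =
      Q.wavg (fun η => ∫⁻ t, w η t ∂expMeasure 1) (Q.mean Ψ) := by
  funext η
  have hw' : Measurable fun p : E × ℝ => w p.1 p.2 := measurable_from_prod_countable_right hw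
  have h0 : Measurable fun ω : (ℕ → E) × (ℕ → ℝ) => w (ω.1 0) (ω.2 0) := by
    exact hw'.comp (g := fun p : E × ℝ => w p.1 p.2)
      (f := fun ω : (ℕ → E) × (ℕ → ℝ) => (ω.1 0, ω.2 0)) (by fun_prop)
  rw [RateMatrix.mean, lintegral_law Q η (f := fun ω => w (ω.1 0) (ω.2 0) * Ψ (shift ω))
    (h0.mul (hΨ.comp measurable_shift))]
  have h1 : ∀ (t : ℝ) (ω : (ℕ → E) × (ℕ → ℝ)),
      shift (consSeq η ω.1, consSeq t ω.2) = ω := fun t ω => rfl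
  simp only [consSeq_zero, h1]
  have h2 : ∀ t : ℝ, Q.avg (fun ζ => ∫⁻ ω, w η t * Ψ ω ∂Q.law ζ) η = w η t * Q.avg (Q.mean Ψ) η := by
    intro t
    rw [RateMatrix.avg, RateMatrix.avg, ← lintegral_const_mul _ Measurable.of_discrete]
    exact lintegral_congr fun ζ => lintegral_const_mul _ hΨ
  simp_rw [h2]
  rw [lintegral_mul_const _ (hw η), RateMatrix.wavg]

/-- This is the passage from trajectories to operators. A multiplicative functional of the first `n`
steps becomes the `n`-th iterate of a weighted transition operator, so that most of what follows is
algebra of `wavg` and `pot`. -/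
theorem mean_prod_mul_shift {w : E → ℝ → ℝ≥0∞} (hw : ∀ η, Measurable (w η))
    {Ψ : (ℕ → E) × (ℕ → ℝ) → ℝ≥0∞} (hΨ : Measurable Ψ) (n : ℕ) :
    Q.mean (fun ω => (∏ i ∈ Finset.range n, w (ω.1 i) (ω.2 i)) * Ψ (shift^[n] ω)) =
      (Q.wavg (fun η => ∫⁻ t, w η t ∂expMeasure 1))^[n] (Q.mean Ψ) := by
  have hw' : Measurable fun p : E × ℝ => w p.1 p.2 := measurable_from_prod_countable_right hw
  induction n with
  | zero => simp
  | succ n ih =>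
    rw [Function.iterate_succ_apply', ← ih, ← mean_mul_shift Q hw]
    · congr 1
      funext ω
      rw [Finset.prod_range_succ', Function.iterate_succ_apply]
      simp only [shift]
      ring
    · refine Measurable.mul (Finset.measurable_prod _ fun i _ => ?_) (hΨ.comp (measurable_shift.iterate n))
      exact hw'.comp (g := fun p : E × ℝ => w p.1 p.2)
        (f := fun ω : (ℕ → E) × (ℕ → ℝ) => (ω.1 i, ω.2 i)) (by fun_prop)

theorem ae_start (η : E) : ∀ᵐ ω ∂Q.law η, ω.1 0 = η := by
  have hm : MeasurableSet {ω : (ℕ → E) × (ℕ → ℝ) | ¬ ω.1 0 = η} :=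
    (measurableSet_eq_fun ((measurable_pi_apply 0).comp measurable_fst) measurable_const).compl
  rw [ae_iff, ← lintegral_indicator_one hm, lintegral_law Q η (measurable_one.indicator hm)]
  simp [RateMatrix.avg]

end Markov

/-! ### Potential theory of the jump chain -/

section Potential

variable {E : Type*} [MeasurableSpace E] [DiscreteMeasurableSpace E] [Countable E]
  (Q : RateMatrix E)

theorem avg_add (f g : E → ℝ≥0∞) : Q.avg (f + g) = Q.avg f + Q.avg g := by
  funext η; exact lintegral_add_left Measurable.of_discrete _

theorem avg_const_mul (c : ℝ≥0∞) (f : E → ℝ≥0∞) (η : E) :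
    Q.avg (fun ζ => c * f ζ) η = c * Q.avg f η :=
  lintegral_const_mul _ Measurable.of_discrete

theorem avg_mono {f g : E → ℝ≥0∞} (h : f ≤ g) : Q.avg f ≤ Q.avg g := fun _ => lintegral_mono h

theorem avg_const (c : ℝ≥0∞) (η : E) : Q.avg (fun _ => c) η = c := by
  simp [RateMatrix.avg]

theorem avg_le_const {f : E → ℝ≥0∞} {c : ℝ≥0∞} (h : ∀ η, f η ≤ c) (η : E) : Q.avg f η ≤ c :=
  (avg_mono Q (g := fun _ => c) h η).trans (avg_const Q c η).le

theorem avg_tsum {ι : Type*} [Countable ι] (f : ι → E → ℝ≥0∞) (η : E) :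
    Q.avg (fun ζ => ∑' i, f i ζ) η = ∑' i, Q.avg (f i) η :=
  lintegral_tsum fun _ => Measurable.of_discrete.aemeasurable

theorem avg_eq_tsum (f : E → ℝ≥0∞) (η : E) :
    Q.avg f η = ∑' ζ, f ζ * Q.jumpKernel η {ζ} := lintegral_countable' f

theorem wavg_add (m f g : E → ℝ≥0∞) : Q.wavg m (f + g) = Q.wavg m f + Q.wavg m g := by
  funext η; simp [RateMatrix.wavg, avg_add, mul_add]

theorem wavg_mono {m m' f g : E → ℝ≥0∞} (hm : m ≤ m') (h : f ≤ g) : Q.wavg m f ≤ Q.wavg m' g :=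
  fun η => mul_le_mul' (hm η) (avg_mono Q h η)

theorem wavg_iterate_mono {m m' f g : E → ℝ≥0∞} (hm : m ≤ m') (h : f ≤ g) (n : ℕ) :
    (Q.wavg m)^[n] f ≤ (Q.wavg m')^[n] g := by
  induction n with
  | zero => exact h
  | succ n ih => simp only [Function.iterate_succ_apply']; exact wavg_mono Q hm ih

theorem wavg_iterate_add (m f g : E → ℝ≥0∞) (n : ℕ) :
    (Q.wavg m)^[n] (f + g) = (Q.wavg m)^[n] f + (Q.wavg m)^[n] g := by
  induction n with
  | zero => rfl
  | succ n ih => simp only [Function.iterate_succ_apply', ih, wavg_add]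

theorem wavg_iterate_const_mul (m : E → ℝ≥0∞) (c : ℝ≥0∞) (f : E → ℝ≥0∞) (n : ℕ) :
    (Q.wavg m)^[n] (fun ζ => c * f ζ) = fun ζ => c * (Q.wavg m)^[n] f ζ := by
  induction n with
  | zero => rfl
  | succ n ih =>
    simp only [Function.iterate_succ_apply', ih]
    funext η
    rw [RateMatrix.wavg, avg_const_mul, RateMatrix.wavg, mul_left_comm]

theorem wavg_iterate_tsum {ι : Type*} [Countable ι] (m : E → ℝ≥0∞) (f : ι → E → ℝ≥0∞) (n : ℕ) :
    (Q.wavg m)^[n] (fun ζ => ∑' i, f i ζ) = fun ζ => ∑' i, (Q.wavg m)^[n] (f i) ζ := by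
  induction n with
  | zero => rfl
  | succ n ih =>
    simp only [Function.iterate_succ_apply', ih]
    funext η
    rw [RateMatrix.wavg, avg_tsum, ← ENNReal.tsum_mul_left]
    rfl

theorem wavg_iterate_one_le {m : E → ℝ≥0∞} (hm : m ≤ 1) (n : ℕ) :
    (Q.wavg m)^[n] 1 ≤ 1 := by
  induction n with
  | zero => exact le_rfl
  | succ n ih =>
    rw [Function.iterate_succ_apply']
    intro η
    exact (mul_le_mul' (hm η) (avg_le_const Q ih η)).trans (one_mul _).le

/-- The potential `∑ₙ (m P)ⁿ f` of the jump chain with transition operator `P`. -/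
def RateMatrix.pot (m f : E → ℝ≥0∞) (η : E) : ℝ≥0∞ := ∑' n, (Q.wavg m)^[n] f η

theorem pot_eq (m f : E → ℝ≥0∞) : Q.pot m f = f + Q.wavg m (Q.pot m f) := by
  funext η
  rw [RateMatrix.pot, tsum_eq_zero_add' ENNReal.summable, Pi.add_apply, RateMatrix.wavg]
  simp only [Function.iterate_succ_apply', Function.iterate_zero, id]
  rw [show Q.pot m f = fun ζ => ∑' n, (Q.wavg m)^[n] f ζ from rfl, avg_tsum,
    ← ENNReal.tsum_mul_left]
  rfl

theorem pot_eq' (m f : E → ℝ≥0∞) : Q.pot m f = f + Q.pot m (Q.wavg m f) := by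
  funext η
  rw [RateMatrix.pot, tsum_eq_zero_add' ENNReal.summable, Pi.add_apply, RateMatrix.pot]
  simp only [Function.iterate_succ_apply, Function.iterate_zero, id]

theorem pot_add (m f g : E → ℝ≥0∞) : Q.pot m (f + g) = Q.pot m f + Q.pot m g := by
  funext η
  simp only [RateMatrix.pot, wavg_iterate_add, Pi.add_apply]
  exact ENNReal.tsum_add

theorem pot_mono {m m' f g : E → ℝ≥0∞} (hm : m ≤ m') (h : f ≤ g) : Q.pot m f ≤ Q.pot m' g :=
  fun η => ENNReal.tsum_le_tsum fun n => wavg_iterate_mono Q hm h n η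

theorem pot_const_mul (m : E → ℝ≥0∞) (c : ℝ≥0∞) (f : E → ℝ≥0∞) (η : E) :
    Q.pot m (fun ζ => c * f ζ) η = c * Q.pot m f η := by
  simp only [RateMatrix.pot, wavg_iterate_const_mul]
  exact ENNReal.tsum_mul_left

theorem pot_tsum {ι : Type*} [Countable ι] (m : E → ℝ≥0∞) (f : ι → E → ℝ≥0∞) (η : E) :
    Q.pot m (fun ζ => ∑' i, f i ζ) η = ∑' i, Q.pot m (f i) η := by
  simp only [RateMatrix.pot, wavg_iterate_tsum]
  exact ENNReal.tsum_comm

theorem sum_range_succ_wavg (m f : E → ℝ≥0∞) (n : ℕ) :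
    ∑ k ∈ Finset.range (n + 1), (Q.wavg m)^[k] f =
      f + Q.wavg m (∑ k ∈ Finset.range n, (Q.wavg m)^[k] f) := by
  induction n with
  | zero =>
    have : Q.wavg m 0 = 0 := by funext η; simp [RateMatrix.wavg, RateMatrix.avg]
    simp [this]
  | succ n ih =>
    rw [Finset.sum_range_succ, ih, add_assoc, Function.iterate_succ_apply', ← wavg_add,
      ← Finset.sum_range_succ, ih]

theorem pot_le_of_sum_le {m f v : E → ℝ≥0∞}
    (h : ∀ n, ∑ k ∈ Finset.range n, (Q.wavg m)^[k] f ≤ v) : Q.pot m f ≤ v := by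
  intro η
  rw [RateMatrix.pot, ENNReal.tsum_eq_iSup_nat]
  refine iSup_le fun n => ?_
  simpa using h n η

theorem sum_le_pot (m f : E → ℝ≥0∞) (n : ℕ) :
    ∑ k ∈ Finset.range n, (Q.wavg m)^[k] f ≤ Q.pot m f := by
  intro η
  rw [Finset.sum_apply]
  exact ENNReal.sum_le_tsum (f := fun k => (Q.wavg m)^[k] f η) (Finset.range n)

/-- The potential `pot m f` is the smallest solution of `v ≥ f + m P v`. -/
theorem pot_le_of_le {m f v : E → ℝ≥0∞} (h : f + Q.wavg m v ≤ v) : Q.pot m f ≤ v := by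
  refine pot_le_of_sum_le Q fun n => ?_
  induction n with
  | zero => simp
  | succ n ih =>
    rw [sum_range_succ_wavg]
    exact (add_le_add le_rfl (wavg_mono Q le_rfl ih)).trans h

/-- A function that vanishes at infinity along the chain and solves `h + a = s + m P h` is
recovered from the potentials of `a` and `s`. -/
theorem add_pot_eq_pot {m h a s : E → ℝ≥0∞} (heq : h + a = s + Q.wavg m h) {η : E}
    (hlim : Tendsto (fun n => (Q.wavg m)^[n] h η) atTop (𝓝 0)) :
    h η + Q.pot m a η = Q.pot m s η := by
  have key : ∀ n, h + ∑ k ∈ Finset.range n, (Q.wavg m)^[k] a =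
      ∑ k ∈ Finset.range n, (Q.wavg m)^[k] s + (Q.wavg m)^[n] h := by
    intro n
    induction n with
    | zero => simp
    | succ n ih =>
      rw [sum_range_succ_wavg, sum_range_succ_wavg, ← add_assoc, heq, add_assoc, ← wavg_add, ih,
        wavg_add, Function.iterate_succ_apply', add_assoc]
  have h1 : Tendsto (fun n => h η + ∑ k ∈ Finset.range n, (Q.wavg m)^[k] a η) atTop
      (𝓝 (h η + Q.pot m a η)) :=
    (ENNReal.tendsto_nat_tsum _).const_add _
  have h2 : Tendsto (fun n => ∑ k ∈ Finset.range n, (Q.wavg m)^[k] s η + (Q.wavg m)^[n] h η) atTop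
      (𝓝 (Q.pot m s η + 0)) :=
    (ENNReal.tendsto_nat_tsum _).add hlim
  rw [add_zero] at h2
  refine tendsto_nhds_unique h1 (h2.congr fun n => ?_)
  have := congrFun (key n) η
  simp only [Pi.add_apply, Finset.sum_apply] at this
  exact this.symm

theorem tendsto_iterate_of_le {m h : E → ℝ≥0∞} {c : ℝ≥0∞} (hc : c ≠ ∞) (hh : ∀ η, h η ≤ c) {η : E}
    (hlim : Tendsto (fun n => (Q.wavg m)^[n] 1 η) atTop (𝓝 0)) :
    Tendsto (fun n => (Q.wavg m)^[n] h η) atTop (𝓝 0) := by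
  have h1 : ∀ n, (Q.wavg m)^[n] h η ≤ c * (Q.wavg m)^[n] 1 η := by
    intro n
    have := wavg_iterate_mono Q (le_refl m) (f := h) (g := fun ζ => c * (1 : E → ℝ≥0∞) ζ)
      (fun ζ => by simpa using hh ζ) n η
    rwa [wavg_iterate_const_mul] at this
  refine tendsto_of_tendsto_of_tendsto_of_le_of_le tendsto_const_nhds ?_ (fun _ => zero_le) h1
  simpa using ENNReal.Tendsto.const_mul hlim (Or.inr hc)

/-! ### Recurrence -/

theorem hold_pos_of_rate_pos {a b : E} (hab : a ≠ b) (h : 0 < Q.rate a b) : 0 < Q.hold a := by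
  classical
  have h1 := ((Q.hasSum_rate a).update a 0)
  have h2 : Function.update (Q.rate a) a 0 b ≤ 0 - Q.rate a a + 0 := by
    refine le_hasSum (a := 0 - Q.rate a a + 0) (by convert h1 using 1) b fun j _ => ?_
    by_cases hj : j = a
    · simp [hj]
    · simpa [hj] using Q.rate_nonneg a j (Ne.symm hj)
  rw [Function.update_of_ne hab.symm] at h2
  unfold RateMatrix.hold
  linarith

theorem jumpKernel_singleton {a : E} (h : Q.hold a ≠ 0) (b : E) :
    Q.jumpKernel a {b} = ENNReal.ofReal (Q.jumpProb a b) := by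
  change (Q.jumpPMF a).toMeasure {b} = _
  rw [PMF.toMeasure_apply_singleton _ _ (measurableSet_singleton b)]
  exact congrArg (fun p : PMF E => p b) (dif_neg h)

theorem jumpKernel_pos {a b : E} (hab : a ≠ b) (h : 0 < Q.rate a b) :
    0 < Q.jumpKernel a {b} := by
  have h1 := hold_pos_of_rate_pos Q hab h
  rw [jumpKernel_singleton Q h1.ne']
  simp only [RateMatrix.jumpProb, if_neg hab.symm]
  exact ENNReal.ofReal_pos.mpr (div_pos h h1)

/-- The indicator of the complement of a point. -/
def avoid (a : E) : E → ℝ≥0∞ := ({a}ᶜ : Set E).indicator 1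

/-- The indicator of a point. -/
def point (a : E) : E → ℝ≥0∞ := ({a} : Set E).indicator 1

@[simp] theorem avoid_self (a : E) : avoid a a = 0 := by simp [avoid]
@[simp] theorem point_self (a : E) : point a a = 1 := by simp [point]
theorem avoid_of_ne {a b : E} (h : b ≠ a) : avoid a b = 1 := by simp [avoid, h]
theorem point_of_ne {a b : E} (h : b ≠ a) : point a b = 0 := by simp [point, h]

/-- Every state is visited again, almost surely, by the jump chain that starts from it. -/
def RateMatrix.IsRecurrent : Prop := ∀ a, Q.avg (Q.pot (avoid a) (point a)) a = 1

theorem pot_point_le_one (a : E) : Q.pot (avoid a) (point a) ≤ 1 := by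
  refine pot_le_of_le Q fun η => ?_
  by_cases h : η = a
  · subst h; simp [RateMatrix.wavg]
  · simp only [Pi.add_apply, point_of_ne h, zero_add, RateMatrix.wavg, avoid_of_ne h, one_mul]
    exact (avg_const Q 1 η).le

/-- Maximum principle: `1 - f` is nonnegative with zero mean, hence vanishes at every point that is
charged. -/
theorem eq_one_of_avg_eq_one {f : E → ℝ≥0∞} (hf : f ≤ 1) {a b : E} (h : Q.avg f a = 1)
    (hab : 0 < Q.jumpKernel a {b}) : f b = 1 := by
  by_contra hne
  have hlt : f b < 1 := lt_of_le_of_ne (hf b) hne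
  have h1 : ∫⁻ ζ, (1 - f ζ) ∂Q.jumpKernel a = 0 := by
    rw [lintegral_sub Measurable.of_discrete]
    · change ∫⁻ _, 1 ∂_ - Q.avg f a = 0
      rw [h]; simp
    · change Q.avg f a ≠ ∞
      rw [h]; simp
    · exact .of_forall hf
  rw [lintegral_countable', ENNReal.tsum_eq_zero] at h1
  have := h1 b
  rw [mul_eq_zero] at this
  rcases this with h2 | h2
  · exact (tsub_pos_of_lt hlt).ne' h2
  · exact hab.ne' h2

variable {Q}

/-- The probability of hitting `a` is harmonic everywhere, at `a` itself by recurrence, and attains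
its maximum one at `a`. The maximum principle carries the value one along paths that start from `a`.
-/
theorem pot_point_eq_one (hirr : Q.IsIrreducible) (hrec : Q.IsRecurrent) (a : E) :
    Q.pot (avoid a) (point a) = 1 := by
  set ρ := Q.pot (avoid a) (point a) with hρ
  have h1 : ρ a = 1 := by
    rw [hρ, pot_eq]; simp [RateMatrix.wavg]
  have h2 : ∀ η, Q.avg ρ η = ρ η := by
    intro η
    by_cases h : η = a
    · subst h; rw [h1]; exact hrec η
    · conv_rhs => rw [hρ, pot_eq]
      simp [point_of_ne h, RateMatrix.wavg, avoid_of_ne h, hρ]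
  funext η
  induction hirr a η with
  | refl => exact h1
  | tail _ hbc ih =>
    exact eq_one_of_avg_eq_one Q (pot_point_le_one Q a) ((h2 _).trans ih)
      (jumpKernel_pos Q hbc.1 hbc.2)

/-- The iterate is at most the probability that the first `n` states avoid `a`, that is, one minus
the partial sum of the series for the hitting probability. This supplies the vanishing condition of
`add_pot_eq_pot`. -/
theorem tendsto_iterate_one (hirr : Q.IsIrreducible) (hrec : Q.IsRecurrent) {a : E}
    {m : E → ℝ≥0∞} (hm : m ≤ avoid a) (η : E) :
    Tendsto (fun n => (Q.wavg m)^[n] 1 η) atTop (𝓝 0) := by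
  have h1 : ∀ n, (∑ k ∈ Finset.range n, (Q.wavg (avoid a))^[k] (point a)) +
      (Q.wavg (avoid a))^[n] 1 = 1 := by
    intro n
    induction n with
    | zero => simp
    | succ n ih =>
      rw [sum_range_succ_wavg, Function.iterate_succ_apply', add_assoc, ← wavg_add, ih]
      funext ζ
      simp only [Pi.add_apply, RateMatrix.wavg, Pi.one_apply]
      rw [show Q.avg 1 ζ = 1 from avg_const Q 1 ζ]
      by_cases h : ζ = a
      · subst h; simp
      · simp [point_of_ne h, avoid_of_ne h]
  have h2 : Tendsto (fun n => ∑ k ∈ Finset.range n, (Q.wavg (avoid a))^[k] (point a) η) atTop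
      (𝓝 1) := by
    have := congrFun (pot_point_eq_one hirr hrec a) η
    rw [Pi.one_apply] at this
    rw [← this]
    exact ENNReal.tendsto_nat_tsum _
  have h3 : Tendsto (fun n => 1 - ∑ k ∈ Finset.range n, (Q.wavg (avoid a))^[k] (point a) η) atTop
      (𝓝 0) := by
    simpa using ENNReal.Tendsto.sub (tendsto_const_nhds (x := (1 : ℝ≥0∞))) h2 (Or.inl (by simp))
  refine tendsto_of_tendsto_of_tendsto_of_le_of_le tendsto_const_nhds h3 (fun _ => zero_le) ?_
  intro n
  refine (wavg_iterate_mono Q hm le_rfl n η).trans ?_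
  have := congrFun (h1 n) η
  simp only [Pi.add_apply, Finset.sum_apply, Pi.one_apply] at this
  refine ENNReal.le_sub_of_add_le_left (ne_top_of_le_ne_top ENNReal.one_ne_top ?_) this.le
  rw [← this]; exact le_self_add

/-- If the weights are smaller than one at some state, the weighted mass vanishes. -/
theorem tendsto_iterate_one_of_lt (hirr : Q.IsIrreducible) (hrec : Q.IsRecurrent) {a : E}
    {m : E → ℝ≥0∞} (hm : m ≤ 1) (ha : m a < 1) (η : E) :
    Tendsto (fun n => (Q.wavg m)^[n] 1 η) atTop (𝓝 0) := by
  have hanti : ∀ ζ, Antitone fun n => (Q.wavg m)^[n] 1 ζ := by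
    intro ζ
    refine antitone_nat_of_succ_le fun n => ?_
    rw [Function.iterate_succ_apply]
    exact wavg_iterate_mono Q le_rfl (wavg_iterate_one_le Q hm 1) n ζ
  -- The decreasing limit `d` satisfies `d = m P d`. Recurrence at `a` yields `d ≤ d a`, and then `d
  -- a ≤ m a * d a` with `m a < 1` forces `d a = 0`.
  set d : E → ℝ≥0∞ := fun ζ => ⨅ n, (Q.wavg m)^[n] 1 ζ with hd
  have hd1 : d ≤ 1 := fun ζ => iInf_le _ 0
  have hdeq : ∀ ζ, d ζ = m ζ * Q.avg d ζ := by
    intro ζ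
    have h1 : Tendsto (fun n => Q.avg ((Q.wavg m)^[n] 1) ζ) atTop (𝓝 (Q.avg d ζ)) := by
      refine tendsto_lintegral_of_dominated_convergence (fun _ => 1)
        (fun n => Measurable.of_discrete) (fun n => .of_forall (wavg_iterate_one_le Q hm n)) (by simp)
        (.of_forall fun b => tendsto_atTop_iInf (hanti b))
    have h2 : Tendsto (fun n => (Q.wavg m)^[n + 1] 1 ζ) atTop (𝓝 (m ζ * Q.avg d ζ)) := by
      simp only [Function.iterate_succ_apply']
      exact ENNReal.Tendsto.const_mul h1 (Or.inr (ne_top_of_le_ne_top ENNReal.one_ne_top (hm ζ)))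
    exact tendsto_nhds_unique ((tendsto_add_atTop_iff_nat 1).mpr (tendsto_atTop_iInf (hanti ζ))) h2
  have hle : ∀ ζ, d ζ ≤ d a := by
    intro ζ
    -- The chain is run until it meets `a`: since `m ≤ 1`, the function `d` is at most its average
    -- one step later, and the mass that has not met `a` within `n` steps carries a value at most
    -- one.
    have h1 : ∀ n, ∀ b, d b ≤ d a + (Q.wavg (avoid a))^[n] 1 b := by
      intro n
      induction n with
      | zero => intro b; exact (hd1 b).trans le_add_self
      | succ n ih =>
        intro b
        by_cases hb : b = a
        · rw [hb]; exact le_self_add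
        · rw [Function.iterate_succ_apply', RateMatrix.wavg, avoid_of_ne hb, one_mul, hdeq]
          calc m b * Q.avg d b ≤ 1 * Q.avg ((fun _ => d a) + (Q.wavg (avoid a))^[n] 1) b :=
                mul_le_mul' (hm b) (avg_mono Q ih b)
            _ = _ := by rw [one_mul, avg_add, Pi.add_apply, avg_const]
    refine ge_of_tendsto' (f := fun n => d a + (Q.wavg (avoid a))^[n] 1 ζ) (x := atTop) ?_ (fun n => h1 n ζ)
    simpa using (tendsto_iterate_one hirr hrec le_rfl ζ).const_add (d a)
  have h0 : d a = 0 := by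
    by_contra hne
    have hfin : d a ≠ ∞ := ne_top_of_le_ne_top ENNReal.one_ne_top (hd1 a)
    have h1 : d a ≤ m a * d a := by
      conv_lhs => rw [hdeq]
      exact mul_le_mul' le_rfl (avg_le_const Q hle a)
    have h2 : m a * d a < 1 * d a := ENNReal.mul_lt_mul_left hne hfin ha
    rw [one_mul] at h2
    exact absurd h1 (not_le.mpr h2)
  have h1 : d η = 0 := le_antisymm ((hle η).trans h0.le) zero_le
  rw [← h1]
  exact tendsto_atTop_iInf (hanti η)

/-! ### Mean values over a cycle -/

variable (Q) in
/-- Mean of the sum of `s` along a cycle of the jump chain that starts and ends at `a`. -/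
def RateMatrix.cyc (a : E) (s : E → ℝ≥0∞) : ℝ≥0∞ :=
  s a + Q.avg (Q.pot (avoid a) (fun ζ => avoid a ζ * s ζ)) a

theorem cyc_add (a : E) (f g : E → ℝ≥0∞) : Q.cyc a (f + g) = Q.cyc a f + Q.cyc a g := by
  simp only [RateMatrix.cyc, Pi.add_apply, mul_add]
  rw [show (fun ζ => avoid a ζ * f ζ + avoid a ζ * g ζ) =
    (fun ζ => avoid a ζ * f ζ) + (fun ζ => avoid a ζ * g ζ) from rfl, pot_add, avg_add,
    Pi.add_apply]
  ring

theorem cyc_const_mul (a : E) (c : ℝ≥0∞) (f : E → ℝ≥0∞) :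
    Q.cyc a (fun ζ => c * f ζ) = c * Q.cyc a f := by
  simp only [RateMatrix.cyc, mul_left_comm _ c]
  rw [show Q.pot (avoid a) (fun ζ => c * (avoid a ζ * f ζ)) =
    fun ζ => c * Q.pot (avoid a) (fun ζ => avoid a ζ * f ζ) ζ from
      funext fun ζ => pot_const_mul Q _ _ _ _, avg_const_mul]
  ring

theorem cyc_tsum {ι : Type*} [Countable ι] (a : E) (f : ι → E → ℝ≥0∞) :
    Q.cyc a (fun ζ => ∑' i, f i ζ) = ∑' i, Q.cyc a (f i) := by
  simp only [RateMatrix.cyc, ← ENNReal.tsum_mul_left]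
  rw [show Q.pot (avoid a) (fun ζ => ∑' i, avoid a ζ * f i ζ) =
    fun ζ => ∑' i, Q.pot (avoid a) (fun ζ => avoid a ζ * f i ζ) ζ from
      funext fun ζ => pot_tsum Q _ _ _, avg_tsum, ENNReal.tsum_add]

/-- A shift by one step exchanges the visit to `a` at the beginning of the cycle for the one at its
end. Recurrence is what makes the cycle end at `a` with probability one. -/
theorem cyc_avg (hrec : Q.IsRecurrent) (a : E) (s : E → ℝ≥0∞) :
    Q.cyc a (Q.avg s) = Q.cyc a s := by
  set g : E → ℝ≥0∞ := fun ζ => avoid a ζ * s ζ with hg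
  have hs : s = g + fun ζ => s a * point a ζ := by
    funext ζ
    by_cases h : ζ = a
    · subst h; simp [hg]
    · simp [hg, avoid_of_ne h, point_of_ne h]
  have h1 : ∀ f : E → ℝ≥0∞, Q.cyc a (Q.avg f) = Q.avg (Q.pot (avoid a) f) a := by
    intro f
    conv_rhs => rw [pot_eq', avg_add]
    rfl
  have h2 : Q.avg (Q.pot (avoid a) (fun ζ => s a * point a ζ)) a = s a := by
    rw [show Q.pot (avoid a) (fun ζ => s a * point a ζ) = fun ζ => s a * Q.pot (avoid a) (point a) ζ
      from funext fun ζ => pot_const_mul Q _ _ _ _, avg_const_mul, hrec a, mul_one]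
  rw [h1, hs, pot_add, avg_add, Pi.add_apply, h2, add_comm, ← hs]
  rfl

theorem tsum_avg {π : E → ℝ≥0∞} (hπ : ∀ ζ, ∑' η, π η * Q.jumpKernel η {ζ} = π ζ)
    (f : E → ℝ≥0∞) : ∑' η, π η * Q.avg f η = ∑' η, π η * f η := by
  simp_rw [avg_eq_tsum, ← ENNReal.tsum_mul_left]
  rw [ENNReal.tsum_comm]
  refine tsum_congr fun ζ => ?_
  rw [← hπ ζ, ← ENNReal.tsum_mul_right]
  exact tsum_congr fun η => by ring

/-- Each use of the invariance of `π` splits off the mass that sits at `a` and pushes the rest one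
step further. Dropping the nonnegative remainder after `n` steps gives the inequality. -/
theorem mul_cyc_le {π : E → ℝ≥0∞} (hπ : ∀ ζ, ∑' η, π η * Q.jumpKernel η {ζ} = π ζ) (a : E)
    (s : E → ℝ≥0∞) : π a * Q.cyc a s ≤ ∑' η, π η * s η := by
  classical
  set g : E → ℝ≥0∞ := fun ζ => avoid a ζ * s ζ with hg
  have hsplit : ∀ f : E → ℝ≥0∞, ∑' η, π η * f η = π a * f a + ∑' η, π η * (avoid a η * f η) := by
    intro f
    rw [ENNReal.tsum_eq_add_tsum_ite a]
    congr 1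
    refine tsum_congr fun ζ => ?_
    by_cases h : ζ = a
    · subst h; simp
    · simp [h, avoid_of_ne h]
  have hstep : ∀ f : E → ℝ≥0∞, ∑' η, π η * f η = π a * Q.avg f a + ∑' η, π η * Q.wavg (avoid a) f η := by
    intro f
    rw [← tsum_avg hπ f, hsplit]; rfl
  have hn : ∀ n, ∑' η, π η * g η =
      π a * Q.avg (∑ k ∈ Finset.range n, (Q.wavg (avoid a))^[k] g) a +
        ∑' η, π η * (Q.wavg (avoid a))^[n] g η := by
    intro n
    induction n with
    | zero => simp [RateMatrix.avg]
    | succ n ih =>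
      rw [ih, hstep ((Q.wavg (avoid a))^[n] g), Finset.sum_range_succ, avg_add, Pi.add_apply, mul_add,
        add_assoc, Function.iterate_succ_apply']
  have hle : π a * Q.avg (Q.pot (avoid a) g) a ≤ ∑' η, π η * g η := by
    rw [show Q.pot (avoid a) g = fun ζ => ∑' n, (Q.wavg (avoid a))^[n] g ζ from rfl, avg_tsum,
      ENNReal.tsum_eq_iSup_nat, ENNReal.mul_iSup]
    refine iSup_le fun n => ?_
    rw [hn n]
    refine le_trans (le_of_eq ?_) le_self_add
    congr 1
    clear hn
    induction n with
    | zero => simp [RateMatrix.avg]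
    | succ n ih => rw [Finset.sum_range_succ, ih, Finset.sum_range_succ, avg_add, Pi.add_apply]
  rw [hsplit s, RateMatrix.cyc, mul_add]
  exact add_le_add le_rfl hle

theorem exists_iterate_avg_pos (hirr : Q.IsIrreducible) (η a : E) :
    ∃ n, 0 < (Q.avg)^[n] (point a) η := by
  induction hirr η a using Relation.ReflTransGen.head_induction_on with
  | refl => exact ⟨0, by simp⟩
  | head hbc _ ih =>
    obtain ⟨n, hn⟩ := ih
    refine ⟨n + 1, ?_⟩
    rw [Function.iterate_succ_apply', avg_eq_tsum]
    refine lt_of_lt_of_le (ENNReal.mul_pos hn.ne' (jumpKernel_pos Q hbc.1 hbc.2).ne') (ENNReal.le_tsum _)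

/-- The cycle formula for an invariant measure of the jump chain. -/
theorem tsum_eq_mul_cyc (hirr : Q.IsIrreducible) (hrec : Q.IsRecurrent) {π : E → ℝ≥0∞}
    (hπ : ∀ ζ, ∑' η, π η * Q.jumpKernel η {ζ} = π ζ) (hfin : ∀ ζ, π ζ ≠ ∞) (a : E)
    (s : E → ℝ≥0∞) : ∑' η, π η * s η = π a * Q.cyc a s := by
  classical
  have hpt : ∀ b, ∑' η, π η * point b η = π b := by
    intro b
    rw [tsum_eq_single b fun ζ h => by simp [point_of_ne h]]
    simp
  have hcyca : Q.cyc a (point a) = 1 := by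
    have : (fun ζ => avoid a ζ * point a ζ) = fun _ => 0 := by
      funext ζ
      by_cases h : ζ = a
      · subst h; simp
      · simp [point_of_ne h]
    have h0 : Q.pot (avoid a) (fun _ => 0) ≤ fun _ => 0 :=
      pot_le_of_le Q fun ζ => by simp [RateMatrix.wavg, RateMatrix.avg]
    rw [RateMatrix.cyc, this, point_self]
    have := avg_mono Q h0 a
    rw [avg_const] at this
    rw [le_antisymm this zero_le, add_zero]
  -- The functionals `π` and `π a * cyc a` agree on `f = Pⁿ 1_a`, because both are invariant under
  -- `P` and agree on `1_a`. The second never exceeds the first, and `f b > 0`, so they agree on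
  -- `1_b`.
  have hpoint : ∀ b, π b = π a * Q.cyc a (point b) := by
    intro b
    obtain ⟨n, hn⟩ := exists_iterate_avg_pos hirr b a
    set f := (Q.avg)^[n] (point a) with hf
    have h1 : ∑' η, π η * f η = π a := by
      rw [hf]
      clear hn hf
      induction n with
      | zero => exact hpt a
      | succ n ih => rw [Function.iterate_succ_apply']; rw [tsum_avg hπ]; exact ih
    have h2 : Q.cyc a f = 1 := by
      rw [hf]
      clear hn hf h1
      induction n with
      | zero => exact hcyca
      | succ n ih => rw [Function.iterate_succ_apply']; rw [cyc_avg hrec]; exact ih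
    have hsplit : f = (fun ζ => f b * point b ζ) + fun ζ => avoid b ζ * f ζ := by
      funext ζ
      by_cases h : ζ = b
      · subst h; simp
      · simp [avoid_of_ne h, point_of_ne h]
    have hA : ∑' η, π η * f η = f b * π b + ∑' η, π η * (avoid b η * f η) := by
      conv_lhs => rw [hsplit]
      simp only [Pi.add_apply, mul_add, ENNReal.tsum_add]
      congr 1
      rw [← hpt b, ← ENNReal.tsum_mul_left]
      exact tsum_congr fun ζ => by ring
    have hB : π a * Q.cyc a f = f b * (π a * Q.cyc a (point b)) +
        π a * Q.cyc a (fun ζ => avoid b ζ * f ζ) := by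
      conv_lhs => rw [hsplit]
      rw [cyc_add, cyc_const_mul]
      ring
    have hle := mul_cyc_le hπ a (point b)
    rw [hpt] at hle
    refine le_antisymm ?_ hle
    have hle2 := mul_cyc_le hπ a (fun ζ => avoid b ζ * f ζ)
    have htot : f b * π b + ∑' η, π η * (avoid b η * f η) =
        f b * (π a * Q.cyc a (point b)) + π a * Q.cyc a (fun ζ => avoid b ζ * f ζ) := by
      rw [← hA, ← hB, h1, h2, mul_one]
    have hfb : f b ≠ ∞ := by
      have : f b * π b ≤ π a := by rw [← h1, hA]; exact le_self_add
      have hf1 : ∀ n, (Q.avg)^[n] (point a) ≤ 1 := by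
        intro n
        induction n with
        | zero => intro ζ; by_cases h : ζ = a <;> simp [point_of_ne, h]
        | succ n ih => rw [Function.iterate_succ_apply']; exact fun ζ => avg_le_const Q ih ζ
      exact ne_top_of_le_ne_top ENNReal.one_ne_top (hf1 n b)
    have hX : ∑' η, π η * (avoid b η * f η) ≠ ∞ := by
      refine ne_top_of_le_ne_top (hfin a) ?_
      rw [← h1, hA]; exact le_add_self
    -- The totals on `f` are equal and the part of `f` away from `b` is compared by `mul_cyc_le`, so
    -- the part at `b` satisfies the reverse inequality.
    have h3 : f b * π b ≤ f b * (π a * Q.cyc a (point b)) := by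
      refine (ENNReal.add_le_add_iff_right hX).mp ?_
      rw [htot]
      exact add_le_add le_rfl hle2
    exact (ENNReal.mul_le_mul_iff_right hn.ne' hfb).mp h3
  have hs : s = fun ζ => ∑' b, s b * point b ζ := by
    funext ζ
    rw [tsum_eq_single ζ fun b h => by simp [point_of_ne h.symm]]
    simp
  conv_rhs => rw [hs]
  rw [cyc_tsum, ← ENNReal.tsum_mul_left]
  refine tsum_congr fun b => ?_
  rw [cyc_const_mul]
  conv_lhs => rw [hpoint b]
  ring

end Potential

/-! ### Piecewise constant trajectories -/

section JumpPath

/-- The trajectory `e` visits the states `y 0, y 1, …`, the `n`-th one during `[J n, J (n + 1))`. -/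
structure JumpPath {α : Type*} (e : ℝ≥0 → α) (J : ℕ → ℝ≥0∞) (y : ℕ → α) : Prop where
  zero : J 0 = 0
  mono : Monotone J
  top : ⨆ n, J n = ∞
  eq : ∀ n (t : ℝ≥0), J n ≤ t → (t : ℝ≥0∞) < J (n + 1) → e t = y n

namespace JumpPath

variable {α : Type*} {e : ℝ≥0 → α} {J : ℕ → ℝ≥0∞} {y : ℕ → α}

theorem exists_index (h : JumpPath e J y) (t : ℝ≥0) :
    ∃ n, J n ≤ t ∧ (t : ℝ≥0∞) < J (n + 1) := by
  classical
  have h1 : ∃ n, (t : ℝ≥0∞) < J n := by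
    have : (t : ℝ≥0∞) < ⨆ n, J n := h.top ▸ ENNReal.coe_lt_top
    exact lt_iSup_iff.mp this
  have h2 := Nat.find_spec h1
  have h3 : Nat.find h1 ≠ 0 := by
    intro h0
    rw [h0, h.zero] at h2
    exact not_lt_zero h2
  obtain ⟨k, hk⟩ := Nat.exists_eq_succ_of_ne_zero h3
  refine ⟨k, not_lt.mp (Nat.find_min h1 (by omega)), ?_⟩
  rw [hk] at h2
  exact h2

theorem scale (h : JumpPath e J y) {θ : ℝ≥0} (hθ : 0 < θ) :
    JumpPath (fun t => e (t * θ)) (fun n => J n / θ) y where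
  zero := by simp [h.zero]
  mono := fun m n hmn => ENNReal.div_le_div_right (h.mono hmn) _
  top := by
    rw [← ENNReal.iSup_div, h.top]
    exact ENNReal.top_div_coe
  eq := by
    intro n t h1 h2
    have h0 : (θ : ℝ≥0∞) ≠ 0 := by exact_mod_cast hθ.ne'
    refine h.eq n _ ?_ ?_
    · rw [ENNReal.coe_mul]
      exact (ENNReal.div_le_iff h0 ENNReal.coe_ne_top).mp h1
    · rw [ENNReal.coe_mul]
      exact (ENNReal.lt_div_iff_mul_lt (.inl h0) (.inl ENNReal.coe_ne_top)).mp h2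

theorem volume_setOf (a b : ℝ≥0∞) :
    volume {s : ℝ | 0 ≤ s ∧ a ≤ ENNReal.ofReal s ∧ ENNReal.ofReal s < b} = b - a := by
  induction a with
  | top =>
    have : {s : ℝ | 0 ≤ s ∧ ∞ ≤ ENNReal.ofReal s ∧ ENNReal.ofReal s < b} = ∅ := by
      ext s; simp
    rw [this]; simp
  | coe a =>
    induction b with
    | top =>
      have : {s : ℝ | 0 ≤ s ∧ (a : ℝ≥0∞) ≤ ENNReal.ofReal s ∧ ENNReal.ofReal s < ∞} = Ici (a : ℝ) := by
        ext s
        simp only [mem_ofPred_eq, ENNReal.ofReal_lt_top, and_true, mem_Ici]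
        rw [ENNReal.ofReal, ENNReal.coe_le_coe]
        constructor
        · rintro ⟨h0, h1⟩
          rw [← Real.coe_toNNReal s h0]; exact_mod_cast h1
        · intro h1
          have h0 : 0 ≤ s := a.2.trans h1
          exact ⟨h0, NNReal.le_toNNReal_of_coe_le h1⟩
      rw [this]; simp
    | coe b =>
      have : {s : ℝ | 0 ≤ s ∧ (a : ℝ≥0∞) ≤ ENNReal.ofReal s ∧ ENNReal.ofReal s < b} =
          Ico (a : ℝ) b := by
        ext s
        simp only [mem_ofPred_eq, mem_Ico]
        rw [ENNReal.ofReal, ENNReal.coe_le_coe, ENNReal.coe_lt_coe]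
        constructor
        · rintro ⟨h0, h1, h2⟩
          rw [← Real.coe_toNNReal s h0]; exact ⟨by exact_mod_cast h1, by exact_mod_cast h2⟩
        · rintro ⟨h1, h2⟩
          have h0 : 0 ≤ s := a.2.trans h1
          exact ⟨h0, NNReal.le_toNNReal_of_coe_le h1, (Real.toNNReal_lt_iff_lt_coe h0).mpr h2⟩
      rw [this, Real.volume_Ico, ENNReal.ofReal_sub _ (NNReal.coe_nonneg a)]
      simp

theorem timeIntegral_eq (h : JumpPath e J y) (f : α → ℝ≥0∞) (T : ℝ≥0∞) :
    timeIntegral e f T = ∑' n, f (y n) * (min (J (n + 1)) T - min (J n) T) := by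
  set A : ℕ → Set ℝ := fun n =>
    {s | 0 ≤ s ∧ min (J n) T ≤ ENNReal.ofReal s ∧ ENNReal.ofReal s < min (J (n + 1)) T} with hA
  have hmeas : ∀ n, MeasurableSet (A n) := fun n =>
    (measurableSet_le measurable_const measurable_id).inter
      ((measurableSet_le measurable_const ENNReal.measurable_ofReal).inter
        (measurableSet_lt ENNReal.measurable_ofReal measurable_const))
  have hAJ : ∀ n, ∀ s ∈ A n, J n ≤ ENNReal.ofReal s ∧ ENNReal.ofReal s < J (n + 1) ∧
      ENNReal.ofReal s < T := by
    rintro n s ⟨_, h1, h2⟩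
    obtain ⟨h3, h4⟩ := lt_min_iff.mp h2
    refine ⟨?_, h3, h4⟩
    rcases min_le_iff.mp h1 with h5 | h5
    · exact h5
    · exact absurd h4 (not_lt.mpr h5)
  have hU : {s : ℝ | 0 ≤ s ∧ ENNReal.ofReal s < T} = ⋃ n, A n := by
    ext s
    simp only [mem_iUnion]
    constructor
    · rintro ⟨h0, hT⟩
      obtain ⟨n, h1, h2⟩ := h.exists_index s.toNNReal
      exact ⟨n, h0, (min_le_left _ _).trans h1, lt_min h2 hT⟩
    · rintro ⟨n, hn⟩
      exact ⟨hn.1, (hAJ n s hn).2.2⟩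
  have hdisj : Pairwise (Function.onFun Disjoint A) := by
    have aux : ∀ m n, m < n → ∀ s, s ∈ A m → s ∉ A n := by
      intro m n hmn s hm hn
      have h1 := (hAJ m s hm).2.1
      have h2 := (hAJ n s hn).1
      exact absurd (h1.trans_le (h.mono hmn)) (not_lt.mpr h2)
    intro m n hmn
    refine Set.disjoint_left.mpr fun s hm hn => ?_
    rcases lt_or_gt_of_ne hmn with h1 | h1
    · exact aux m n h1 s hm hn
    · exact aux n m h1 s hn hm
  rw [timeIntegral, hU, lintegral_iUnion hmeas hdisj]
  refine tsum_congr fun n => ?_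
  have h1 : ∀ s ∈ A n, f (e s.toNNReal) = f (y n) := by
    intro s hs
    rw [h.eq n s.toNNReal (hAJ n s hs).1 (hAJ n s hs).2.1]
  rw [setLIntegral_congr_fun (hmeas n) h1, setLIntegral_const]
  congr 1
  exact volume_setOf _ _

theorem timeIntegral_index (h : JumpPath e J y) (f : α → ℝ≥0∞) (k : ℕ) :
    timeIntegral e f (J k) = ∑ n ∈ Finset.range k, f (y n) * (J (n + 1) - J n) := by
  rw [h.timeIntegral_eq, tsum_eq_sum (s := Finset.range k)]
  · refine Finset.sum_congr rfl fun n hn => ?_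
    have := Finset.mem_range.mp hn
    rw [min_eq_left (h.mono (by omega)), min_eq_left (h.mono (by omega))]
  · intro n hn
    have : k ≤ n := by simpa using hn
    rw [min_eq_right (h.mono (by omega)), min_eq_right (h.mono (by omega)), tsub_self, mul_zero]

theorem timeIntegral_top (h : JumpPath e J y) (f : α → ℝ≥0∞) :
    timeIntegral e f ∞ = ∑' n, f (y n) * (J (n + 1) - J n) := by
  rw [h.timeIntegral_eq]; simp

theorem hitTime_eq (h : JumpPath e J y) (hlt : ∀ n, J n < J (n + 1)) {A : Set α} {k : ℕ}
    (hk : y k ∈ A) (hmin : ∀ i < k, y i ∉ A) : hitTime e A = J k := by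
  refine le_antisymm ?_ ?_
  -- The infimum runs over strictly positive times, so for `k = 0` it is approached without being
  -- attained.
  · refine le_of_forall_gt_imp_ge_of_dense fun c hc => ?_
    obtain ⟨s, h1, h2⟩ := ENNReal.lt_iff_exists_nnreal_btwn.mp (lt_min hc (hlt k))
    obtain ⟨h3, h4⟩ := lt_min_iff.mp h2
    refine le_trans (iInf₂_le s ⟨?_, ?_⟩) h3.le
    · have : (0 : ℝ≥0∞) < s := zero_le.trans_lt h1
      exact_mod_cast this
    · rw [h.eq k s h1.le h4]; exact hk
  · refine le_iInf₂ fun s hs => ?_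
    obtain ⟨n, h1, h2⟩ := h.exists_index s
    refine le_trans (h.mono ?_) h1
    by_contra hn
    refine hmin n (by omega) ?_
    rw [← h.eq n s h1 h2]
    exact hs.2

theorem hitTime_eq_top (h : JumpPath e J y) {A : Set α} (hA : ∀ i, y i ∉ A) :
    hitTime e A = ∞ := by
  refine le_antisymm le_top (le_iInf₂ fun s hs => ?_)
  obtain ⟨n, h1, h2⟩ := h.exists_index s
  refine absurd hs.2 ?_
  rw [h.eq n s h1 h2]
  exact hA n

theorem prod_indicator_eq_one {A : Set α} {n : ℕ} (h : ∀ i < n, y i ∉ A) :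
    ∏ i ∈ Finset.range n, Aᶜ.indicator (1 : α → ℝ≥0∞) (y i) = 1 :=
  Finset.prod_eq_one fun i hi => by simp [h i (Finset.mem_range.mp hi)]

theorem prod_indicator_eq_zero {A : Set α} {n i : ℕ} (hi : i < n) (h : y i ∈ A) :
    ∏ i ∈ Finset.range n, Aᶜ.indicator (1 : α → ℝ≥0∞) (y i) = 0 :=
  Finset.prod_eq_zero (Finset.mem_range.mpr hi) (by simp [h])

/-- The product of indicators is one up to the first visit of `A` and zero after it, so the series
stops at the hitting time. In this multiplicative form its mean is a potential, by `mean_pot`. -/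
theorem timeIntegral_hitTime (h : JumpPath e J y) (hlt : ∀ n, J n < J (n + 1)) (f : α → ℝ≥0∞)
    (A : Set α) :
    timeIntegral e f (hitTime e A) =
      ∑' n, (∏ i ∈ Finset.range n, Aᶜ.indicator 1 (y i)) *
        (Aᶜ.indicator f (y n) * (J (n + 1) - J n)) := by
  classical
  by_cases hA : ∃ i, y i ∈ A
  · have hk := Nat.find_spec hA
    have hmin : ∀ i < Nat.find hA, y i ∉ A := fun i hi => Nat.find_min hA hi
    rw [h.hitTime_eq hlt hk hmin, h.timeIntegral_index, tsum_eq_sum (s := Finset.range (Nat.find hA))]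
    · refine Finset.sum_congr rfl fun n hn => ?_
      have hn := Finset.mem_range.mp hn
      rw [prod_indicator_eq_one fun i hi => hmin i (hi.trans hn), one_mul, indicator_of_mem]
      exact hmin n hn
    · intro n hn
      have hn : Nat.find hA ≤ n := by simpa using hn
      rcases hn.eq_or_lt with h1 | h1
      · rw [← h1, indicator_of_notMem (by simpa using hk)]; simp
      · rw [prod_indicator_eq_zero h1 hk]; simp
  · push Not at hA
    rw [h.hitTime_eq_top hA, h.timeIntegral_top]
    refine tsum_congr fun n => ?_
    rw [prod_indicator_eq_one fun i _ => hA i, one_mul, indicator_of_mem]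
    exact hA n

theorem exists_mem_of_returnTime_lt_top (h : JumpPath e J y) (h0 : 0 < J 1) {A : Set α}
    (hA : returnTime e A < ∞) : ∃ n, y (n + 1) ∈ A := by
  obtain ⟨s, hs⟩ := iInf_lt_iff.mp hA
  obtain ⟨⟨_, hsA, u, _, hus, hne⟩, _⟩ := iInf_lt_iff.mp hs
  obtain ⟨n, h1, h2⟩ := h.exists_index s
  obtain ⟨k, h3, h4⟩ := h.exists_index u
  -- A time at which the state differs from the initial one comes after the first jump; hence the
  -- later time `s` has a positive index.
  have hk : k ≠ 0 := by
    rintro rfl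
    refine hne ?_
    rw [h.eq 0 u h3 h4, h.eq 0 0 (by simp [h.zero]) (by simpa using h0)]
  have hkn : k ≤ n := by
    by_contra hlt
    have : J (n + 1) ≤ J k := h.mono (by omega)
    have h5 : (s : ℝ≥0∞) < u := h2.trans_le (this.trans h3)
    exact absurd hus (not_lt.mpr (by exact_mod_cast h5.le))
  obtain ⟨m, rfl⟩ := Nat.exists_eq_succ_of_ne_zero (show n ≠ 0 by omega)
  exact ⟨m, by rwa [h.eq _ s h1 h2] at hsA⟩

/-- The time spent in `A` during the first `n` sojourns. -/
def clock (J : ℕ → ℝ≥0∞) (y : ℕ → α) (A : Set α) (n : ℕ) : ℝ≥0∞ :=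
  ∑ i ∈ Finset.range n, A.indicator 1 (y i) * (J (i + 1) - J i)

theorem clock_succ (J : ℕ → ℝ≥0∞) (y : ℕ → α) (A : Set α) (n : ℕ) :
    clock J y A (n + 1) = clock J y A n + A.indicator 1 (y n) * (J (n + 1) - J n) :=
  Finset.sum_range_succ _ _

theorem clock_mono (J : ℕ → ℝ≥0∞) (y : ℕ → α) (A : Set α) : Monotone (clock J y A) :=
  monotone_nat_of_le_succ fun n => by rw [clock_succ]; exact le_self_add

theorem occupation_eq (h : JumpPath e J y) (A : Set α) {n : ℕ} {s : ℝ≥0∞} (h1 : J n ≤ s)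
    (h2 : s ≤ J (n + 1)) :
    occupation e A s = clock J y A n + A.indicator 1 (y n) * (s - J n) := by
  rw [occupation, h.timeIntegral_eq, tsum_eq_sum (s := Finset.range (n + 1)),
    Finset.sum_range_succ, min_eq_right h2, min_eq_left h1, clock]
  · congr 1
    refine Finset.sum_congr rfl fun i hi => ?_
    have hi := Finset.mem_range.mp hi
    rw [min_eq_left ((h.mono (by omega)).trans h1), min_eq_left ((h.mono (by omega)).trans h1)]
  · intro i hi
    have hi : n + 1 ≤ i := by simpa using hi
    rw [min_eq_right (h2.trans (h.mono (by omega))), min_eq_right (h2.trans (h.mono (by omega))),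
      tsub_self, mul_zero]

theorem occupation_mono (e : ℝ≥0 → α) (A : Set α) : Monotone (occupation e A) :=
  fun _ _ hst => lintegral_mono_set fun _ hu => ⟨hu.1, hu.2.trans_le hst⟩

/-- The clock of `A` increases strictly during sojourn `n`, so its state belongs to `A` and the
clock runs at unit speed there. The generalized inverse at `t` is therefore `J n` plus the excess of
`t` over the clock at `J n`; taking the supremum skips the excursions outside `A`. -/
theorem tracePath_eq (h : JumpPath e J y) (hlt : ∀ n, J n < J (n + 1)) (A : Set α) {n : ℕ}
    {t : ℝ≥0} (h1 : clock J y A n ≤ t) (h2 : (t : ℝ≥0∞) < clock J y A (n + 1)) :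
    tracePath e A t = some (y n) := by
  have hfin : J n ≠ ∞ := (hlt n).ne_top
  have hy : y n ∈ A := by
    by_contra hy
    rw [clock_succ, indicator_of_notMem hy, zero_mul, add_zero] at h2
    exact absurd h2 (not_lt.mpr h1)
  have hCfin : clock J y A n ≠ ∞ := ne_top_of_le_ne_top ENNReal.coe_ne_top h1
  set u : ℝ≥0∞ := t - clock J y A n with hu
  have hCu : clock J y A n + u = t := add_tsub_cancel_of_le h1
  have hufin : u ≠ ∞ := ne_top_of_le_ne_top ENNReal.coe_ne_top tsub_le_self
  have hult : J n + u < J (n + 1) := by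
    rw [clock_succ, indicator_of_mem hy, Pi.one_apply, one_mul, ← hCu] at h2
    have h3 : u < J (n + 1) - J n := (ENNReal.add_lt_add_iff_left hCfin).mp h2
    rw [add_comm]
    exact lt_tsub_iff_right.mp h3
  have hocc : ∀ s : ℝ≥0∞, J n ≤ s → s ≤ J (n + 1) → occupation e A s = clock J y A n + (s - J n) := by
    intro s h3 h4
    rw [h.occupation_eq A h3 h4, indicator_of_mem hy, Pi.one_apply, one_mul]
  have hinv : inverseOccupation e A t = J n + u := by
    refine le_antisymm (iSup₂_le fun s hs => ?_) ?_
    · by_contra hlt'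
      push Not at hlt'
      obtain ⟨s', h3, h4⟩ := exists_between (lt_min hlt' hult)
      obtain ⟨h5, h6⟩ := lt_min_iff.mp h4
      have h7 : occupation e A s' ≤ t := (occupation_mono e A h5.le).trans hs
      rw [hocc s' (le_self_add.trans h3.le) h6.le, ← hCu] at h7
      have h8 : s' - J n ≤ u := (ENNReal.add_le_add_iff_left hCfin).mp h7
      have h9 : s' ≤ J n + u := by rw [add_comm]; exact tsub_le_iff_right.mp h8
      exact absurd h3 (not_lt.mpr h9)
    · have hne : J n + u ≠ ∞ := ENNReal.add_ne_top.mpr ⟨hfin, hufin⟩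
      have h3 : occupation e A ((J n + u).toNNReal : ℝ≥0∞) ≤ t := by
        rw [ENNReal.coe_toNNReal hne, hocc _ le_self_add hult.le, ENNReal.add_sub_cancel_left hfin, hCu]
      have := le_iSup₂ (f := fun (s : ℝ≥0) (_ : occupation e A s ≤ t) => (s : ℝ≥0∞)) _ h3
      rwa [ENNReal.coe_toNNReal hne] at this
  have hne : J n + u ≠ ∞ := hult.ne_top
  rw [tracePath, hinv, if_neg hne, h.eq n]
  · rw [ENNReal.coe_toNNReal hne]; exact le_self_add
  · rw [ENNReal.coe_toNNReal hne]; exact hult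

theorem tracePath_jumpPath (h : JumpPath e J y) (hlt : ∀ n, J n < J (n + 1)) (A : Set α)
    (htop : ⨆ n, clock J y A n = ∞) :
    JumpPath (tracePath e A) (clock J y A) (fun n => some (y n)) where
  zero := by simp [clock]
  mono := clock_mono J y A
  top := htop
  eq := fun _ _ h1 h2 => h.tracePath_eq hlt A h1 h2

end JumpPath

end JumpPath

/-! ### Trajectories of the chain -/

section ChainPath

variable {E : Type*} (Q : RateMatrix E)

/-- The time of the `n`-th jump. -/
def RateMatrix.jumpTime (ω : (ℕ → E) × (ℕ → ℝ)) (n : ℕ) : ℝ≥0∞ :=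
  ∑ i ∈ Finset.range n, Q.holding ω i

theorem jumpTime_succ (ω : (ℕ → E) × (ℕ → ℝ)) (n : ℕ) :
    Q.jumpTime ω (n + 1) = Q.jumpTime ω n + Q.holding ω n := Finset.sum_range_succ _ _

theorem jumpTime_mono (ω : (ℕ → E) × (ℕ → ℝ)) : Monotone (Q.jumpTime ω) :=
  monotone_nat_of_le_succ fun n => by rw [jumpTime_succ]; exact le_self_add

theorem path_jumpPath {ω : (ℕ → E) × (ℕ → ℝ)} (h : ∑' n, Q.holding ω n = ∞) :
    JumpPath (Q.path ω) (Q.jumpTime ω) ω.1 where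
  zero := by simp [RateMatrix.jumpTime]
  mono := jumpTime_mono Q ω
  top := by rw [← h, ENNReal.tsum_eq_iSup_nat]; rfl
  eq := by
    intro n t h1 h2
    have : sInf {n : ℕ | (t : ℝ≥0∞) < ∑ i ∈ Finset.range (n + 1), Q.holding ω i} = n := by
      refine le_antisymm (Nat.sInf_le h2) ?_
      refine le_csInf ⟨n, h2⟩ fun k hk => ?_
      by_contra hkn
      have h3 : Q.jumpTime ω (k + 1) ≤ Q.jumpTime ω n := jumpTime_mono Q ω (by omega)
      exact absurd (h3.trans h1) (not_le.mpr hk)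
    rw [RateMatrix.path, this]

/-- Trajectories with positive exponential variables and without explosion. -/
def RateMatrix.Regular (ω : (ℕ → E) × (ℕ → ℝ)) : Prop :=
  (∀ n, 0 < ω.2 n) ∧ ∑' n, Q.holding ω n = ∞

variable {Q}

theorem holding_pos (ω : (ℕ → E) × (ℕ → ℝ)) {n : ℕ} (h : 0 < ω.2 n) : 0 < Q.holding ω n :=
  ENNReal.div_pos (ENNReal.ofReal_pos.mpr h).ne' ENNReal.ofReal_ne_top

theorem holding_ne_top (hpos : ∀ η, 0 < Q.hold η) (ω : (ℕ → E) × (ℕ → ℝ)) (n : ℕ) :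
    Q.holding ω n ≠ ∞ :=
  ENNReal.div_ne_top ENNReal.ofReal_ne_top (ENNReal.ofReal_pos.mpr (hpos _)).ne'

theorem jumpTime_ne_top (hpos : ∀ η, 0 < Q.hold η) (ω : (ℕ → E) × (ℕ → ℝ)) (n : ℕ) :
    Q.jumpTime ω n ≠ ∞ :=
  ENNReal.sum_ne_top.mpr fun i _ => holding_ne_top hpos ω i

theorem jumpTime_lt (hpos : ∀ η, 0 < Q.hold η) {ω : (ℕ → E) × (ℕ → ℝ)} (h : Q.Regular ω) (n : ℕ) :
    Q.jumpTime ω n < Q.jumpTime ω (n + 1) := by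
  rw [jumpTime_succ]
  exact ENNReal.lt_add_right (jumpTime_ne_top hpos ω n) (holding_pos ω (h.1 n)).ne'

theorem jumpTime_succ_sub (hpos : ∀ η, 0 < Q.hold η) (ω : (ℕ → E) × (ℕ → ℝ)) (n : ℕ) :
    Q.jumpTime ω (n + 1) - Q.jumpTime ω n = Q.holding ω n := by
  rw [jumpTime_succ, ENNReal.add_sub_cancel_left (jumpTime_ne_top hpos ω n)]

end ChainPath

/-! ### Exponential variables -/

section Exponential

/-- The function `exp (-a)` on `[0, ∞]`. -/
def en (a : ℝ≥0∞) : ℝ≥0∞ := EReal.exp (-(a : EReal))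

@[simp] theorem en_zero : en 0 = 1 := by simp [en]

@[simp] theorem en_top : en ∞ = 0 := by simp [en]

theorem en_ofReal {t : ℝ} (ht : 0 ≤ t) : en (ENNReal.ofReal t) = ENNReal.ofReal (Real.exp (-t)) := by
  rw [en, EReal.coe_ennreal_ofReal, max_eq_left ht, ← EReal.coe_neg, EReal.exp_coe]

theorem en_strictAnti : StrictAnti en := fun _ _ h =>
  EReal.exp_strictMono (EReal.neg_lt_neg_iff.mpr (EReal.coe_ennreal_lt_coe_ennreal_iff.mpr h))

theorem en_antitone : Antitone en := en_strictAnti.antitone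

theorem en_le_one (a : ℝ≥0∞) : en a ≤ 1 := en_zero ▸ en_antitone zero_le

theorem en_ne_top (a : ℝ≥0∞) : en a ≠ ∞ := ne_top_of_le_ne_top ENNReal.one_ne_top (en_le_one a)

theorem en_coe (a : ℝ≥0) : en a = ENNReal.ofReal (Real.exp (-a)) := by
  rw [← en_ofReal (NNReal.coe_nonneg a), ENNReal.ofReal_coe_nnreal]

theorem en_add (a b : ℝ≥0∞) : en (a + b) = en a * en b := by
  induction a with
  | top => simp
  | coe a =>
    induction b with
    | top => simp
    | coe b =>
      rw [← ENNReal.coe_add, en_coe, en_coe, en_coe, ← ENNReal.ofReal_mul (Real.exp_pos _).le,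
        ← Real.exp_add, NNReal.coe_add]
      congr 2
      ring

theorem en_sum {ι : Type*} (s : Finset ι) (f : ι → ℝ≥0∞) : en (∑ i ∈ s, f i) = ∏ i ∈ s, en (f i) := by
  classical
  induction s using Finset.induction_on with
  | empty => simp
  | insert i s hi ih => rw [Finset.sum_insert hi, Finset.prod_insert hi, en_add, ih]

theorem measurable_en : Measurable en := en_antitone.measurable

theorem ae_expMeasure_pos : ∀ᵐ t ∂expMeasure 1, 0 < t := by
  have h := cdf_expMeasure_eq (r := 1) one_pos 0
  rw [cdf_eq_real] at h
  simp only [le_refl, if_true, mul_zero, neg_zero, Real.exp_zero, sub_self] at h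
  rw [measureReal_eq_zero_iff] at h
  rw [ae_iff]
  convert h using 2
  ext t; simp

theorem expMeasure_one_eq : expMeasure 1 = volume.withDensity (exponentialPDF 1) := rfl

theorem measurable_exponentialPDF (r : ℝ) : Measurable (exponentialPDF r) :=
  (measurable_exponentialPDFReal r).ennreal_ofReal

/-- The integrand `t exp (-t)` is the density of the Gamma law of shape two. -/
theorem lintegral_expMeasure_ofReal : ∫⁻ t, ENNReal.ofReal t ∂expMeasure 1 = 1 := by
  rw [expMeasure_one_eq, lintegral_withDensity_eq_lintegral_mul _ (measurable_exponentialPDF 1)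
    ENNReal.measurable_ofReal, ← lintegral_gammaPDF_eq_one (a := 2) (r := 1) two_pos one_pos]
  refine lintegral_congr fun t => ?_
  rcases lt_or_ge t 0 with ht | ht
  · simp [exponentialPDF_of_neg ht, gammaPDF_of_neg ht]
  · rw [Pi.mul_apply, exponentialPDF_of_nonneg ht, gammaPDF_of_nonneg ht,
      ← ENNReal.ofReal_mul (by positivity)]
    congr 1
    rw [Real.Gamma_two]
    norm_num
    ring

theorem lintegral_expMeasure_exp {c : ℝ} (hc : 0 ≤ c) :
    ∫⁻ t, ENNReal.ofReal (Real.exp (-(c * t))) ∂expMeasure 1 = ENNReal.ofReal (1 / (1 + c)) := by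
  have hm : Measurable fun t : ℝ => ENNReal.ofReal (Real.exp (-(c * t))) := by fun_prop
  have hc1 : 0 < 1 + c := by positivity
  rw [expMeasure_one_eq, lintegral_withDensity_eq_lintegral_mul _ (measurable_exponentialPDF 1) hm,
    ← mul_one (ENNReal.ofReal (1 / (1 + c))), ← lintegral_exponentialPDF_eq_one hc1,
    ← lintegral_const_mul _ (measurable_exponentialPDF _)]
  refine lintegral_congr fun t => ?_
  rcases lt_or_ge t 0 with ht | ht
  · simp [exponentialPDF_of_neg ht]
  · rw [Pi.mul_apply, exponentialPDF_of_nonneg ht, exponentialPDF_of_nonneg ht,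
      ← ENNReal.ofReal_mul (by positivity), ← ENNReal.ofReal_mul (by positivity)]
    congr 1
    rw [one_mul, mul_comm, one_div, inv_mul_cancel_left₀ hc1.ne', one_mul, ← Real.exp_add]
    congr 1
    ring

/-- For `l = 0` the holding time is infinite and its discount vanishes; since `α > 0`, the quotient
on the right vanishes as well. Absorbing states of the limit chain need this case. -/
theorem lintegral_expMeasure_en {l : ℝ} (hl : 0 ≤ l) {α : ℝ≥0} (hα : 0 < α) :
    ∫⁻ t, en (α * (ENNReal.ofReal t / ENNReal.ofReal l)) ∂expMeasure 1 =
      ENNReal.ofReal l / (ENNReal.ofReal l + α) := by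
  rcases hl.eq_or_lt with rfl | hl
  · rw [ENNReal.ofReal_zero, ENNReal.zero_div]
    rw [lintegral_congr_ae (g := fun _ => 0), lintegral_zero]
    filter_upwards [ae_expMeasure_pos] with t ht
    rw [ENNReal.div_zero (ENNReal.ofReal_pos.mpr ht).ne',
      ENNReal.mul_top (by exact_mod_cast hα.ne'), en_top]
  · have h1 : ∀ᵐ t ∂expMeasure 1, en (α * (ENNReal.ofReal t / ENNReal.ofReal l)) =
        ENNReal.ofReal (Real.exp (-((α / l) * t))) := by
      filter_upwards [ae_expMeasure_pos] with t ht
      rw [← ENNReal.ofReal_div_of_pos hl, ← ENNReal.ofReal_coe_nnreal,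
        ← ENNReal.ofReal_mul (by positivity), en_ofReal (by positivity)]
      congr 3
      ring
    rw [lintegral_congr_ae h1, lintegral_expMeasure_exp (by positivity),
      ← ENNReal.ofReal_coe_nnreal, ← ENNReal.ofReal_add hl.le (NNReal.coe_nonneg α),
      ← ENNReal.ofReal_div_of_pos (by positivity)]
    congr 1
    field_simp

theorem expMeasure_le {l : ℝ} (hl : 0 < l) (t : ℝ≥0) :
    expMeasure 1 {s | ENNReal.ofReal s / ENNReal.ofReal l ≤ t} =
      ENNReal.ofReal (1 - Real.exp (-(l * t))) := by
  have h1 : {s : ℝ | ENNReal.ofReal s / ENNReal.ofReal l ≤ t} = Iic (l * t) := by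
    ext s
    rw [mem_ofPred_eq, mem_Iic, ENNReal.div_le_iff (ENNReal.ofReal_pos.mpr hl).ne' ENNReal.ofReal_ne_top,
      ← ENNReal.ofReal_coe_nnreal, ← ENNReal.ofReal_mul (NNReal.coe_nonneg t),
      ENNReal.ofReal_le_ofReal_iff (by positivity),
      mul_comm]
  have h := cdf_expMeasure_eq (r := 1) one_pos (l * t)
  rw [cdf_eq_real, if_pos (by positivity), one_mul] at h
  rw [h1, ← h, ofReal_measureReal]

theorem tendsto_coe_nhdsGT_zero :
    Tendsto (fun t : ℝ≥0 => (t : ℝ)) (𝓝[>] 0) (𝓝[>] 0) := by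
  refine tendsto_nhdsWithin_iff.mpr ⟨?_, ?_⟩
  · exact (NNReal.continuous_coe.tendsto 0).mono_left nhdsWithin_le_nhds
  · filter_upwards [self_mem_nhdsWithin] with t ht
    exact NNReal.coe_pos.mpr ht

theorem tendsto_one_sub_exp_div (l : ℝ) :
    Tendsto (fun t : ℝ≥0 => ENNReal.ofReal (1 - Real.exp (-(l * t))) / (t : ℝ≥0∞)) (𝓝[>] 0)
      (𝓝 (ENNReal.ofReal l)) := by
  have h1 : HasDerivAt (fun t : ℝ => 1 - Real.exp (-(l * t))) l 0 := by
    have h2 : HasDerivAt (fun t : ℝ => -(l * t)) (-l) 0 := by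
      have := ((hasDerivAt_id (0 : ℝ)).const_mul l).neg
      rw [mul_one] at this
      exact this
    have := (h2.exp).const_sub 1
    simpa using this
  have h3 := h1.tendsto_slope_zero_right
  simp only [zero_add, mul_zero, neg_zero, Real.exp_zero, sub_self, sub_zero, smul_eq_mul] at h3
  have h4 := ENNReal.tendsto_ofReal (h3.comp tendsto_coe_nhdsGT_zero)
  refine h4.congr' ?_
  filter_upwards [self_mem_nhdsWithin] with t ht
  have ht' : (0 : ℝ) < t := NNReal.coe_pos.mpr ht
  simp only [Function.comp]
  rw [mul_comm, ← div_eq_mul_inv, ENNReal.ofReal_div_of_pos ht', ENNReal.ofReal_coe_nnreal]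

end Exponential

/-! ### Expectations of functionals of the chain -/

section Functionals

variable {E : Type*} [MeasurableSpace E] [DiscreteMeasurableSpace E] [Countable E]
  (Q : RateMatrix E)

/-- The holding rate, as an extended nonnegative number. -/
def RateMatrix.lam (η : E) : ℝ≥0∞ := ENNReal.ofReal (Q.hold η)

variable {Q}

theorem lam_ne_top (η : E) : Q.lam η ≠ ∞ := by
  exact ENNReal.ofReal_ne_top

theorem lam_ne_zero (hpos : ∀ η, 0 < Q.hold η) (η : E) : Q.lam η ≠ 0 :=
  (ENNReal.ofReal_pos.mpr (hpos η)).ne'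

theorem hold_pos_of_irreducible (hirr : Q.IsIrreducible) [Nontrivial E] (η : E) : 0 < Q.hold η := by
  obtain ⟨ξ, hξ⟩ := exists_ne η
  rcases (hirr η ξ).cases_head with h | ⟨c, h, _⟩
  · exact absurd h.symm hξ
  · exact hold_pos_of_rate_pos Q h.1 h.2

theorem measurable_coord (n : ℕ) : Measurable fun ω : (ℕ → E) × (ℕ → ℝ) => ω.1 n :=
  (measurable_pi_apply n).comp measurable_fst

theorem measurable_comp_coord (f : E → ℝ≥0∞) (n : ℕ) :
    Measurable fun ω : (ℕ → E) × (ℕ → ℝ) => f (ω.1 n) :=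
  (Measurable.of_discrete (f := f)).comp (measurable_coord n)

theorem measurable_weight {w : E → ℝ → ℝ≥0∞} (hw : ∀ η, Measurable (w η)) (n : ℕ) :
    Measurable fun ω : (ℕ → E) × (ℕ → ℝ) => w (ω.1 n) (ω.2 n) :=
  (measurable_from_prod_countable_right (f := fun p : E × ℝ => w p.1 p.2) hw).comp
    (f := fun ω : (ℕ → E) × (ℕ → ℝ) => (ω.1 n, ω.2 n)) (by fun_prop)

theorem measurable_holding (n : ℕ) : Measurable fun ω => Q.holding ω n :=
  measurable_weight (w := fun η t => ENNReal.ofReal t / ENNReal.ofReal (Q.hold η))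
    (fun _ => ENNReal.measurable_ofReal.div_const _) n

theorem mean_pot {w : E → ℝ → ℝ≥0∞} (hw : ∀ η, Measurable (w η))
    {Ψ : (ℕ → E) × (ℕ → ℝ) → ℝ≥0∞} (hΨ : Measurable Ψ) :
    Q.mean (fun ω => ∑' n, (∏ i ∈ Finset.range n, w (ω.1 i) (ω.2 i)) * Ψ (shift^[n] ω)) =
      Q.pot (fun η => ∫⁻ t, w η t ∂expMeasure 1) (Q.mean Ψ) := by
  funext η
  rw [RateMatrix.mean, lintegral_tsum]
  · refine tsum_congr fun n => ?_
    exact congrFun (mean_prod_mul_shift Q hw hΨ n) η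
  · intro n
    exact ((Finset.measurable_prod _ fun i _ => measurable_weight hw i).mul
      (hΨ.comp (measurable_shift.iterate n))).aemeasurable

theorem mean_start {g : E → ℝ → ℝ≥0∞} (hg : ∀ η, Measurable (g η)) :
    Q.mean (fun ω => g (ω.1 0) (ω.2 0)) = fun η => ∫⁻ t, g η t ∂expMeasure 1 := by
  have := mean_mul_shift Q hg (Ψ := fun _ => 1) measurable_const
  simp only [mul_one] at this
  rw [this]
  funext η
  have h1 : Q.mean (fun _ => 1) = fun _ => 1 := by funext ζ; simp [RateMatrix.mean]
  rw [RateMatrix.wavg, h1, avg_const, mul_one]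

theorem mean_shift {Ψ : (ℕ → E) × (ℕ → ℝ) → ℝ≥0∞} (hΨ : Measurable Ψ) :
    Q.mean (fun ω => Ψ (shift ω)) = Q.avg (Q.mean Ψ) := by
  have := mean_mul_shift Q (w := fun _ _ => 1) (fun _ => measurable_const) hΨ
  simp only [one_mul] at this
  rw [this]
  funext η
  simp [RateMatrix.wavg]

theorem ae_pos (η : E) : ∀ᵐ ω ∂Q.law η, ∀ n, 0 < ω.2 n := by
  rw [ae_all_iff]
  intro n
  have h1 : ∀ᵐ e : ℕ → ℝ ∂Measure.infinitePi fun _ : ℕ => expMeasure 1, 0 < e n :=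
    (measurePreserving_eval_infinitePi (fun _ : ℕ => expMeasure 1) n).quasiMeasurePreserving.ae
      ae_expMeasure_pos
  exact Measure.quasiMeasurePreserving_snd.ae h1

theorem ae_regular (hne : Q.NonExplosive) (η : E) : ∀ᵐ ω ∂Q.law η, Q.Regular ω :=
  (ae_pos η).and (hne η)

/-- Each visit to `ζ` before `a` contributes `f ζ` times a holding time of mean `1 / λ(ζ)`. Through
this identity (C2) and (C3) become bounds on potentials. -/
theorem mean_timeIntegral_hitTime (hpos : ∀ η, 0 < Q.hold η) (hne : Q.NonExplosive)
    (f : E → ℝ≥0∞) (a η : E) :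
    ∫⁻ ω, timeIntegral (Q.path ω) f (hitTime (Q.path ω) {a}) ∂Q.law η =
      Q.pot (avoid a) (fun ζ => avoid a ζ * (f ζ / Q.lam ζ)) η := by
  have h1 : ∀ᵐ ω ∂Q.law η, timeIntegral (Q.path ω) f (hitTime (Q.path ω) {a}) =
      ∑' n, (∏ i ∈ Finset.range n, (fun ζ (_ : ℝ) => avoid a ζ) (ω.1 i) (ω.2 i)) *
        (fun ω => ({a}ᶜ : Set E).indicator f (ω.1 0) * Q.holding ω 0) (shift^[n] ω) := by
    filter_upwards [ae_regular hne η] with ω hω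
    rw [(path_jumpPath Q hω.2).timeIntegral_hitTime (jumpTime_lt hpos hω)]
    refine tsum_congr fun n => ?_
    rw [jumpTime_succ_sub hpos]
    simp only [shift_iterate_fst, shift_iterate_snd, add_zero, RateMatrix.holding]
    rfl
  have hm : ∀ ζ, Measurable fun t : ℝ => ({a}ᶜ : Set E).indicator f ζ *
      (ENNReal.ofReal t / ENNReal.ofReal (Q.hold ζ)) := fun ζ =>
    (ENNReal.measurable_ofReal.div_const _).const_mul _
  rw [lintegral_congr_ae h1]
  refine (congrFun (mean_pot (Q := Q) (w := fun ζ _ => avoid a ζ) (fun _ => measurable_const)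
    (measurable_weight hm 0)) η).trans ?_
  rw [mean_start (g := fun ζ t => ({a}ᶜ : Set E).indicator f ζ *
      (ENNReal.ofReal t / ENNReal.ofReal (Q.hold ζ))) hm]
  congr 1
  · funext ζ; simp
  · funext ζ
    rw [lintegral_const_mul _ (ENNReal.measurable_ofReal.div_const _)]
    simp_rw [div_eq_mul_inv]
    rw [lintegral_mul_const _ ENNReal.measurable_ofReal, lintegral_expMeasure_ofReal, one_mul]
    by_cases h : ζ = a
    · subst h; simp
    · rw [avoid_of_ne h, one_mul, indicator_of_mem (by simpa using h)]; rfl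

theorem mean_first_hit (F : Set E) {g : E → ℝ → ℝ≥0∞} (hg : ∀ η, Measurable (g η)) :
    Q.mean (fun ω => ∑' n, (∏ i ∈ Finset.range n, Fᶜ.indicator 1 (ω.1 i)) *
      (F.indicator 1 (ω.1 n) * g (ω.1 n) (ω.2 n))) =
      Q.pot (Fᶜ.indicator 1) (fun ζ => F.indicator 1 ζ * ∫⁻ t, g ζ t ∂expMeasure 1) := by
  have hm : ∀ ζ, Measurable fun t : ℝ => F.indicator (1 : E → ℝ≥0∞) ζ * g ζ t := fun ζ =>
    (hg ζ).const_mul _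
  have h := mean_pot (Q := Q) (w := fun ζ _ => Fᶜ.indicator 1 ζ) (fun _ => measurable_const)
    (measurable_weight hm 0)
  simp only [shift_iterate_fst, shift_iterate_snd, add_zero] at h
  rw [h, mean_start hm]
  congr 1
  · funext ζ; simp
  · funext ζ
    rw [lintegral_const_mul _ (hg ζ)]

/-- At the first visit of `F`, the sum over all visits reduces to a single term. -/
theorem tsum_first_hit {F : Set E} {y : ℕ → E} (g : ℕ → ℝ≥0∞) {k : ℕ} (hk : y k ∈ F)
    (hmin : ∀ i < k, y i ∉ F) :
    ∑' n, (∏ i ∈ Finset.range n, Fᶜ.indicator 1 (y i)) * (F.indicator 1 (y n) * g n) = g k := by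
  rw [tsum_eq_single k]
  · rw [JumpPath.prod_indicator_eq_one hmin, indicator_of_mem hk]; simp
  · intro n hn
    rcases lt_or_gt_of_ne hn with h | h
    · rw [indicator_of_notMem (hmin n h)]; simp
    · rw [JumpPath.prod_indicator_eq_zero h hk]; simp

/-- On the event that the jump chain never comes back to `a` the return time is infinite, so a
finite mean leaves this event no mass. Positive recurrence enters the proof only here. -/
theorem isRecurrent (hpos : ∀ η, 0 < Q.hold η) (hne : Q.NonExplosive)
    (hrec : Q.IsPositiveRecurrent) : Q.IsRecurrent := by
  classical
  intro a
  refine le_antisymm (avg_le_const Q (pot_point_le_one Q a) a) ?_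
  set B : Set ((ℕ → E) × (ℕ → ℝ)) := {ω | ∀ n, ω.1 (n + 1) ≠ a} with hB
  have hBm : MeasurableSet B := by
    have : B = ⋂ n, {ω | ω.1 (n + 1) = a}ᶜ := by ext; simp [hB]
    rw [this]
    exact MeasurableSet.iInter fun n =>
      (measurableSet_eq_fun (measurable_coord _) measurable_const).compl
  have hB0 : Q.law a B = 0 := by
    have h1 : ∫⁻ ω, B.indicator (fun _ => ∞) ω ∂Q.law a ≤
        ∫⁻ ω, returnTime (Q.path ω) {a} ∂Q.law a := by
      refine lintegral_mono_ae ?_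
      filter_upwards [ae_regular hne a] with ω hω
      by_cases h : ω ∈ B
      · rw [indicator_of_mem h]
        by_contra hlt
        push Not at hlt
        have h0 : 0 < Q.jumpTime ω 1 := by
          have := jumpTime_lt hpos hω 0
          exact zero_le.trans_lt this
        obtain ⟨n, hn⟩ := (path_jumpPath Q hω.2).exists_mem_of_returnTime_lt_top h0 hlt
        exact h n hn
      · rw [indicator_of_notMem h]; exact zero_le
    have h2 := h1.trans_lt (hrec a)
    rw [lintegral_indicator_const hBm] at h2
    by_contra hne0
    rw [ENNReal.top_mul hne0] at h2
    exact lt_irrefl _ h2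
  have h1 : Q.pot (avoid a) (point a) = Q.mean (fun ω =>
      ∑' n, (∏ i ∈ Finset.range n, ({a} : Set E)ᶜ.indicator 1 (ω.1 i)) *
      (({a} : Set E).indicator 1 (ω.1 n) * 1)) := by
    rw [mean_first_hit (Q := Q) ({a} : Set E) (g := fun _ _ => 1) (fun _ => measurable_const)]
    simp only [lintegral_const, measure_univ, mul_one]
    rfl
  have hm : Measurable fun ω : (ℕ → E) × (ℕ → ℝ) =>
      ∑' n, (∏ i ∈ Finset.range n, ({a} : Set E)ᶜ.indicator (1 : E → ℝ≥0∞) (ω.1 i)) *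
      (({a} : Set E).indicator 1 (ω.1 n) * 1) := by
    refine Measurable.tsum fun n => Measurable.mul ?_ (Measurable.mul ?_ measurable_const)
    · exact Finset.measurable_prod _ fun i _ => measurable_comp_coord _ i
    · exact measurable_comp_coord _ n
  rw [h1, ← mean_shift hm, RateMatrix.mean]
  have h2 : ∫⁻ _, 1 ∂Q.law a = 1 := by simp
  refine h2.ge.trans (lintegral_mono_ae ?_)
  have hB1 : ∀ᵐ ω ∂Q.law a, ω ∉ B := measure_eq_zero_iff_ae_notMem.mp hB0
  filter_upwards [hB1] with ω hω
  have hex : ∃ n, (shift ω).1 n ∈ ({a} : Set E) := by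
    by_contra hcon
    push Not at hcon
    exact hω fun n => hcon n
  exact (tsum_first_hit (fun _ => 1) (Nat.find_spec hex) fun i hi => Nat.find_min hex hi).ge

/-- Almost surely, every state is visited at arbitrarily large times. -/
theorem ae_frequently_visits (hirr : Q.IsIrreducible) (hrec : Q.IsRecurrent) (η a : E) :
    ∀ᵐ ω ∂Q.law η, ∀ n, ∃ k ≥ n, ω.1 k = a := by
  rw [ae_all_iff]
  intro n
  set H : (ℕ → E) × (ℕ → ℝ) → ℝ≥0∞ := fun ω =>
      ∑' n, (∏ i ∈ Finset.range n, ({a} : Set E)ᶜ.indicator (1 : E → ℝ≥0∞) (ω.1 i)) *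
      (({a} : Set E).indicator 1 (ω.1 n) * 1) with hH
  have hm : Measurable H := by
    refine Measurable.tsum fun n => Measurable.mul ?_ (Measurable.mul ?_ measurable_const)
    · exact Finset.measurable_prod _ fun i _ => measurable_comp_coord _ i
    · exact measurable_comp_coord _ n
  have h1 : Q.mean H = 1 := by
    rw [hH, mean_first_hit (Q := Q) ({a} : Set E) (g := fun _ _ => 1) (fun _ => measurable_const)]
    simp only [lintegral_const, measure_univ, mul_one]
    exact pot_point_eq_one hirr hrec a
  -- `H` is the indicator of a visit to `a`. Its mean is one from every starting point, hence also
  -- after `n` shifts, and a variable bounded by one with mean one equals one almost surely.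
  have h2 : ∀ n, Q.mean (fun ω => H (shift^[n] ω)) = 1 := by
    intro n
    induction n with
    | zero => exact h1
    | succ n ih =>
      simp only [Function.iterate_succ_apply]
      rw [mean_shift (Ψ := fun ω => H (shift^[n] ω)) (hm.comp (measurable_shift.iterate n)), ih]
      funext ζ
      exact avg_const Q 1 ζ
  classical
  have hle : ∀ ω, H ω ≤ 1 := by
    intro ω
    by_cases hex : ∃ n, ω.1 n ∈ ({a} : Set E)
    · exact (tsum_first_hit (fun _ => 1) (Nat.find_spec hex) fun i hi => Nat.find_min hex hi).le
    · push Not at hex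
      have : H ω = 0 := by
        rw [hH]
        refine ENNReal.tsum_eq_zero.mpr fun n => ?_
        rw [indicator_of_notMem (hex n)]; simp
      rw [this]; exact zero_le
  have h3 : ∀ᵐ ω ∂Q.law η, H (shift^[n] ω) = 1 := by
    have h4 : ∫⁻ ω, (1 - H (shift^[n] ω)) ∂Q.law η = 0 := by
      rw [lintegral_sub (g := fun ω => H (shift^[n] ω)) (hm.comp (measurable_shift.iterate n))]
      · have := congrFun (h2 n) η
        rw [RateMatrix.mean] at this
        rw [this]; simp
      · have := congrFun (h2 n) η
        rw [RateMatrix.mean] at this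
        rw [this]; simp
      · exact .of_forall fun ω => hle _
    rw [lintegral_eq_zero_iff (f := fun ω => 1 - H (shift^[n] ω)) (measurable_const.sub (hm.comp (measurable_shift.iterate n)))] at h4
    filter_upwards [h4] with ω hω
    exact le_antisymm (hle _) (tsub_eq_zero_iff_le.mp hω)
  filter_upwards [h3] with ω hω
  by_contra hcon
  push Not at hcon
  have : H (shift^[n] ω) = 0 := by
    rw [hH]
    refine ENNReal.tsum_eq_zero.mpr fun k => ?_
    rw [shift_iterate_fst, indicator_of_notMem (by simpa using hcon (n + k) (by omega))]; simp
  rw [this] at hω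
  exact zero_ne_one hω

end Functionals

/-! ### The rates of the trace process -/

section TraceRate

variable {E : Type*} [MeasurableSpace E] [DiscreteMeasurableSpace E] [Countable E]
  {Q : RateMatrix E}

theorem indicator_le_one {α : Type*} (A : Set α) : A.indicator (1 : α → ℝ≥0∞) ≤ 1 :=
  indicator_le_self' fun _ _ => zero_le

/-- The value of `g` at the first visit of `F`. -/
def atFirstHit (F : Set E) (g : E → ℝ → ℝ≥0∞) (ω : (ℕ → E) × (ℕ → ℝ)) : ℝ≥0∞ :=
  ∑' n, (∏ i ∈ Finset.range n, Fᶜ.indicator 1 (ω.1 i)) *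
    (F.indicator 1 (ω.1 n) * g (ω.1 n) (ω.2 n))

theorem measurable_atFirstHit (F : Set E) {g : E → ℝ → ℝ≥0∞} (hg : ∀ η, Measurable (g η)) :
    Measurable (atFirstHit F g) :=
  Measurable.tsum fun n =>
    (Finset.measurable_prod _ fun i _ => measurable_comp_coord _ i).mul
      ((measurable_comp_coord _ n).mul (measurable_weight hg n))

theorem pot_indicator_le_one (F : Set E) : Q.pot (Fᶜ.indicator 1) (F.indicator 1) ≤ 1 := by
  refine pot_le_of_le Q fun η => ?_
  by_cases h : η ∈ F
  · simp [RateMatrix.wavg, h]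
  · simp only [Pi.add_apply, RateMatrix.wavg, indicator_of_notMem h, zero_add,
      indicator_of_mem (mem_compl h), Pi.one_apply, one_mul]
    exact (avg_const Q 1 η).le

theorem avg_pot_eq_tsum (m f : E → ℝ≥0∞) (η : E) :
    Q.avg (Q.pot m f) η = ∑' z, f z * Q.avg (Q.pot m (point z)) η := by
  have hs : f = fun ζ => ∑' b, f b * point b ζ := by
    funext ζ
    rw [tsum_eq_single ζ fun b h => by simp [point_of_ne h.symm]]
    simp
  conv_lhs => rw [hs]
  rw [show Q.pot m (fun ζ => ∑' b, f b * point b ζ) = fun ζ => ∑' b, f b * Q.pot m (point b) ζ from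
    funext fun ζ => by rw [pot_tsum]; exact tsum_congr fun b => pot_const_mul Q _ _ _ _, avg_tsum]
  exact tsum_congr fun b => avg_const_mul Q _ _ _

/-- The first state of `F` met after a jump has a subprobability law `q`, and dominated convergence
applies with majorant `q`. -/
theorem tendsto_avg_pot_zero (F : Set E) {p : ℝ≥0 → E → ℝ≥0∞} (hp : ∀ t, p t ≤ 1)
    (hlim : ∀ z, Tendsto (fun t => p t z) (𝓝[>] 0) (𝓝 0)) (η : E) :
    Tendsto (fun t => Q.avg (Q.pot (Fᶜ.indicator 1) (fun z => F.indicator 1 z * p t z)) η)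
      (𝓝[>] 0) (𝓝 0) := by
  set q : E → ℝ≥0∞ := fun z => F.indicator 1 z * Q.avg (Q.pot (Fᶜ.indicator 1) (point z)) η with hq
  have hq1 : ∑' z, q z ≤ 1 := by
    rw [hq, ← avg_pot_eq_tsum]
    exact avg_le_const Q (pot_indicator_le_one F) η
  have h1 : ∀ t, Q.avg (Q.pot (Fᶜ.indicator 1) (fun z => F.indicator 1 z * p t z)) η =
      ∫⁻ z, p t z * q z ∂Measure.count := by
    intro t
    rw [lintegral_count, avg_pot_eq_tsum]
    exact tsum_congr fun z => by rw [hq]; ring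
  simp_rw [h1]
  have h2 : ∫⁻ _ : E, 0 ∂Measure.count = 0 := by simp
  rw [← h2]
  refine tendsto_lintegral_filter_of_dominated_convergence q (.of_forall fun t => Measurable.of_discrete)
    (.of_forall fun t => .of_forall fun z => ?_) ?_ (.of_forall fun z => ?_)
  · exact mul_le_of_le_one_left zero_le (hp t z)
  · rw [lintegral_count]
    exact ne_top_of_le_ne_top ENNReal.one_ne_top hq1
  · have hqz : q z ≠ ∞ := ne_top_of_le_ne_top ENNReal.one_ne_top ((ENNReal.le_tsum z).trans hq1)
    simpa using ENNReal.Tendsto.mul_const (hlim z) (Or.inr hqz)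

/-- For the trace on `F`, the states at small times. -/
theorem trace_bounds (hpos : ∀ η, 0 < Q.hold η) {F : Set E} {η ξ : E} (hη : η ∈ F) (hne : η ≠ ξ)
    {ω : (ℕ → E) × (ℕ → ℝ)} (hω : Q.Regular ω) (h0 : ω.1 0 = η) (hhit : ∃ k, ω.1 (k + 1) ∈ F)
    (t : ℝ≥0) :
    (Q.holding ω 0 ≤ t → (1 : ℝ≥0∞) ≤ atFirstHit F (fun ζ s => point ξ ζ *
        {s : ℝ | (t : ℝ≥0∞) < ENNReal.ofReal s / Q.lam ζ}.indicator 1 s) (shift ω) →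
        tracePath (Q.path ω) F t = some ξ) ∧
      atFirstHit F (fun ζ s => point ξ ζ *
        {s : ℝ | (t : ℝ≥0∞) < ENNReal.ofReal s / Q.lam ζ}.indicator 1 s) (shift ω) ≤
          {ω | (1 : ℝ≥0∞) ≤ atFirstHit F (fun ζ s => point ξ ζ *
        {s : ℝ | (t : ℝ≥0∞) < ENNReal.ofReal s / Q.lam ζ}.indicator 1 s) (shift ω)}.indicator 1 ω ∧
      (tracePath (Q.path ω) F t = some ξ → Q.holding ω 0 ≤ t ∧
        1 ≤ atFirstHit F (fun ζ s => point ξ ζ +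
          {s : ℝ | ENNReal.ofReal s / Q.lam ζ ≤ t}.indicator 1 s) (shift ω)) := by
  classical
  set k := Nat.find hhit with hk
  have hkF : (shift ω).1 k ∈ F := Nat.find_spec hhit
  have hmin : ∀ i < k, (shift ω).1 i ∉ F := fun i hi => Nat.find_min hhit hi
  -- Index `k + 1` is the first visit of `F` after step zero. It may be a return to `η` itself.
  have hval : ∀ g : E → ℝ → ℝ≥0∞, atFirstHit F g (shift ω) = g (ω.1 (k + 1)) (ω.2 (k + 1)) :=
    fun g => tsum_first_hit (fun n => g ((shift ω).1 n) ((shift ω).2 n)) hkF hmin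
  have hJ := path_jumpPath Q hω.2
  have hlt := jumpTime_lt hpos hω
  -- From step `1` to step `k` the chain is outside `F` and the clock of `F` stands still.
  have hclock : ∀ j ≤ k, JumpPath.clock (Q.jumpTime ω) ω.1 F (j + 1) = Q.holding ω 0 := by
    intro j hj
    induction j with
    | zero =>
      rw [JumpPath.clock_succ, jumpTime_succ_sub hpos, h0, indicator_of_mem hη]
      simp [JumpPath.clock]
    | succ j ih =>
      rw [JumpPath.clock_succ, ih (by omega), indicator_of_notMem (show ω.1 (j + 1) ∉ F from hmin j (by omega))]
      simp
  have hclock2 : JumpPath.clock (Q.jumpTime ω) ω.1 F (k + 2) =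
      Q.holding ω 0 + Q.holding ω (k + 1) := by
    rw [JumpPath.clock_succ, hclock k le_rfl, jumpTime_succ_sub hpos,
      indicator_of_mem (show ω.1 (k + 1) ∈ F from hkF)]
    simp
  have htr : Q.holding ω 0 ≤ t → (t : ℝ≥0∞) < Q.holding ω 0 + Q.holding ω (k + 1) →
      tracePath (Q.path ω) F t = some (ω.1 (k + 1)) := by
    intro h1 h2
    exact hJ.tracePath_eq hlt F (n := k + 1) ((hclock k le_rfl).trans_le h1) (hclock2 ▸ h2)
  refine ⟨?_, ?_, ?_⟩
  · intro h1 h2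
    rw [hval] at h2
    have hξ : ω.1 (k + 1) = ξ := by
      by_contra hcon
      rw [point_of_ne hcon, zero_mul] at h2
      exact absurd h2 (by simp)
    have hs : (t : ℝ≥0∞) < Q.holding ω (k + 1) := by
      by_contra hcon
      rw [indicator_of_notMem (by exact hcon), mul_zero] at h2
      exact absurd h2 (by simp)
    rw [htr h1 (hs.trans_le le_add_self), hξ]
  · by_cases h : ω ∈ {ω | (1 : ℝ≥0∞) ≤ atFirstHit F (fun ζ s => point ξ ζ *
        {s : ℝ | (t : ℝ≥0∞) < ENNReal.ofReal s / Q.lam ζ}.indicator 1 s) (shift ω)}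
    · rw [indicator_of_mem h, hval]
      exact (mul_le_mul' (indicator_le_one _ _) (indicator_le_one _ _)).trans (one_mul _).le
    · rw [indicator_of_notMem h]
      rw [mem_ofPred_eq, hval] at h
      rw [hval]
      by_cases h1 : ω.1 (k + 1) = ξ
      · by_cases h2 : ω.2 (k + 1) ∈
            {s : ℝ | (t : ℝ≥0∞) < ENNReal.ofReal s / Q.lam (ω.1 (k + 1))}
        · rw [indicator_of_mem h2, h1] at h
          simp at h
        · rw [indicator_of_notMem h2, mul_zero]
      · rw [point_of_ne h1, zero_mul]
  · intro h1
    have hle : Q.holding ω 0 ≤ t := by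
      by_contra hcon
      push Not at hcon
      have := hJ.tracePath_eq hlt F (n := 0) (t := t) (by simp [JumpPath.clock])
        ((hclock 0 (Nat.zero_le _)).symm ▸ hcon)
      rw [this, h0] at h1
      exact hne (Option.some.inj h1)
    refine ⟨hle, ?_⟩
    rw [hval]
    rcases lt_or_ge (t : ℝ≥0∞) (Q.holding ω 0 + Q.holding ω (k + 1)) with h2 | h2
    · have h3 := htr hle h2
      rw [h1] at h3
      rw [← Option.some.inj h3, point_self]
      exact le_self_add
    · have h3 : Q.holding ω (k + 1) ≤ t := le_add_self.trans h2
      rw [indicator_of_mem (show ω.2 (k + 1) ∈ {s : ℝ | ENNReal.ofReal s / Q.lam (ω.1 (k + 1)) ≤ t}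
        from h3)]
      exact le_add_self

/-- Let `c` be the probability that the next visited state of `F` is `ξ`, and `p t ζ` the
probability that a holding time at `ζ` is at most `t`. The probability that the trace is at `ξ` at
time `t` lies between `p t η * (1 - p t ξ) * c` and `p t η * (c + o(1))`, and `p t η / t` tends to
`λ(η)`. -/
theorem traceRate_eq (hpos : ∀ η, 0 < Q.hold η) (hirr : Q.IsIrreducible) (hne : Q.NonExplosive)
    (hrec : Q.IsRecurrent) {F : Set E} {η ξ : E} (hη : η ∈ F) (hξ : ξ ∈ F) (hηξ : η ≠ ξ) :
    traceRate Q F η ξ = Q.lam η * Q.avg (Q.pot (Fᶜ.indicator 1) (point ξ)) η := by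
  set c := Q.avg (Q.pot (Fᶜ.indicator 1) (point ξ)) η with hc
  set p : ℝ≥0 → E → ℝ≥0∞ := fun t ζ => ENNReal.ofReal (1 - Real.exp (-(Q.hold ζ * t))) with hp
  have hpe : ∀ (t : ℝ≥0) ζ, expMeasure 1 {s | ENNReal.ofReal s / Q.lam ζ ≤ t} = p t ζ := fun t ζ =>
    expMeasure_le (hpos ζ) t
  have hp1 : ∀ t, p t ≤ 1 := fun t ζ => by rw [← hpe]; exact prob_le_one
  have hmle : ∀ (t : ℝ≥0) ζ, MeasurableSet {s : ℝ | ENNReal.ofReal s / Q.lam ζ ≤ t} := fun t ζ =>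
    measurableSet_le (ENNReal.measurable_ofReal.div_const _) measurable_const
  have hmlt : ∀ (t : ℝ≥0) ζ, MeasurableSet {s : ℝ | (t : ℝ≥0∞) < ENNReal.ofReal s / Q.lam ζ} :=
    fun t ζ => measurableSet_lt measurable_const (ENNReal.measurable_ofReal.div_const _)
  have hpc : ∀ (t : ℝ≥0) ζ, expMeasure 1 {s | (t : ℝ≥0∞) < ENNReal.ofReal s / Q.lam ζ} = 1 - p t ζ := by
    intro t ζ
    rw [← hpe, ← prob_compl_eq_one_sub (hmle t ζ)]
    congr 1
    ext s; simp
  have hc1 : c ≤ 1 := by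
    refine avg_le_const Q (fun ζ => (pot_mono Q le_rfl (fun z => ?_) ζ).trans
      (pot_indicator_le_one F ζ)) η
    by_cases h : z = ξ
    · rw [h, point_self, indicator_of_mem hξ]; rfl
    · rw [point_of_ne h]; exact zero_le
  have hpt : ∀ z, F.indicator 1 z * point ξ z = point ξ z := by
    intro z
    by_cases h : z = ξ
    · rw [h, indicator_of_mem hξ]; simp
    · rw [point_of_ne h, mul_zero]
  set g1 : ℝ≥0 → E → ℝ → ℝ≥0∞ := fun t ζ s => point ξ ζ *
        {s : ℝ | (t : ℝ≥0∞) < ENNReal.ofReal s / Q.lam ζ}.indicator 1 s with hg1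
  set g2 : ℝ≥0 → E → ℝ → ℝ≥0∞ := fun t ζ s => point ξ ζ +
          {s : ℝ | ENNReal.ofReal s / Q.lam ζ ≤ t}.indicator 1 s with hg2
  have hg1m : ∀ t ζ, Measurable (g1 t ζ) := fun t ζ =>
    (measurable_one.indicator (hmlt t ζ)).const_mul _
  have hg2m : ∀ t ζ, Measurable (g2 t ζ) := fun t ζ =>
    (measurable_one.indicator (hmle t ζ)).const_add _
  set w : ℝ≥0 → E → ℝ → ℝ≥0∞ := fun t ζ s =>
    {s : ℝ | ENNReal.ofReal s / Q.lam ζ ≤ t}.indicator 1 s with hw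
  have hwm : ∀ t ζ, Measurable (w t ζ) := fun t ζ => measurable_one.indicator (hmle t ζ)
  have hmean : ∀ (t : ℝ≥0) (g : E → ℝ → ℝ≥0∞) (_ : ∀ ζ, Measurable (g ζ)),
      ∫⁻ ω, w t (ω.1 0) (ω.2 0) * atFirstHit F g (shift ω) ∂Q.law η =
        p t η * Q.avg (Q.pot (Fᶜ.indicator 1)
          (fun ζ => F.indicator 1 ζ * ∫⁻ s, g ζ s ∂expMeasure 1)) η := by
    intro t g hg
    have := congrFun (mean_mul_shift Q (hwm t) (measurable_atFirstHit F hg)) η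
    rw [RateMatrix.mean] at this
    rw [this, RateMatrix.wavg, lintegral_indicator_one (hmle t η), hpe]
    congr 2
    exact mean_first_hit F hg
  have hae : ∀ᵐ ω ∂Q.law η, Q.Regular ω ∧ ω.1 0 = η ∧ ∃ k, ω.1 (k + 1) ∈ F := by
    filter_upwards [ae_regular hne η, ae_start Q η, ae_frequently_visits hirr hrec η ξ] with ω h1 h2 h3
    obtain ⟨k, hk, hk2⟩ := h3 1
    obtain ⟨j, rfl⟩ := Nat.exists_eq_add_of_le' hk
    exact ⟨h1, h2, j, hk2 ▸ hξ⟩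
  -- It suffices that the first holding time is at most `t`, that the next state of `F` is `ξ`, and
  -- that the holding time there exceeds `t`.
  have hlower : ∀ t : ℝ≥0, p t η * ((1 - p t ξ) * c) ≤
      Q.law η {ω | tracePath (Q.path ω) F t = some ξ} := by
    intro t
    have h1 : Q.avg (Q.pot (Fᶜ.indicator 1)
          (fun ζ => F.indicator 1 ζ * ∫⁻ s, g1 t ζ s ∂expMeasure 1)) η = (1 - p t ξ) * c := by
      have h2 : (fun ζ => F.indicator 1 ζ * ∫⁻ s, g1 t ζ s ∂expMeasure 1) =
          fun ζ => (1 - p t ξ) * point ξ ζ := by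
        funext ζ
        rw [hg1, lintegral_const_mul _ (measurable_one.indicator (hmlt t ζ)),
          lintegral_indicator_one (hmlt t ζ), hpc, ← mul_assoc, hpt]
        by_cases h : ζ = ξ
        · rw [h, mul_comm]
        · rw [point_of_ne h, zero_mul, mul_zero]
      rw [h2, show Q.pot (Fᶜ.indicator 1) (fun ζ => (1 - p t ξ) * point ξ ζ) =
        fun ζ => (1 - p t ξ) * Q.pot (Fᶜ.indicator 1) (point ξ) ζ from
          funext fun ζ => pot_const_mul Q _ _ _ _, avg_const_mul]
    rw [← h1, ← hmean t (g1 t) (hg1m t)]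
    refine le_trans (lintegral_mono_ae ?_) (lintegral_indicator_one_le _)
    filter_upwards [hae] with ω hω
    obtain ⟨hb1, hb2, _⟩ := trace_bounds hpos hη hηξ hω.1 hω.2.1 hω.2.2 t
    by_cases h3 : ω.2 0 ∈ {s : ℝ | ENNReal.ofReal s / Q.lam (ω.1 0) ≤ t}
    · by_cases h4 : 1 ≤ atFirstHit F (g1 t) (shift ω)
      · rw [indicator_of_mem (show ω ∈ {ω | tracePath (Q.path ω) F t = some ξ} from hb1 h3 h4)]
        refine (mul_le_mul' (indicator_le_one _ _) (hb2.trans (indicator_le_one _ _))).trans ?_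
        exact (one_mul _).le
      · rw [indicator_of_notMem (by exact h4)] at hb2
        rw [le_antisymm hb2 zero_le, mul_zero]
        exact zero_le
    · simp only [hw]
      rw [indicator_of_notMem h3, zero_mul]
      exact zero_le
  -- Conversely the first holding time is at most `t`, and either the next state of `F` is `ξ` or
  -- its holding time is also at most `t`. The second alternative is negligible.
  have hupper : ∀ t : ℝ≥0, Q.law η {ω | tracePath (Q.path ω) F t = some ξ} ≤
      p t η * (c + Q.avg (Q.pot (Fᶜ.indicator 1) (fun z => F.indicator 1 z * p t z)) η) := by
    intro t
    have h1 : Q.avg (Q.pot (Fᶜ.indicator 1)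
          (fun ζ => F.indicator 1 ζ * ∫⁻ s, g2 t ζ s ∂expMeasure 1)) η =
        c + Q.avg (Q.pot (Fᶜ.indicator 1) (fun z => F.indicator 1 z * p t z)) η := by
      have h2 : (fun ζ => F.indicator 1 ζ * ∫⁻ s, g2 t ζ s ∂expMeasure 1) =
          point ξ + fun z => F.indicator 1 z * p t z := by
        funext ζ
        rw [hg2, lintegral_add_left measurable_const, lintegral_indicator_one (hmle t ζ), hpe, mul_add]
        simp only [lintegral_const, measure_univ, mul_one, hpt]
        rfl
      rw [h2, pot_add, avg_add]
      rfl
    rw [← h1, ← hmean t (g2 t) (hg2m t)]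
    have h3 : Measurable fun ω : (ℕ → E) × (ℕ → ℝ) =>
        w t (ω.1 0) (ω.2 0) * atFirstHit F (g2 t) (shift ω) :=
      (measurable_weight (hwm t) 0).mul ((measurable_atFirstHit F (hg2m t)).comp measurable_shift)
    have h4 := mul_meas_ge_le_lintegral (μ := Q.law η) h3 1
    rw [one_mul] at h4
    refine le_trans (measure_mono_ae ?_) h4
    filter_upwards [hae] with ω hω hmem
    obtain ⟨_, _, hb3⟩ := trace_bounds hpos hη hηξ hω.1 hω.2.1 hω.2.2 t
    obtain ⟨h5, h6⟩ := hb3 hmem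
    change 1 ≤ w t (ω.1 0) (ω.2 0) * atFirstHit F (g2 t) (shift ω)
    simp only [hw]
    rw [indicator_of_mem (show ω.2 0 ∈ {s : ℝ | ENNReal.ofReal s / Q.lam (ω.1 0) ≤ t} from h5),
      Pi.one_apply, one_mul]
    exact h6
  have hplim : ∀ z, Tendsto (fun t => p t z) (𝓝[>] 0) (𝓝 0) := by
    intro z
    have h1 : Continuous fun t : ℝ≥0 => ENNReal.ofReal (1 - Real.exp (-(Q.hold z * t))) :=
      ENNReal.continuous_ofReal.comp (by fun_prop)
    have h2 := h1.tendsto 0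
    simp only [NNReal.coe_zero, mul_zero, neg_zero, Real.exp_zero, sub_self, ENNReal.ofReal_zero] at h2
    exact h2.mono_left nhdsWithin_le_nhds
  have hL := tendsto_one_sub_exp_div (Q.hold η)
  have hlim : Tendsto (fun t : ℝ≥0 => Q.law η {ω | tracePath (Q.path ω) F t = some ξ} / (t : ℝ≥0∞))
      (𝓝[>] 0) (𝓝 (Q.lam η * c)) := by
    have hcfin : c ≠ ∞ := ne_top_of_le_ne_top ENNReal.one_ne_top hc1
    have h1 : Tendsto (fun t : ℝ≥0 => p t η / t * ((1 - p t ξ) * c)) (𝓝[>] 0)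
        (𝓝 (Q.lam η * c)) := by
      refine ENNReal.Tendsto.mul hL (Or.inr hcfin) ?_ (Or.inr (lam_ne_top η))
      have h2 : Tendsto (fun t => 1 - p t ξ) (𝓝[>] 0) (𝓝 1) := by
        simpa using ENNReal.Tendsto.sub (tendsto_const_nhds (x := (1 : ℝ≥0∞))) (hplim ξ)
          (Or.inl (by simp))
      simpa using ENNReal.Tendsto.mul_const h2 (Or.inr hcfin)
    have h3 : Tendsto (fun t : ℝ≥0 => p t η / t *
        (c + Q.avg (Q.pot (Fᶜ.indicator 1) (fun z => F.indicator 1 z * p t z)) η)) (𝓝[>] 0)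
        (𝓝 (Q.lam η * c)) := by
      refine ENNReal.Tendsto.mul hL (Or.inr hcfin) ?_ (Or.inr (lam_ne_top η))
      simpa using (tendsto_avg_pot_zero F hp1 hplim η).const_add c
    refine tendsto_of_tendsto_of_tendsto_of_le_of_le h1 h3 (fun t => ?_) (fun t => ?_)
    · simp only [ENNReal.div_eq_inv_mul, mul_assoc]
      exact mul_le_mul' le_rfl (hlower t)
    · simp only [ENNReal.div_eq_inv_mul, mul_assoc]
      exact mul_le_mul' le_rfl (hupper t)
  exact hlim.limUnder_eq

theorem jumpRateTo_eq {S : Type*} (hpos : ∀ η, 0 < Q.hold η) (hirr : Q.IsIrreducible)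
    (hne : Q.NonExplosive) (hrec : Q.IsRecurrent) {W : S → Set E} {y : S} {η : E}
    (hη : η ∈ wells W) (hy : η ∉ W y) :
    jumpRateTo Q W y η =
      Q.lam η * Q.avg (Q.pot ((outside W).indicator 1) ((W y).indicator 1)) η := by
  have h1 : ∀ ξ : W y, traceRate Q (wells W) η ξ =
      Q.lam η * Q.avg (Q.pot ((outside W).indicator 1) (point (ξ : E))) η := by
    intro ξ
    refine traceRate_eq hpos hirr hne hrec hη (mem_iUnion.mpr ⟨y, ξ.2⟩) ?_
    rintro rfl
    exact hy ξ.2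
  rw [jumpRateTo, tsum_congr h1, ENNReal.tsum_mul_left, ← avg_tsum]
  congr 2
  funext ζ
  rw [← pot_tsum]
  congr 1
  funext z
  classical
  by_cases hz : z ∈ W y
  · rw [tsum_eq_single ⟨z, hz⟩, indicator_of_mem hz]
    · simp
    · intro b hb
      exact point_of_ne fun h => hb (Subtype.ext h.symm)
  · rw [indicator_of_notMem hz, ENNReal.tsum_eq_zero]
    intro b
    exact point_of_ne fun h => hz (h ▸ b.2)

end TraceRate

/-! ### Escape from a well -/

section Escape

variable {E : Type*} [MeasurableSpace E] [DiscreteMeasurableSpace E] [Countable E]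
  {Q : RateMatrix E} {S : Type*}

theorem pot_finset_sum {ι : Type*} (s : Finset ι) (m : E → ℝ≥0∞) (f : ι → E → ℝ≥0∞) :
    Q.pot m (∑ i ∈ s, f i) = ∑ i ∈ s, Q.pot m (f i) := by
  classical
  induction s using Finset.induction_on with
  | empty =>
    have h0 : Q.pot m 0 ≤ 0 :=
      pot_le_of_le Q fun ζ => by simp [RateMatrix.wavg, RateMatrix.avg]
    simpa using le_antisymm h0 fun _ => zero_le
  | insert i s hi ih => rw [Finset.sum_insert hi, Finset.sum_insert hi, pot_add, ih]

theorem avg_finset_sum {ι : Type*} (s : Finset ι) (f : ι → E → ℝ≥0∞) :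
    Q.avg (∑ i ∈ s, f i) = ∑ i ∈ s, Q.avg (f i) := by
  classical
  induction s using Finset.induction_on with
  | empty => funext ζ; simp [RateMatrix.avg]
  | insert i s hi ih => rw [Finset.sum_insert hi, Finset.sum_insert hi, avg_add, ih]

/-- Every state is in the well of `x`, in another well or outside the wells. -/
theorem mem_cases (W : S → Set E) (x : S) (η : E) :
    (η ∈ W x ∧ η ∉ otherWells W x ∧ η ∉ outside W) ∨
    (η ∉ W x ∧ η ∈ otherWells W x ∧ η ∉ outside W) ∨
    (η ∉ W x ∧ η ∉ otherWells W x ∧ η ∈ outside W) := by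
  by_cases h1 : η ∈ W x
  · refine Or.inl ⟨h1, fun h => h.2 h1, fun h => h (mem_iUnion.mpr ⟨x, h1⟩)⟩
  · by_cases h2 : η ∈ wells W
    · exact Or.inr (Or.inl ⟨h1, ⟨h2, h1⟩, fun h => h h2⟩)
    · exact Or.inr (Or.inr ⟨h1, fun h => h2 h.1, h2⟩)

theorem mem_otherWells {W : S → Set E} (hW : Pairwise fun x y => Disjoint (W x) (W y)) {x y : S}
    (hyx : y ≠ x) {η : E} (hη : η ∈ W y) : η ∈ otherWells W x :=
  ⟨mem_iUnion.mpr ⟨y, hη⟩, fun h => Set.disjoint_left.mp (hW hyx) hη h⟩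

theorem indicator_otherWells [Fintype S] [DecidableEq S] {W : S → Set E}
    (hW : Pairwise fun x y => Disjoint (W x) (W y)) (x : S) :
    (otherWells W x).indicator (1 : E → ℝ≥0∞) =
      ∑ y ∈ Finset.univ.erase x, (W y).indicator 1 := by
  funext η
  rw [Finset.sum_apply]
  by_cases h : η ∈ otherWells W x
  · obtain ⟨y, hy⟩ := mem_iUnion.mp h.1
    have hyx : y ≠ x := by rintro rfl; exact h.2 hy
    rw [indicator_of_mem h, Finset.sum_eq_single y]
    · rw [indicator_of_mem hy]
    · intro z _ hzy
      exact indicator_of_notMem (fun hz => Set.disjoint_left.mp (hW hzy) hz hy) _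
    · intro hcon
      exact absurd (Finset.mem_erase.mpr ⟨hyx, Finset.mem_univ y⟩) hcon
  · rw [indicator_of_notMem h]
    symm
    refine Finset.sum_eq_zero fun y hy => indicator_of_notMem (fun hη => h ?_) _
    exact mem_otherWells hW (Finset.ne_of_mem_erase hy) hη

variable (Q) in
/-- The mean discount of one step at rate `α` of the time spent in the well of `x`, for the chain
stopped in the other wells. -/
def RateMatrix.escWeight (W : S → Set E) (x : S) (α : ℝ≥0) (η : E) : ℝ≥0∞ :=
  (outside W).indicator 1 η + (W x).indicator (fun η => Q.lam η / (Q.lam η + α)) η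

variable {W : S → Set E} {x : S} {α : ℝ≥0}

theorem escWeight_well {η : E} (h : η ∈ W x) :
    Q.escWeight W x α η = Q.lam η / (Q.lam η + α) := by
  have : η ∉ outside W := fun h' => h' (mem_iUnion.mpr ⟨x, h⟩)
  rw [RateMatrix.escWeight, indicator_of_mem h, indicator_of_notMem this, zero_add]

theorem escWeight_outside {η : E} (h : η ∈ outside W) : Q.escWeight W x α η = 1 := by
  have : η ∉ W x := fun h' => h (mem_iUnion.mpr ⟨x, h'⟩)
  rw [RateMatrix.escWeight, indicator_of_mem h, indicator_of_notMem this, add_zero, Pi.one_apply]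

theorem escWeight_other {η : E} (h : η ∈ otherWells W x) : Q.escWeight W x α η = 0 := by
  rw [RateMatrix.escWeight, indicator_of_notMem h.2, indicator_of_notMem (show η ∉ outside W from fun h' => h' h.1),
    add_zero]

theorem escWeight_le_one (η : E) : Q.escWeight W x α η ≤ 1 := by
  rcases mem_cases W x η with h | h | h
  · rw [escWeight_well h.1]
    exact ENNReal.div_le_of_le_mul (by rw [one_mul]; exact le_self_add)
  · rw [escWeight_other h.2.1]; exact zero_le
  · rw [escWeight_outside h.2.2]

theorem escWeight_le_avoid {b : E} (hb : b ∈ otherWells W x) :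
    Q.escWeight W x α ≤ avoid b := by
  intro η
  by_cases h : η = b
  · rw [h, escWeight_other hb]; exact zero_le
  · rw [avoid_of_ne h]; exact escWeight_le_one η

theorem lam_add_ne_zero (hα : 0 < α) (η : E) : Q.lam η + α ≠ 0 := by
  simp [hα.ne']

theorem lam_add_ne_top (η : E) : Q.lam η + α ≠ ∞ :=
  ENNReal.add_ne_top.mpr ⟨lam_ne_top η, ENNReal.coe_ne_top⟩

theorem div_add_div_eq_one (hα : 0 < α) (η : E) :
    Q.lam η / (Q.lam η + α) + α / (Q.lam η + α) = 1 := by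
  rw [ENNReal.div_add_div_same]
  exact ENNReal.div_self (lam_add_ne_zero hα η) (lam_add_ne_top η)

variable (Q) in
/-- The discounted mean of `f` along the time spent in the well of `x` before the chain reaches
another well. -/
def RateMatrix.escMean (W : S → Set E) (x : S) (α : ℝ≥0) (f : E → ℝ≥0∞) : E → ℝ≥0∞ :=
  Q.pot (Q.escWeight W x α) ((W x).indicator fun ζ => f ζ / (Q.lam ζ + α))

theorem escMean_const_mul (c : ℝ≥0∞) (f : E → ℝ≥0∞) (η : E) :
    Q.escMean W x α (fun ζ => c * f ζ) η = c * Q.escMean W x α f η := by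
  rw [RateMatrix.escMean, RateMatrix.escMean, ← pot_const_mul]
  congr 1
  funext ζ
  by_cases h : ζ ∈ W x
  · rw [indicator_of_mem h, indicator_of_mem h, mul_div_assoc]
  · rw [indicator_of_notMem h, indicator_of_notMem h, mul_zero]

/-- Conservation of probability: either another well is reached first, or an exponential clock of
rate `α`, running only in the well of `x`, rings first. The constant one solves the corresponding
one-step equation, and the point `b`, where the weight vanishes, makes the remainder tend to zero.
-/
theorem pot_other_add_escMean (hirr : Q.IsIrreducible) (hrec : Q.IsRecurrent) (hα : 0 < α) {b : E}
    (hb : b ∈ otherWells W x) (η : E) :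
    Q.pot (Q.escWeight W x α) ((otherWells W x).indicator 1) η +
      α * Q.escMean W x α 1 η = 1 := by
  have heq : (1 : E → ℝ≥0∞) + 0 = ((otherWells W x).indicator 1 +
      fun ζ => α * (W x).indicator (fun ζ => (1 : E → ℝ≥0∞) ζ / (Q.lam ζ + α)) ζ) +
      Q.wavg (Q.escWeight W x α) 1 := by
    funext ζ
    simp only [Pi.add_apply, Pi.zero_apply, add_zero, RateMatrix.wavg]
    rw [show Q.avg 1 ζ = 1 from avg_const Q 1 ζ, mul_one]
    rcases mem_cases W x ζ with h | h | h
    · rw [escWeight_well h.1, indicator_of_mem h.1, indicator_of_notMem h.2.1, zero_add, add_comm,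
        Pi.one_apply, mul_one_div, div_add_div_eq_one hα]
    · rw [escWeight_other h.2.1, indicator_of_notMem h.1, indicator_of_mem h.2.1]; simp
    · rw [escWeight_outside h.2.2, indicator_of_notMem h.1, indicator_of_notMem h.2.1]; simp
  have := add_pot_eq_pot Q heq (tendsto_iterate_one hirr hrec (escWeight_le_avoid hb) η)
  have h0 : Q.pot (Q.escWeight W x α) 0 η = 0 := by
    have := congrFun (pot_finset_sum (Q := Q) (∅ : Finset ℕ) (Q.escWeight W x α) (fun _ => 0)) η
    simpa using this
  rw [h0, add_zero, pot_add, Pi.add_apply, pot_const_mul] at this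
  exact this.symm

/-- Let `q` be the probability that the first state visited in the wells, the present one included,
lies in the well of `y`. It is zero on the well of `x`, and there the jump rate of the trace is `λ P
q`. In the one-step equation for `q` the discounted flow `λ / (λ + α) * P q` out of the well of `x`
thus becomes the source `R^{x,y} / (λ + α)`. -/
theorem pot_well_eq_escMean (hpos : ∀ η, 0 < Q.hold η) (hirr : Q.IsIrreducible)
    (hne : Q.NonExplosive) (hrec : Q.IsRecurrent)
    (hW : Pairwise fun x y => Disjoint (W x) (W y)) {b : E}
    (hb : b ∈ otherWells W x) {y : S} (hyx : y ≠ x) {η : E} (hη : η ∈ W x) :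
    Q.pot (Q.escWeight W x α) ((W y).indicator 1) η =
      Q.escMean W x α (jumpRateTo Q W y) η := by
  set q := Q.pot ((outside W).indicator 1) ((W y).indicator 1) with hq
  have hq1 : q ≤ 1 := by
    refine le_trans (pot_mono Q le_rfl ?_) (pot_indicator_le_one (Q := Q) (wells W))
    exact indicator_le_indicator_of_subset (subset_iUnion W y) fun _ => zero_le
  have hxy : ∀ ζ ∈ W x, ζ ∉ W y := fun ζ h1 h2 => Set.disjoint_left.mp (hW hyx) h2 h1
  have hqeq : ∀ ζ, q ζ = (W y).indicator 1 ζ + (outside W).indicator 1 ζ * Q.avg q ζ := by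
    intro ζ
    conv_lhs => rw [hq, pot_eq]
    rfl
  have hsrc : ∀ ζ ∈ W x, jumpRateTo Q W y ζ / (Q.lam ζ + α) =
      Q.escWeight W x α ζ * Q.avg q ζ := by
    intro ζ hζ
    rw [jumpRateTo_eq hpos hirr hne hrec (mem_iUnion.mpr ⟨x, hζ⟩) (hxy ζ hζ), escWeight_well hζ,
      ENNReal.mul_div_right_comm]
  have heq : q + ((W x).indicator fun ζ => jumpRateTo Q W y ζ / (Q.lam ζ + α)) =
      (W y).indicator 1 + Q.wavg (Q.escWeight W x α) q := by
    funext ζ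
    simp only [Pi.add_apply, RateMatrix.wavg]
    rw [hqeq ζ]
    rcases mem_cases W x ζ with h | h | h
    · rw [indicator_of_mem h.1, indicator_of_notMem h.2.2, hsrc ζ h.1]; simp
    · rw [indicator_of_notMem h.1, indicator_of_notMem h.2.2, escWeight_other h.2.1]; simp
    · rw [indicator_of_notMem h.1, indicator_of_mem h.2.2, escWeight_outside h.2.2]; simp
  have := add_pot_eq_pot Q heq (η := η) (tendsto_iterate_of_le Q ENNReal.one_ne_top hq1
    (tendsto_iterate_one hirr hrec (escWeight_le_avoid hb) η))
  have hq0 : q η = 0 := by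
    rw [hqeq, indicator_of_notMem (hxy η hη),
      indicator_of_notMem (show η ∉ outside W from fun h' => h' (mem_iUnion.mpr ⟨x, hη⟩))]
    simp
  rw [hq0, zero_add] at this
  exact this.symm

variable (Q) in
/-- The mean of the integral of `f` along the time spent in the well of `x` before `a` is reached. -/
def RateMatrix.hitMean (W : S → Set E) (x : S) (a : E) (f : E → ℝ≥0∞) : E → ℝ≥0∞ :=
  Q.pot (avoid a) (fun ζ => avoid a ζ * ((W x).indicator f ζ / Q.lam ζ))

/-- The integrand lives on the well, so nothing is collected before the well is entered, and the
bound at the points of the well passes to all starting points by averaging. -/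
theorem hitMean_le {a : E} {f : E → ℝ≥0∞} {ε : ℝ≥0∞}
    (h : ∀ η ∈ W x, Q.hitMean W x a f η ≤ ε) (η : E) : Q.hitMean W x a f η ≤ ε := by
  refine pot_le_of_sum_le Q (v := fun _ => ε) (fun n => ?_) η
  induction n with
  | zero => intro _; simp
  | succ n ih =>
    intro ζ
    by_cases hζ : ζ ∈ W x
    · exact (sum_le_pot Q _ _ _ ζ).trans (h ζ hζ)
    · rw [sum_range_succ_wavg, Pi.add_apply, indicator_of_notMem hζ, ENNReal.zero_div, mul_zero,
        zero_add]
      exact (mul_le_mul' (indicator_le_one _ _) (avg_le_const Q ih ζ)).trans (one_mul _).le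

theorem hitMean_mono {a : E} {f g : E → ℝ≥0∞} (h : ∀ ζ ∈ W x, f ζ ≤ g ζ) :
    Q.hitMean W x a f ≤ Q.hitMean W x a g := by
  refine pot_mono Q le_rfl fun ζ => mul_le_mul' le_rfl (ENNReal.div_le_div_right ?_ _)
  by_cases hζ : ζ ∈ W x
  · rw [indicator_of_mem hζ, indicator_of_mem hζ]; exact h ζ hζ
  · rw [indicator_of_notMem hζ]; exact zero_le

theorem hitMean_const_mul {a : E} (c : ℝ≥0∞) (f : E → ℝ≥0∞) (η : E) :
    Q.hitMean W x a (fun ζ => c * f ζ) η = c * Q.hitMean W x a f η := by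
  rw [RateMatrix.hitMean, RateMatrix.hitMean, ← pot_const_mul]
  congr 1
  funext ζ
  by_cases h : ζ ∈ W x
  · rw [indicator_of_mem h, indicator_of_mem h, mul_div_assoc, mul_left_comm]
  · rw [indicator_of_notMem h, indicator_of_notMem h]; simp

/-- The discounted mean of `f` until the escape from the well is, up to an error, proportional to
the mean of `f` over a cycle. -/
theorem escMean_bounds (hpos : ∀ η, 0 < Q.hold η) (hirr : Q.IsIrreducible) (hrec : Q.IsRecurrent)
    (hα : 0 < α) {b : E} (hb : b ∈ otherWells W x) {a : E} (ha : a ∈ W x)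
    {f : E → ℝ≥0∞} {ε : ℝ≥0∞} (hε : ε ≠ ∞) (hf : ∀ η ∈ W x, Q.hitMean W x a f η ≤ ε) (η : E) :
    Q.escMean W x α f η ≤ ε + Q.cyc a (fun ζ => (W x).indicator f ζ / Q.lam ζ) *
        Q.pot (Q.escWeight W x α) (fun ζ => Q.escWeight W x α a * point a ζ) η ∧
      Q.cyc a (fun ζ => (W x).indicator f ζ / Q.lam ζ) *
        Q.pot (Q.escWeight W x α) (fun ζ => Q.escWeight W x α a * point a ζ) η ≤
      Q.escMean W x α f η + ε := by
  set g : E → ℝ≥0∞ := Q.hitMean W x a f with hg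
  set C := Q.cyc a (fun ζ => (W x).indicator f ζ / Q.lam ζ) with hC
  have hgle : ∀ ζ, g ζ ≤ ε := hitMean_le hf
  have hgeq : ∀ ζ, g ζ = avoid a ζ * ((W x).indicator f ζ / Q.lam ζ) + avoid a ζ * Q.avg g ζ := by
    intro ζ
    conv_lhs => rw [hg, RateMatrix.hitMean, pot_eq]
    rfl
  have hCeq : C = (W x).indicator f a / Q.lam a + Q.avg g a := rfl
  have hmul : ∀ ζ ∈ W x, f ζ / (Q.lam ζ + α) = Q.escWeight W x α ζ * (f ζ / Q.lam ζ) := by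
    intro ζ hζ
    rw [escWeight_well hζ, div_eq_mul_inv, div_eq_mul_inv, div_eq_mul_inv]
    have : Q.lam ζ * (Q.lam ζ)⁻¹ = 1 :=
      ENNReal.mul_inv_cancel (lam_ne_zero hpos ζ) (lam_ne_top ζ)
    calc f ζ * (Q.lam ζ + α)⁻¹ = (Q.lam ζ * (Q.lam ζ)⁻¹) * (f ζ * (Q.lam ζ + α)⁻¹) := by
          rw [this, one_mul]
      _ = _ := by ring
  -- The function `g` belongs to the problem stopped at `a`, the potential to the problem discounted
  -- in the well and stopped in the other wells. The remainder `r` is the amount of `g` lost by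
  -- discounting and by stopping.
  set r : E → ℝ≥0∞ := (fun ζ => α * (W x).indicator (fun ζ => g ζ / (Q.lam ζ + α)) ζ) +
    (otherWells W x).indicator g with hr
  -- Off `a` this is the one-step equation of `g`. At `a`, where `g` is zero, a new cycle starts,
  -- and its mean `C` appears on the left.
  have heq : g + (fun ζ => C * (Q.escWeight W x α a * point a ζ)) =
      (((W x).indicator fun ζ => f ζ / (Q.lam ζ + α)) + r) + Q.wavg (Q.escWeight W x α) g := by
    funext ζ
    simp only [Pi.add_apply, RateMatrix.wavg, hr]
    rcases mem_cases W x ζ with h | h | h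
    · rw [indicator_of_mem h.1, indicator_of_mem h.1, indicator_of_notMem h.2.1, add_zero,
        hmul ζ h.1]
      by_cases hza : ζ = a
      · subst hza
        rw [hgeq ζ, hCeq, indicator_of_mem h.1]
        simp only [avoid_self, zero_mul, add_zero, point_self, mul_one, ENNReal.zero_div, mul_zero]
        ring
      · have hgz : g ζ = f ζ / Q.lam ζ + Q.avg g ζ := by
          rw [hgeq ζ, avoid_of_ne hza, one_mul, one_mul, indicator_of_mem h.1]
        rw [point_of_ne hza, mul_zero, mul_zero, add_zero, add_right_comm, ← mul_add, ← hgz,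
          escWeight_well h.1, ← mul_div_assoc, ← ENNReal.mul_div_right_comm,
          ENNReal.mul_div_right_comm, ENNReal.mul_div_right_comm, ← add_mul, div_add_div_eq_one hα,
          one_mul]
    · have hza : ζ ≠ a := by rintro rfl; exact h.1 ha
      rw [indicator_of_notMem h.1, indicator_of_notMem h.1, indicator_of_mem h.2.1,
        escWeight_other h.2.1, point_of_ne hza]
      simp
    · have hza : ζ ≠ a := by rintro rfl; exact h.1 ha
      rw [indicator_of_notMem h.1, indicator_of_notMem h.1, indicator_of_notMem h.2.1,
        escWeight_outside h.2.2, point_of_ne hza, hgeq ζ, indicator_of_notMem h.1, avoid_of_ne hza]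
      simp
  have key := add_pot_eq_pot Q heq (η := η) (tendsto_iterate_of_le Q hε hgle
    (tendsto_iterate_one hirr hrec (escWeight_le_avoid hb) η))
  rw [pot_add, Pi.add_apply, pot_const_mul] at key
  change g η + C * _ = Q.escMean W x α f η + _ at key
  -- The remainder is at most `ε` times the source whose potential equals one by
  -- `pot_other_add_escMean`.
  have hrle : Q.pot (Q.escWeight W x α) r η ≤ ε := by
    have h1 : r ≤ fun ζ => ε * ((otherWells W x).indicator 1 ζ +
        α * (W x).indicator (fun ζ => (1 : E → ℝ≥0∞) ζ / (Q.lam ζ + α)) ζ) := by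
      intro ζ
      simp only [hr, Pi.add_apply]
      rcases mem_cases W x ζ with h | h | h
      · rw [indicator_of_mem h.1, indicator_of_mem h.1, indicator_of_notMem h.2.1,
          indicator_of_notMem h.2.1, add_zero, zero_add, mul_left_comm, Pi.one_apply, mul_one_div]
        exact mul_le_mul' le_rfl (ENNReal.div_le_div_right (hgle ζ) _)
      · rw [indicator_of_notMem h.1, indicator_of_notMem h.1, indicator_of_mem h.2.1,
          indicator_of_mem h.2.1]
        simpa using hgle ζ
      · rw [indicator_of_notMem h.1, indicator_of_notMem h.1, indicator_of_notMem h.2.1]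
        simp
    refine (pot_mono Q le_rfl h1 η).trans ?_
    rw [pot_const_mul]
    refine mul_le_of_le_one_right zero_le (le_of_eq ?_)
    rw [← pot_other_add_escMean (Q := Q) hirr hrec hα hb η, RateMatrix.escMean, ← pot_const_mul]
    rw [show (fun ζ => (otherWells W x).indicator 1 ζ +
        α * (W x).indicator (fun ζ => (1 : E → ℝ≥0∞) ζ / (Q.lam ζ + α)) ζ) =
        (otherWells W x).indicator 1 +
        fun ζ => α * (W x).indicator (fun ζ => (1 : E → ℝ≥0∞) ζ / (Q.lam ζ + α)) ζ from rfl,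
      pot_add, Pi.add_apply]
  refine ⟨?_, ?_⟩
  · calc Q.escMean W x α f η ≤ _ := le_self_add
      _ = _ := key.symm
      _ ≤ _ := add_le_add (hgle η) le_rfl
  · calc _ ≤ _ := le_add_self
      _ = _ := key
      _ ≤ _ := add_le_add le_rfl hrle

/-! ### The invariant measure -/

section Invariant

variable {μ : Measure E} [IsProbabilityMeasure μ]

/-- Moving the diagonal term of `∑ μ(η) R(η, ζ) = 0` to the other side shows that `μ λ` is invariant
for the jump chain. -/
theorem tsum_invariant (hpos : ∀ η, 0 < Q.hold η) (hμ : Q.IsInvariant μ) (ζ : E) :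
    ∑' η, μ {η} * Q.lam η * Q.jumpKernel η {ζ} = μ {ζ} * Q.lam ζ := by
  classical
  have h1 := (hμ ζ).update ζ 0
  have h2 : ∀ η, Function.update (fun η => μ.real {η} * Q.rate η ζ) ζ 0 η =
      μ.real {η} * (Q.hold η * Q.jumpProb η ζ) := by
    intro η
    by_cases h : η = ζ
    · subst h; simp [RateMatrix.jumpProb]
    · rw [Function.update_of_ne h, RateMatrix.jumpProb, if_neg (Ne.symm h),
        mul_div_cancel₀ _ (hpos η).ne']
  have h3 : ∀ η, μ {η} * Q.lam η * Q.jumpKernel η {ζ} =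
      ENNReal.ofReal (Function.update (fun η => μ.real {η} * Q.rate η ζ) ζ 0 η) := by
    intro η
    rw [h2, jumpKernel_singleton Q (hpos η).ne', RateMatrix.lam, mul_assoc,
      ENNReal.ofReal_mul measureReal_nonneg, ENNReal.ofReal_mul (Q.hold_nonneg η),
      ofReal_measureReal]
  have h4 : ∀ η, 0 ≤ Function.update (fun η => μ.real {η} * Q.rate η ζ) ζ 0 η := by
    intro η
    rw [h2]
    exact mul_nonneg measureReal_nonneg (mul_nonneg (Q.hold_nonneg η) (Q.jumpProb_nonneg η ζ))
  simp_rw [h3]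
  rw [← ENNReal.ofReal_tsum_of_nonneg h4 h1.summable, h1.tsum_eq, RateMatrix.lam,
    ← ofReal_measureReal (μ := μ) (s := {ζ}), ← ENNReal.ofReal_mul measureReal_nonneg]
  congr 1
  rw [RateMatrix.hold]
  ring

theorem tsum_measure_mul (hpos : ∀ η, 0 < Q.hold η) (hirr : Q.IsIrreducible)
    (hrec : Q.IsRecurrent) (hμ : Q.IsInvariant μ) (a : E) (f : E → ℝ≥0∞) :
    ∑' η, μ {η} * f η = μ {a} * Q.lam a * Q.cyc a (fun ζ => f ζ / Q.lam ζ) := by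
  rw [← tsum_eq_mul_cyc hirr hrec (π := fun η => μ {η} * Q.lam η) (tsum_invariant hpos hμ)
    (fun ζ => ENNReal.mul_ne_top (measure_ne_top μ _) (lam_ne_top ζ)) a]
  refine tsum_congr fun η => ?_
  rw [mul_assoc, ENNReal.mul_div_cancel (lam_ne_zero hpos η) (lam_ne_top η)]

theorem measure_singleton_ne_zero (hpos : ∀ η, 0 < Q.hold η) (hirr : Q.IsIrreducible)
    (hrec : Q.IsRecurrent) (hμ : Q.IsInvariant μ) (a : E) : μ {a} ≠ 0 := by
  intro h0
  have h1 := tsum_measure_mul hpos hirr hrec hμ a (fun _ => 1)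
  simp only [mul_one, h0, zero_mul] at h1
  have h2 : ∑' η, μ {η} = μ univ := by
    rw [← lintegral_one, lintegral_countable']; simp
  rw [h2, measure_univ] at h1
  exact one_ne_zero h1

theorem tsum_subtype_mul (A : Set E) (f : E → ℝ≥0∞) :
    ∑' η : A, f η * μ {(η : E)} = ∑' η, μ {η} * A.indicator f η := by
  rw [tsum_subtype A fun η => f η * μ {η}]
  refine tsum_congr fun η => ?_
  by_cases h : η ∈ A
  · rw [indicator_of_mem h, indicator_of_mem h, mul_comm]
  · rw [indicator_of_notMem h, indicator_of_notMem h, mul_zero]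

/-- A function and its conditional mean have the same mean over a cycle. -/
theorem cyc_condMean (hpos : ∀ η, 0 < Q.hold η) (hirr : Q.IsIrreducible)
    (hrec : Q.IsRecurrent) (hμ : Q.IsInvariant μ) {A : Set E} {a : E} (ha : a ∈ A) (f : E → ℝ≥0∞) :
    Q.cyc a (fun ζ => A.indicator (fun ζ => condMean μ A f * (1 : E → ℝ≥0∞) ζ) ζ / Q.lam ζ) =
      Q.cyc a (fun ζ => A.indicator f ζ / Q.lam ζ) := by
  have hμa := measure_singleton_ne_zero hpos hirr hrec hμ a
  have hμA : μ A ≠ 0 := fun h => hμa (measure_mono_null (singleton_subset_iff.mpr ha) h)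
  have h1 := tsum_measure_mul hpos hirr hrec hμ a (A.indicator f)
  have h2 := tsum_measure_mul hpos hirr hrec hμ a
    (A.indicator fun ζ => condMean μ A f * (1 : E → ℝ≥0∞) ζ)
  have h3 : ∑' η, μ {η} * A.indicator (fun ζ => condMean μ A f * (1 : E → ℝ≥0∞) ζ) η =
      ∑' η, μ {η} * A.indicator f η := by
    rw [← tsum_subtype_mul A f]
    have h4 : ∑' η, μ {η} * A.indicator (fun ζ => condMean μ A f * (1 : E → ℝ≥0∞) ζ) η =
        condMean μ A f * μ A := by
      have h5 : μ A = ∑' η, μ {η} * A.indicator 1 η := by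
        rw [← lintegral_indicator_one (MeasurableSet.of_discrete (s := A)), lintegral_countable']
        exact tsum_congr fun η => mul_comm _ _
      rw [h5, ← ENNReal.tsum_mul_left]
      refine tsum_congr fun η => ?_
      by_cases h : η ∈ A
      · simp only [indicator_of_mem h, Pi.one_apply]; ring
      · simp only [indicator_of_notMem h, mul_zero]
    rw [h4, condMean, ENNReal.div_mul_cancel hμA (measure_ne_top μ A)]
  rw [h3, h1] at h2
  have h5 : μ {a} * Q.lam a ≠ 0 := mul_ne_zero hμa (lam_ne_zero hpos a)
  have h6 : μ {a} * Q.lam a ≠ ∞ := ENNReal.mul_ne_top (measure_ne_top μ _) (lam_ne_top a)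
  exact ((ENNReal.mul_right_inj h5 h6).mp h2).symm

theorem meanExitRate_eq [Fintype S] [DecidableEq S] (W : S → Set E) (x : S) :
    meanExitRate Q μ W x = ∑ y ∈ Finset.univ.erase x, meanRate Q μ W x y := by
  simp only [meanExitRate, meanRate, condMean, exitRate, div_eq_mul_inv, ← Finset.sum_mul]
  congr 1
  rw [← Summable.tsum_finsetSum fun _ _ => ENNReal.summable]
  exact tsum_congr fun η => Finset.sum_mul _ _ _

/-- The discounted probability of escaping to the well of `y` is close to the mean rate
multiplied by the discounted time spent in the well. -/
theorem escape_bounds [Fintype S] [DecidableEq S] (hpos : ∀ η, 0 < Q.hold η)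
    (hirr : Q.IsIrreducible) (hne : Q.NonExplosive) (hrec : Q.IsRecurrent) (hμ : Q.IsInvariant μ)
    (hW : Pairwise fun x y => Disjoint (W x) (W y)) (hα : 0 < α)
    {a : E} (ha : a ∈ W x) {y : S} (hyx : y ≠ x) {b : E} (hb : b ∈ W y) {ε : ℝ≥0∞} (hε : ε ≠ ∞)
    (h2 : ∀ η ∈ W x, Q.hitMean W x a (exitRate Q W x) η ≤ ε)
    (h3 : ∀ η ∈ W x, meanExitRate Q μ W x * Q.hitMean W x a 1 η ≤ ε) {η : E} (hη : η ∈ W x) :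
    Q.pot (Q.escWeight W x α) ((W y).indicator 1) η ≤
        meanRate Q μ W x y * Q.escMean W x α 1 η + 2 * ε ∧
      meanRate Q μ W x y * Q.escMean W x α 1 η ≤
        Q.pot (Q.escWeight W x α) ((W y).indicator 1) η + 2 * ε := by
  have hbo : b ∈ otherWells W x := mem_otherWells hW hyx hb
  have hmem : y ∈ Finset.univ.erase x := Finset.mem_erase.mpr ⟨hyx, Finset.mem_univ y⟩
  have e2 : ∀ η ∈ W x, Q.hitMean W x a (jumpRateTo Q W y) η ≤ ε := fun η hη =>
    (hitMean_mono (fun ζ _ => Finset.single_le_sum (f := fun y => jumpRateTo Q W y ζ)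
      (fun _ _ => zero_le) hmem) η).trans (h2 η hη)
  have e3 : ∀ η ∈ W x, Q.hitMean W x a (fun ζ => meanRate Q μ W x y * (1 : E → ℝ≥0∞) ζ) η ≤ ε := by
    intro η hη
    rw [hitMean_const_mul]
    refine le_trans (mul_le_mul' ?_ le_rfl) (h3 η hη)
    rw [meanExitRate_eq]
    exact Finset.single_le_sum (f := fun y => meanRate Q μ W x y) (fun _ _ => zero_le) hmem
  have b2 := escMean_bounds hpos hirr hrec hα hbo ha hε e2 η
  have b3 := escMean_bounds hpos hirr hrec hα hbo ha hε e3 η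
  -- The jump rate and its conditional mean have the same cycle mean, so both pairs of bounds
  -- contain the same product. It is eliminated between them, at the price of `2 * ε`.
  rw [show meanRate Q μ W x y = condMean μ (W x) (jumpRateTo Q W y) from rfl,
    cyc_condMean hpos hirr hrec hμ ha] at b3
  rw [pot_well_eq_escMean hpos hirr hne hrec hW hbo hyx hη]
  rw [escMean_const_mul] at b3
  refine ⟨?_, ?_⟩
  · calc _ ≤ _ := b2.1
      _ ≤ ε + (_ + ε) := add_le_add le_rfl b3.2
      _ = _ := by rw [meanRate]; ring
  · calc _ ≤ _ := b3.1
      _ ≤ ε + (_ + ε) := add_le_add le_rfl b2.2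
      _ = _ := by ring

end Invariant

/-! ### The attractor -/

theorem exitRate_eq [Fintype S] [DecidableEq S] (hpos : ∀ η, 0 < Q.hold η) (hirr : Q.IsIrreducible)
    (hne : Q.NonExplosive) (hrec : Q.IsRecurrent)
    (hW : Pairwise fun x y => Disjoint (W x) (W y)) {η : E} (hη : η ∈ W x) :
    exitRate Q W x η =
      Q.lam η * Q.avg (Q.pot ((outside W).indicator 1) ((otherWells W x).indicator 1)) η := by
  rw [exitRate, indicator_otherWells hW, pot_finset_sum, avg_finset_sum, Finset.sum_apply,
    Finset.mul_sum]
  refine Finset.sum_congr rfl fun y hy => ?_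
  exact jumpRateTo_eq hpos hirr hne hrec (mem_iUnion.mpr ⟨x, hη⟩) fun h =>
    Set.disjoint_left.mp (hW (Finset.ne_of_mem_erase hy)) h hη

/-- The probability of reaching the other wells before `a` is the smallest solution of its one-step
inequality, and `q + g` is another one. Here `q` is the probability that the first state visited in
the wells, the present one included, lies in another well, and `g` is the mean integral of the exit
rate until `a`. In the well of `x` one has `q = 0` and `exitRate / λ = P q`, so off `a` the first
term of `g` pays for `P q`. At `η` only `g η ≤ ε` remains. -/
theorem one_sub_le_law_hitTime [Fintype S] [DecidableEq S] (hpos : ∀ η, 0 < Q.hold η)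
    (hirr : Q.IsIrreducible) (hne : Q.NonExplosive) (hrec : Q.IsRecurrent)
    (hW : Pairwise fun x y => Disjoint (W x) (W y)) {a : E} (ha : a ∈ W x) {ε : ℝ≥0∞}
    {η : E} (hη : η ∈ W x) (h2 : Q.hitMean W x a (exitRate Q W x) η ≤ ε) :
    1 - ε ≤ Q.law η
      {ω | hitTime (Q.path ω) {a} < hitTime (Q.path ω) (otherWells W x)} := by
  classical
  set D := otherWells W x with hD
  set F : Set E := insert a D with hF
  set q := Q.pot ((outside W).indicator 1) (D.indicator 1) with hq
  set g := Q.hitMean W x a (exitRate Q W x) with hg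
  have haD : a ∉ D := fun h => h.2 ha
  have hqeq : ∀ ζ, q ζ = D.indicator 1 ζ + (outside W).indicator 1 ζ * Q.avg q ζ := by
    intro ζ
    conv_lhs => rw [hq, pot_eq]
    rfl
  have hgeq : ∀ ζ, g ζ = avoid a ζ * ((W x).indicator (exitRate Q W x) ζ / Q.lam ζ) +
      avoid a ζ * Q.avg g ζ := by
    intro ζ
    conv_lhs => rw [hg, RateMatrix.hitMean, pot_eq]
    rfl
  have hbad : Q.pot (Fᶜ.indicator 1) (D.indicator 1) ≤ q + g := by
    refine pot_le_of_le Q fun ζ => ?_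
    simp only [Pi.add_apply, RateMatrix.wavg, avg_add]
    by_cases hζF : ζ ∈ F
    · rw [indicator_of_notMem (show ζ ∉ Fᶜ from fun h => h hζF), zero_mul, add_zero, hqeq ζ, add_assoc]
      exact le_self_add
    · have hza : ζ ≠ a := fun h => hζF (h ▸ mem_insert _ _)
      have hzD : ζ ∉ D := fun h => hζF (mem_insert_of_mem _ h)
      rw [indicator_of_mem (show ζ ∈ Fᶜ from hζF), indicator_of_notMem hzD, zero_add, Pi.one_apply,
        one_mul, hqeq ζ, hgeq ζ, avoid_of_ne hza, one_mul, one_mul, indicator_of_notMem hzD, zero_add]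
      rcases mem_cases W x ζ with h | h | h
      · rw [indicator_of_mem h.1, exitRate_eq hpos hirr hne hrec hW h.1,
          ENNReal.mul_div_right_comm, ENNReal.div_self (lam_ne_zero hpos ζ) (lam_ne_top ζ), one_mul]
        exact le_add_self
      · exact absurd h.2.1 hzD
      · rw [indicator_of_mem h.2.2, indicator_of_notMem h.1, Pi.one_apply, one_mul]
        simp
  have hb : Q.pot (Fᶜ.indicator 1) (D.indicator 1) η ≤ ε := by
    refine (hbad η).trans ?_
    have hq0 : q η = 0 := by
      rw [hqeq, indicator_of_notMem fun h : η ∈ D => h.2 hη,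
        indicator_of_notMem (show η ∉ outside W from fun h' => h' (mem_iUnion.mpr ⟨x, hη⟩))]
      simp
    rw [Pi.add_apply, hq0, zero_add]
    exact h2
  have hmeas := measurable_atFirstHit F (g := fun ζ _ => D.indicator 1 ζ) (fun _ => measurable_const)
  have hmean : ∫⁻ ω, atFirstHit F (fun ζ _ => D.indicator 1 ζ) ω ∂Q.law η =
      Q.pot (Fᶜ.indicator 1) (D.indicator 1) η := by
    have := congrFun (mean_first_hit (Q := Q) F (g := fun ζ _ => D.indicator 1 ζ)
      (fun _ => measurable_const)) η
    refine this.trans ?_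
    congr 1
    funext ζ
    rw [lintegral_const, measure_univ, mul_one]
    by_cases h : ζ ∈ D
    · rw [indicator_of_mem (show ζ ∈ F from mem_insert_of_mem _ h), Pi.one_apply, one_mul]
    · rw [indicator_of_notMem h, mul_zero]
  set B : Set ((ℕ → E) × (ℕ → ℝ)) := {ω | 1 ≤ atFirstHit F (fun ζ _ => D.indicator 1 ζ) ω} with hB
  have hBm : MeasurableSet B := measurableSet_le measurable_const hmeas
  have hBle : Q.law η B ≤ ε := by
    have := mul_meas_ge_le_lintegral (μ := Q.law η) hmeas 1
    rw [one_mul, hmean] at this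
    exact this.trans hb
  have h1 : 1 - ε ≤ Q.law η Bᶜ := by
    rw [prob_compl_eq_one_sub hBm]
    exact tsub_le_tsub_left hBle 1
  refine h1.trans (measure_mono_ae ?_)
  filter_upwards [ae_regular hne η, ae_frequently_visits hirr hrec η a] with ω hω hvis hωB
  obtain ⟨k0, _, hk0⟩ := hvis 0
  have hex : ∃ n, ω.1 n ∈ F := ⟨k0, hk0 ▸ mem_insert _ _⟩
  have hval := tsum_first_hit (fun n => D.indicator (1 : E → ℝ≥0∞) (ω.1 n)) (Nat.find_spec hex)
    fun i hi => Nat.find_min hex hi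
  set k := Nat.find hex
  have hkF : ω.1 k ∈ F := Nat.find_spec hex
  have hmin : ∀ i < k, ω.1 i ∉ F := fun i hi => Nat.find_min hex hi
  have hkD : ω.1 k ∉ D := by
    intro h
    refine hωB ?_
    change 1 ≤ atFirstHit F (fun ζ _ => D.indicator 1 ζ) ω
    rw [atFirstHit, hval, indicator_of_mem h]
    rfl
  have hka : ω.1 k = a := (mem_insert_iff.mp hkF).resolve_right hkD
  have hJ := path_jumpPath Q hω.2
  have hlt := jumpTime_lt hpos hω
  change hitTime (Q.path ω) {a} < hitTime (Q.path ω) D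
  rw [hJ.hitTime_eq hlt (A := {a}) (k := k) hka
    fun i hi h => hmin i hi (mem_insert_iff.mpr (Or.inl h))]
  by_cases hexD : ∃ n, ω.1 n ∈ D
  · rw [hJ.hitTime_eq hlt (Nat.find_spec hexD) fun i hi => Nat.find_min hexD hi]
    have hkn : k < Nat.find hexD := by
      by_contra hcon
      push Not at hcon
      rcases hcon.eq_or_lt with h | h
      · exact hkD (h ▸ Nat.find_spec hexD)
      · exact hmin _ h (mem_insert_of_mem _ (Nat.find_spec hexD))
    exact (hlt k).trans_le (hJ.mono hkn)
  · push Not at hexD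
    rw [hJ.hitTime_eq_top hexD]
    exact (jumpTime_ne_top hpos ω k).lt_top

end Escape

/-! ### Time changes -/

section TimeChange

/-- The identity on `[0, p]`, followed by an affine map of `[p, c]` onto `[p, d]` and by a
translation. -/
def bend (p c d t : ℝ) : ℝ :=
  if t ≤ p then t else if t ≤ c then p + (t - p) * ((d - p) / (c - p)) else t + (d - c)

variable {p c d : ℝ}

theorem bend_of_le {t : ℝ} (h : t ≤ p) : bend p c d t = t := if_pos h

theorem bend_of_mid {t : ℝ} (h1 : p < t) (h2 : t ≤ c) :
    bend p c d t = p + (t - p) * ((d - p) / (c - p)) := by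
  rw [bend, if_neg (not_le.mpr h1), if_pos h2]

theorem bend_of_ge {t : ℝ} (hc : p < c) (h : c ≤ t) : bend p c d t = t + (d - c) := by
  rcases h.eq_or_lt with rfl | h
  · rw [bend_of_mid hc le_rfl, mul_div_cancel₀ _ (sub_pos.mpr hc).ne']; ring
  · rw [bend, if_neg (not_le.mpr (hc.trans h)), if_neg (not_le.mpr h)]

theorem bend_bend (hc : p < c) (hd : p < d) (t : ℝ) : bend p d c (bend p c d t) = t := by
  have hc' : c - p ≠ 0 := (sub_pos.mpr hc).ne'
  have hd' : d - p ≠ 0 := (sub_pos.mpr hd).ne'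
  have hk : 0 < (d - p) / (c - p) := div_pos (sub_pos.mpr hd) (sub_pos.mpr hc)
  rcases le_or_gt t p with h1 | h1
  · rw [bend_of_le h1, bend_of_le h1]
  · rcases le_or_gt t c with h2 | h2
    · rw [bend_of_mid h1 h2, bend_of_mid]
      · field_simp
        ring
      · have := mul_pos (sub_pos.mpr h1) hk
        linarith
      · have h3 : (t - p) * ((d - p) / (c - p)) ≤ (c - p) * ((d - p) / (c - p)) :=
          mul_le_mul_of_nonneg_right (by linarith) hk.le
        rw [mul_div_cancel₀ _ hc'] at h3
        linarith
    · rw [bend_of_ge hc h2.le, bend_of_ge hd (by linarith)]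
      ring

theorem le_bend (hc : p < c) (hd : p < d) {t : ℝ} (h : p ≤ t) : p ≤ bend p c d t := by
  rcases h.eq_or_lt with rfl | h1
  · rw [bend_of_le le_rfl]
  · rcases le_or_gt t c with h2 | h2
    · rw [bend_of_mid h1 h2]
      have := mul_pos (sub_pos.mpr h1) (div_pos (sub_pos.mpr hd) (sub_pos.mpr hc))
      linarith
    · rw [bend_of_ge hc h2.le]; linarith

theorem bend_mono (hc : p < c) (hd : p < d) : Monotone (bend p c d) := by
  have hk : 0 < (d - p) / (c - p) := div_pos (sub_pos.mpr hd) (sub_pos.mpr hc)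
  intro s t hst
  rcases le_or_gt s p with h1 | h1
  · rw [bend_of_le h1]
    rcases le_or_gt t p with h2 | h2
    · rwa [bend_of_le h2]
    · exact h1.trans (le_bend hc hd h2.le)
  · rcases le_or_gt s c with h2 | h2
    · rw [bend_of_mid h1 h2]
      rcases le_or_gt t c with h3 | h3
      · rw [bend_of_mid (h1.trans_le hst) h3]
        have := mul_le_mul_of_nonneg_right (show s - p ≤ t - p by linarith) hk.le
        linarith
      · rw [bend_of_ge hc h3.le]
        have h4 := mul_le_mul_of_nonneg_right (show s - p ≤ c - p by linarith) hk.le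
        rw [mul_div_cancel₀ _ (sub_pos.mpr hc).ne'] at h4
        linarith
    · rw [bend_of_ge hc h2.le, bend_of_ge hc (h2.le.trans hst)]
      linarith

theorem bend_nonneg (hp : 0 ≤ p) (hc : p < c) (hd : p < d) {t : ℝ} (ht : 0 ≤ t) :
    0 ≤ bend p c d t := by
  rcases le_or_gt t p with h1 | h1
  · rwa [bend_of_le h1]
  · exact hp.trans (le_bend hc hd h1.le)

theorem abs_bend_sub_le (hc : p < c) (t : ℝ) : |bend p c d t - t| ≤ |d - c| := by
  rcases le_or_gt t p with h1 | h1
  · rw [bend_of_le h1, sub_self, abs_zero]; exact abs_nonneg _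
  · rcases le_or_gt t c with h2 | h2
    · rw [bend_of_mid h1 h2]
      have hc' : 0 < c - p := sub_pos.mpr hc
      have : p + (t - p) * ((d - p) / (c - p)) - t = (d - c) * ((t - p) / (c - p)) := by
        field_simp
        ring
      rw [this, abs_mul]
      refine mul_le_of_le_one_right (abs_nonneg _) ?_
      rw [abs_of_nonneg (div_nonneg (by linarith) hc'.le), div_le_one hc']
      linarith
    · rw [bend_of_ge hc h2.le]; simp

/-- `bend` as an increasing bijection of the half-line. -/
def bendIso (hp : 0 ≤ p) (hc : p < c) (hd : p < d) : ℝ≥0 ≃o ℝ≥0 :=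
  Equiv.toOrderIso
    { toFun := fun t => ⟨bend p c d t, bend_nonneg hp hc hd t.2⟩
      invFun := fun t => ⟨bend p d c t, bend_nonneg hp hd hc t.2⟩
      left_inv := fun t => NNReal.coe_injective (bend_bend hc hd t)
      right_inv := fun t => NNReal.coe_injective (bend_bend hd hc t) }
    (fun _ _ h => bend_mono hc hd (NNReal.coe_le_coe.mpr h))
    (fun _ _ h => bend_mono hd hc (NNReal.coe_le_coe.mpr h))

theorem coe_bendIso (hp : 0 ≤ p) (hc : p < c) (hd : p < d) (t : ℝ≥0) :
    (bendIso hp hc hd t : ℝ) = bend p c d t := rfl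

/-- Each new point costs one further `bend`. It fixes `[0, b n]`, where the earlier points have
already been placed, and moves the current image `a (n + 1) + (b n - a n)` of the next point to `b
(n + 1)`. Its displacement is at most the difference of two errors, whence `2 * δ` per step. -/
theorem exists_timeChange {a b : ℕ → ℝ} {δ : ℝ} (ha0 : a 0 = 0) (hb0 : b 0 = 0) (n : ℕ)
    (ha : ∀ i < n, a i < a (i + 1)) (hb : ∀ i < n, b i < b (i + 1))
    (hab : ∀ i ≤ n, |b i - a i| ≤ δ) :
    ∃ φ : ℝ≥0 ≃o ℝ≥0, (∀ i ≤ n, ∀ t : ℝ≥0, (t : ℝ) = a i → (φ t : ℝ) = b i) ∧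
      (∀ t, |(φ t : ℝ) - t| ≤ n * (2 * δ)) ∧ ∀ t : ℝ≥0, a n ≤ t → (φ t : ℝ) = t + (b n - a n) := by
  induction n with
  | zero =>
    refine ⟨OrderIso.refl _, ?_, ?_, ?_⟩
    · intro i hi t ht
      obtain rfl : i = 0 := by omega
      rw [OrderIso.refl_apply, ht, ha0, hb0]
    · intro t; simp
    · intro t _; simp [ha0, hb0]
  | succ n ih =>
    obtain ⟨φ, h1, h2, h3⟩ := ih (fun i hi => ha i (by omega)) (fun i hi => hb i (by omega))
      (fun i hi => hab i (by omega))
    have han : ∀ i ≤ n + 1, 0 ≤ a i := by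
      intro i hi
      induction i with
      | zero => rw [ha0]
      | succ i ih => exact (ih (by omega)).trans (ha i (by omega)).le
    have hbn : ∀ i ≤ n + 1, 0 ≤ b i := by
      intro i hi
      induction i with
      | zero => rw [hb0]
      | succ i ih => exact (ih (by omega)).trans (hb i (by omega)).le
    have hbm : ∀ i ≤ n, b i ≤ b n := by
      intro i hi
      refine Nat.le_induction (P := fun m _ => m ≤ n → b i ≤ b m) (fun _ => le_rfl)
        (fun m _ ih hm => (ih (by omega)).trans (hb m (by omega)).le) n hi le_rfl
    have hp := hbn n (by omega)
    have hlt := ha n (by omega)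
    have hc : b n < a (n + 1) + (b n - a n) := by linarith
    have hd := hb n (by omega)
    refine ⟨φ.trans (bendIso hp hc hd), ?_, ?_, ?_⟩
    · intro i hi t ht
      rw [OrderIso.trans_apply, coe_bendIso]
      rcases Nat.lt_or_ge n i with h4 | h4
      · obtain rfl : i = n + 1 := by omega
        rw [h3 t (by rw [ht]; exact hlt.le), ht, bend_of_ge hc le_rfl]
        ring
      · rw [h1 i h4 t ht, bend_of_le (hbm i h4)]
    · intro t
      rw [OrderIso.trans_apply, coe_bendIso]
      have h4 := abs_bend_sub_le (d := b (n + 1)) hc (φ t : ℝ)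
      have h5 := h2 t
      have h6 : |b (n + 1) - (a (n + 1) + (b n - a n))| ≤ 2 * δ := by
        have e1 := hab (n + 1) le_rfl
        have e2 := hab n (by omega)
        rw [abs_le] at e1 e2 ⊢
        constructor <;> linarith
      have h7 := abs_sub_le (bend (b n) (a (n + 1) + (b n - a n)) (b (n + 1)) (φ t)) (φ t) t
      push_cast
      linarith
    · intro t ht
      rw [OrderIso.trans_apply, coe_bendIso, h3 t (hlt.le.trans ht), bend_of_ge hc (by linarith)]
      ring

end TimeChange

/-! ### The Skorohod topology and jump sequences -/

section Skorohod

/-- A trajectory with strictly increasing jump times. -/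
structure StrictJumpPath {α : Type*} (e : ℝ≥0 → α) (J : ℕ → ℝ≥0∞) (y : ℕ → α) : Prop
    extends JumpPath e J y where
  lt : ∀ n, J n ≠ ∞ → J n < J (n + 1)

theorem StrictJumpPath.isCadlag {α : Type*} {e : ℝ≥0 → α} {J : ℕ → ℝ≥0∞} {y : ℕ → α}
    (h : StrictJumpPath e J y) : IsCadlag e := by
  intro t
  have hcont : Continuous fun s : ℝ≥0 => (s : ℝ≥0∞) := ENNReal.continuous_coe
  obtain ⟨n, h1, h2⟩ := h.exists_index t
  refine ⟨?_, ?_⟩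
  · have h3 : ∀ᶠ s : ℝ≥0 in 𝓝 t, (s : ℝ≥0∞) < J (n + 1) := hcont.continuousAt.eventually_lt_const h2
    filter_upwards [nhdsWithin_le_nhds h3, self_mem_nhdsWithin] with s hs hst
    rw [h.eq n t h1 h2, h.eq n s (h1.trans (by exact_mod_cast hst)) hs]
  · rcases h1.eq_or_lt with h3 | h3
    · cases n with
      | zero =>
        have ht : t = 0 := by
          have := h.zero
          rw [h3] at this
          exact_mod_cast this
        refine ⟨e t, ?_⟩
        rw [ht]
        filter_upwards [self_mem_nhdsWithin] with s hs
        exact absurd (show s < 0 from hs) not_lt_zero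
      | succ n =>
        have hfin : J n ≠ ∞ := ne_top_of_le_ne_top ENNReal.coe_ne_top ((h.mono (Nat.le_succ n)).trans h1)
        have h4 : J n < t := h3 ▸ h.lt n hfin
        have h5 : ∀ᶠ s : ℝ≥0 in 𝓝 t, J n < (s : ℝ≥0∞) := hcont.continuousAt.eventually_const_lt h4
        refine ⟨y n, ?_⟩
        filter_upwards [nhdsWithin_le_nhds h5, self_mem_nhdsWithin] with s hs hst
        refine h.eq n s hs.le ?_
        rw [h3]
        exact_mod_cast hst
    · have h5 : ∀ᶠ s : ℝ≥0 in 𝓝 t, J n < (s : ℝ≥0∞) := hcont.continuousAt.eventually_const_lt h3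
      refine ⟨y n, ?_⟩
      filter_upwards [nhdsWithin_le_nhds h5, self_mem_nhdsWithin] with s hs hst
      refine h.eq n s hs.le (lt_trans ?_ h2)
      exact_mod_cast hst

/-- The time change matches the jumps of `e` up to time `T` with those of `e'`. After the last of
them it is a translation by at most `δ`, so `hlast` excludes a further jump of `e'` before the image
of `T`. -/
theorem close_of_jumps {α : Type*} {e e' : SkorohodSpace α} {J J' : ℕ → ℝ≥0∞} {y y' : ℕ → α}
    (h : StrictJumpPath e.1 J y) (h' : StrictJumpPath e'.1 J' y') {T ε : ℝ≥0} {n : ℕ} {δ : ℝ}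
    (h1 : J n ≤ T) (h2 : (T : ℝ≥0∞) < J (n + 1)) (hfin : ∀ i ≤ n, J' i ≠ ∞)
    (hy : ∀ i ≤ n, y' i = y i) (hJ : ∀ i ≤ n, |(J' i).toReal - (J i).toReal| ≤ δ)
    (hδ : n * (2 * δ) ≤ ε) (hlast : ENNReal.ofReal (T + δ) < J' (n + 1)) :
    SkorohodSpace.Close T ε e e' := by
  have hJfin : ∀ i ≤ n, J i ≠ ∞ := fun i hi =>
    ne_top_of_le_ne_top ENNReal.coe_ne_top ((h.mono hi).trans h1)
  have ha0 : (J 0).toReal = 0 := by rw [h.zero]; rfl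
  have hb0 : (J' 0).toReal = 0 := by rw [h'.zero]; rfl
  obtain ⟨φ, e1, e2, e3⟩ := exists_timeChange (a := fun i => (J i).toReal)
    (b := fun i => (J' i).toReal) ha0 hb0 n
    (fun i hi => (ENNReal.toReal_lt_toReal (hJfin i (by omega)) (hJfin (i + 1) hi)).mpr
      (h.lt i (hJfin i (by omega))))
    (fun i hi => (ENNReal.toReal_lt_toReal (hfin i (by omega)) (hfin (i + 1) hi)).mpr
      (h'.lt i (hfin i (by omega)))) hJ
  have hφ : ∀ i ≤ n, (φ (J i).toNNReal : ℝ≥0∞) = J' i := by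
    intro i hi
    have := e1 i hi (J i).toNNReal rfl
    rw [← ENNReal.coe_toNNReal (hfin i hi)]
    congr 1
    exact NNReal.coe_injective this
  have hlow : ∀ i ≤ n, ∀ t : ℝ≥0, J i ≤ t → J' i ≤ φ t := by
    intro i hi t ht
    rw [← hφ i hi]
    have : (J i).toNNReal ≤ t := by
      rw [← ENNReal.coe_le_coe, ENNReal.coe_toNNReal (hJfin i hi)]; exact ht
    exact_mod_cast φ.monotone this
  refine ⟨φ, fun t ht => ⟨?_, ?_⟩⟩
  · rw [NNReal.dist_eq]
    exact (e2 t).trans hδ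
  · obtain ⟨i, h3, h4⟩ := h.exists_index t
    have hin : i ≤ n := by
      by_contra hcon
      have : J (n + 1) ≤ J i := h.mono (by omega)
      have h5 : (T : ℝ≥0∞) < t := h2.trans_le (this.trans h3)
      exact absurd ht (not_le.mpr (by exact_mod_cast h5))
    rw [h.eq i t h3 h4, ← hy i hin]
    refine h'.eq i _ (hlow i hin t h3) ?_
    rcases hin.eq_or_lt with rfl | hlt
    · refine lt_of_le_of_lt ?_ hlast
      have h5 : (J i).toReal ≤ t := by
        rw [← ENNReal.coe_toReal]; exact ENNReal.toReal_mono ENNReal.coe_ne_top h3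
      have h6 := e3 t h5
      rw [← ENNReal.ofReal_coe_nnreal, h6]
      refine ENNReal.ofReal_le_ofReal ?_
      have h7 := (abs_le.mp (hJ i le_rfl)).2
      have h8 : (t : ℝ) ≤ T := NNReal.coe_le_coe.mpr ht
      linarith
    · rw [← hφ (i + 1) hlt]
      have : t < (J (i + 1)).toNNReal := by
        rw [← ENNReal.coe_lt_coe, ENNReal.coe_toNNReal (hJfin (i + 1) hlt)]; exact h4
      exact_mod_cast φ.strictMono this

variable {S : Type*}

open Classical in
/-- The coordinates `exp (- J n) 1 {y n = s}` of a jump sequence. -/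
def mark (J : ℕ → ℝ≥0∞) (y : ℕ → S) (p : ℕ × S) : ℝ≥0∞ := if y p.1 = p.2 then en (J p.1) else 0

theorem mark_le_one (J : ℕ → ℝ≥0∞) (y : ℕ → S) (p : ℕ × S) : mark J y p ≤ 1 := by
  unfold mark
  split_ifs
  · exact en_le_one _
  · exact zero_le

theorem mark_ne_top (J : ℕ → ℝ≥0∞) (y : ℕ → S) (p : ℕ × S) : mark J y p ≠ ∞ :=
  ne_top_of_le_ne_top ENNReal.one_ne_top (mark_le_one J y p)

/-- The coordinates of a jump sequence, as a point of a compact space. -/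
def code (J : ℕ → ℝ≥0∞) (y : ℕ → S) : ℕ × S → unitInterval := fun p =>
  ⟨(mark J y p).toReal, ENNReal.toReal_nonneg,
    ENNReal.toReal_le_of_le_ofReal zero_le_one (by simpa using mark_le_one J y p)⟩

/-- Trajectories with values in `S ∪ {𝔡}` that stay in `S` and jump as prescribed. -/
def Follows (e : SkorohodSpace (Option S)) (J : ℕ → ℝ≥0∞) (y : ℕ → S) : Prop :=
  StrictJumpPath e.1 J fun n => some (y n)

/-- A trajectory near `e` on `[0, T]` is recognized from finitely many marks: those of the jumps of
index at most `n` are prescribed up to `δ`, and an upper bound on the marks of index `n + 1`, for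
every label, puts the next jump after `T'`. An infinite jump time has mark zero, so absorbed
trajectories need no separate treatment. -/
theorem exists_isOpen_code [Finite S] {G : Set (SkorohodSpace (Option S))} (hG : IsOpen G)
    {e : SkorohodSpace (Option S)} (he : e ∈ G) {J : ℕ → ℝ≥0∞} {y : ℕ → S} (h : Follows e J y) :
    ∃ O : Set (ℕ × S → unitInterval), IsOpen O ∧ code J y ∈ O ∧
      ∀ e' J' y', Follows e' J' y' → code J' y' ∈ O → e' ∈ G := by
  obtain ⟨T, ε, hε, hclose⟩ := hG e he
  obtain ⟨n, h1, h2⟩ := h.exists_index T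
  have hJfin : ∀ i ≤ n, J i ≠ ∞ := fun i hi =>
    ne_top_of_le_ne_top ENNReal.coe_ne_top ((h.mono hi).trans h1)
  obtain ⟨T', hT1, hT2⟩ := ENNReal.lt_iff_exists_nnreal_btwn.mp h2
  have hTT : (T : ℝ) < T' := by exact_mod_cast hT1
  -- The first term keeps `T + δ` below the next jump, the second makes the total displacement `n *
  -- (2 * δ)` at most `ε`.
  set δ : ℝ := min (T' - T) (ε / (2 * (n + 1))) with hδ
  have hδpos : 0 < δ := lt_min (by linarith) (div_pos hε (by positivity))
  have hδε : n * (2 * δ) ≤ ε := by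
    have h3 : δ ≤ ε / (2 * (n + 1)) := min_le_right _ _
    rw [le_div_iff₀ (by positivity)] at h3
    nlinarith
  have hδT : (T : ℝ) + δ ≤ T' := by
    have : δ ≤ T' - T := min_le_left _ _
    linarith
  refine ⟨(⋂ i ∈ Finset.range (n + 1), {v | Real.exp (-((J i).toReal + δ)) < v (i, y i) ∧
      (v (i, y i) : ℝ) < Real.exp (-((J i).toReal - δ))}) ∩
      ⋂ s : S, {v | (v (n + 1, s) : ℝ) < Real.exp (-T')}, ?_, ⟨?_, ?_⟩, ?_⟩
  · refine IsOpen.inter (isOpen_biInter_finset fun i _ => ?_) (isOpen_iInter_of_finite fun s => ?_)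
    · have hc : Continuous fun v : ℕ × S → unitInterval => (v (i, y i) : ℝ) := by fun_prop
      exact (isOpen_lt continuous_const hc).inter (isOpen_lt hc continuous_const)
    · have hc : Continuous fun v : ℕ × S → unitInterval => (v (n + 1, s) : ℝ) := by fun_prop
      exact isOpen_lt hc continuous_const
  · simp only [Finset.mem_range, mem_iInter]
    intro i hi
    have hv : (code J y (i, y i) : ℝ) = Real.exp (-(J i).toReal) := by
      simp only [code, mark, if_true]
      rw [← ENNReal.ofReal_toReal (hJfin i (by omega)), en_ofReal ENNReal.toReal_nonneg,
        ENNReal.toReal_ofReal (Real.exp_pos _).le, ENNReal.toReal_ofReal ENNReal.toReal_nonneg]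
    simp only [mem_ofPred_eq, hv, Real.exp_lt_exp]
    constructor <;> linarith
  · simp only [mem_iInter]
    intro s
    have h3 : mark J y (n + 1, s) < en T' := by
      unfold mark
      split_ifs
      · exact en_strictAnti hT2
      · rw [← en_top]; exact en_strictAnti ENNReal.coe_lt_top
    have h4 := (ENNReal.toReal_lt_toReal (mark_ne_top _ _ _) (en_ne_top _)).mpr h3
    rw [en_coe, ENNReal.toReal_ofReal (Real.exp_pos _).le] at h4
    exact h4
  · rintro e' J' y' h' ⟨hO1, hO2⟩
    simp only [Finset.mem_range, mem_iInter] at hO1 hO2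
    -- A strictly positive mark at `(i, y i)` forces the label to be `y i` and the jump time to be
    -- finite.
    have hpos : ∀ i ≤ n, y' i = y i ∧ J' i ≠ ∞ ∧ |(J' i).toReal - (J i).toReal| ≤ δ := by
      intro i hi
      obtain ⟨h3, h4⟩ := hO1 i (by omega)
      have hyi : y' i = y i := by
        by_contra hcon
        simp only [code, mark, if_neg hcon, ENNReal.toReal_zero] at h3
        exact absurd h3 (not_lt.mpr (Real.exp_pos _).le)
      have hfin : J' i ≠ ∞ := by
        intro hcon
        simp only [code, mark, if_pos hyi, hcon, en_top, ENNReal.toReal_zero] at h3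
        exact absurd h3 (not_lt.mpr (Real.exp_pos _).le)
      have hv : (code J' y' (i, y i) : ℝ) = Real.exp (-(J' i).toReal) := by
        simp only [code, mark, if_pos hyi]
        rw [← ENNReal.ofReal_toReal hfin, en_ofReal ENNReal.toReal_nonneg,
          ENNReal.toReal_ofReal (Real.exp_pos _).le, ENNReal.toReal_ofReal ENNReal.toReal_nonneg]
      rw [hv, Real.exp_lt_exp] at h3 h4
      refine ⟨hyi, hfin, abs_le.mpr ⟨?_, ?_⟩⟩ <;> linarith
    refine hclose e' (close_of_jumps h h' h1 h2 (fun i hi => (hpos i hi).2.1)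
      (fun i hi => congrArg some (hpos i hi).1) (fun i hi => (hpos i hi).2.2) hδε ?_)
    refine lt_of_le_of_lt (ENNReal.ofReal_le_ofReal hδT) ?_
    rw [ENNReal.ofReal_coe_nnreal]
    have h5 := hO2 (y' (n + 1))
    simp only [code, mark, if_true, mem_ofPred_eq] at h5
    by_contra hcon
    push Not at hcon
    have h6 := ENNReal.toReal_mono (en_ne_top _) (en_antitone hcon)
    rw [en_coe, ENNReal.toReal_ofReal (Real.exp_pos _).le] at h6
    exact absurd h5 (not_lt.mpr h6)

/-- Open sets of trajectories correspond to open sets of jump sequences. -/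
theorem exists_isOpen_mem_iff [Finite S] {G : Set (SkorohodSpace (Option S))} (hG : IsOpen G) :
    ∃ O : Set (ℕ × S → unitInterval), IsOpen O ∧
      ∀ e J y, Follows e J y → (e ∈ G ↔ code J y ∈ O) := by
  refine ⟨⋃₀ {O | IsOpen O ∧ ∀ e' J' y', Follows e' J' y' → code J' y' ∈ O → e' ∈ G},
    isOpen_sUnion fun O hO => hO.1, fun e J y h => ⟨fun he => ?_, ?_⟩⟩
  · obtain ⟨O, h1, h2, h3⟩ := exists_isOpen_code hG he h
    exact ⟨O, ⟨h1, h3⟩, h2⟩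
  · rintro ⟨O, hO, hmem⟩
    exact hO.2 e J y h hmem

/-- Off a measurable null set the preimage of an open set of trajectories is the preimage of an open
set of codes; on the null set the map is replaced by a constant. -/
theorem aemeasurable_of_follows [Finite S] {Ω : Type*} [MeasurableSpace Ω] {P : Measure Ω}
    {X : Ω → SkorohodSpace (Option S)} {J : Ω → ℕ → ℝ≥0∞} {y : Ω → ℕ → S}
    (hm : Measurable fun ω => code (J ω) (y ω)) (h : ∀ᵐ ω ∂P, Follows (X ω) (J ω) (y ω)) :
    AEMeasurable X P := by
  classical
  obtain ⟨B, hB, hBm, hB0⟩ := exists_measurable_superset_of_null (ae_iff.mp h)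
  set d : SkorohodSpace (Option S) := ⟨fun _ => none, fun _ => ⟨.of_forall fun _ => rfl,
    none, .of_forall fun _ => rfl⟩⟩
  refine ⟨B.piecewise (fun _ => d) X, ?_, ?_⟩
  · refine measurable_of_isOpen fun G hG => ?_
    obtain ⟨O, hO, hiff⟩ := exists_isOpen_mem_iff hG
    have heq : B.piecewise (fun _ => d) X ⁻¹' G = (B ∩ {_ω | d ∈ G}) ∪
        (Bᶜ ∩ (fun ω => code (J ω) (y ω)) ⁻¹' O) := by
      ext ω
      by_cases hω : ω ∈ B
      · simp [hω]
      · have hF : Follows (X ω) (J ω) (y ω) := by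
          by_contra hcon
          exact hω (hB hcon)
        simp only [mem_preimage, piecewise_eq_of_notMem _ _ _ hω, mem_union, mem_inter_iff, hω,
          false_and, false_or, mem_compl_iff, not_false_eq_true, true_and]
        exact hiff _ _ _ hF
    rw [heq]
    exact (hBm.inter (.const _)).union (hBm.compl.inter (hm hO.measurableSet))
  · have hB1 : ∀ᵐ ω ∂P, ω ∉ B := measure_eq_zero_iff_ae_notMem.mp hB0
    filter_upwards [hB1] with ω hω
    rw [piecewise_eq_of_notMem _ _ _ hω]

end Skorohod

/-! ### Convergence in distribution from the convergence of moments -/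

section Moments

/-- A coordinate of the cube, as a continuous function. -/
def cubeCoord {ι : Type*} (i : ι) : C(ι → unitInterval, ℝ) := ⟨fun v => (v i : ℝ), by fun_prop⟩

theorem separatesPoints_adjoin_cubeCoord (ι : Type*) :
    (Algebra.adjoin ℝ (range (cubeCoord (ι := ι)))).SeparatesPoints := by
  intro v w hvw
  obtain ⟨i, hi⟩ := Function.ne_iff.mp hvw
  refine ⟨cubeCoord i, ⟨cubeCoord i, Algebra.subset_adjoin (mem_range_self i), rfl⟩, ?_⟩
  intro h
  exact hi (Subtype.ext h)

/-- Finite products of coordinates span a subalgebra that separates the points of the cube, dense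
among the continuous functions by Stone–Weierstrass. -/
theorem tendsto_of_tendsto_moments {ι : Type*} [Countable ι]
    {P : ℕ → ProbabilityMeasure (ι → unitInterval)} {P' : ProbabilityMeasure (ι → unitInterval)}
    (h : ∀ L : List ι, Tendsto (fun N => ∫ v : ι → unitInterval, (L.map fun i => (v i : ℝ)).prod ∂(P N : Measure _))
      atTop (𝓝 (∫ v : ι → unitInterval, (L.map fun i => (v i : ℝ)).prod ∂(P' : Measure _)))) :
    Tendsto P atTop (𝓝 P') := by
  set A := Algebra.adjoin ℝ (range (cubeCoord (ι := ι))) with hA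
  have hint : ∀ (R : ProbabilityMeasure (ι → unitInterval)) (f : C(ι → unitInterval, ℝ)),
      Integrable f (R : Measure (ι → unitInterval)) := fun R f =>
    BoundedContinuousFunction.integrable _ (BoundedContinuousFunction.mkOfCompact f)
  have hAlg : ∀ f ∈ A, Tendsto (fun N => ∫ v, f v ∂(P N : Measure _)) atTop
      (𝓝 (∫ v, f v ∂(P' : Measure _))) := by
    intro f hf
    rw [hA, ← Subalgebra.mem_toSubmodule, Algebra.adjoin_eq_span] at hf
    induction hf using Submodule.span_induction with
    | mem f hf =>
      have : ∃ L : List ι, ∀ v, f v = (L.map fun i => (v i : ℝ)).prod := by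
        induction hf using Submonoid.closure_induction with
        | mem f hf =>
          obtain ⟨i, rfl⟩ := hf
          exact ⟨[i], fun v => by simp [cubeCoord]⟩
        | one => exact ⟨[], fun v => by simp⟩
        | mul f g _ _ hf hg =>
          obtain ⟨L, hL⟩ := hf
          obtain ⟨M, hM⟩ := hg
          exact ⟨L ++ M, fun v => by simp [hL, hM]⟩
      obtain ⟨L, hL⟩ := this
      simp only [hL]
      exact h L
    | zero => simp
    | add f g _ _ hf hg =>
      simp only [ContinuousMap.add_apply]
      rw [integral_add (hint _ f) (hint _ g)]
      refine (hf.add hg).congr fun N => ?_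
      rw [integral_add (hint _ f) (hint _ g)]
    | smul c f _ hf =>
      simp only [ContinuousMap.smul_apply, integral_smul]
      exact hf.const_smul c
  rw [ProbabilityMeasure.tendsto_iff_forall_integral_tendsto]
  intro f
  rw [Metric.tendsto_atTop]
  intro ε hε
  obtain ⟨g, hg⟩ := ContinuousMap.exists_mem_subalgebra_near_continuousMap_of_separatesPoints A
    (separatesPoints_adjoin_cubeCoord ι) f.toContinuousMap (ε / 3) (by positivity)
  obtain ⟨n, hn⟩ := (Metric.tendsto_atTop.mp (hAlg g g.2)) (ε / 3) (by positivity)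
  have hclose : ∀ R : ProbabilityMeasure (ι → unitInterval),
      |∫ v, f v ∂(R : Measure _) - ∫ v, (g : C(ι → unitInterval, ℝ)) v ∂(R : Measure _)| ≤ ε / 3 := by
    intro R
    rw [← integral_sub (show Integrable f _ from hint R f.toContinuousMap) (hint R g)]
    have hle := norm_integral_le_of_norm_le_const (μ := (R : Measure (ι → unitInterval)))
      (f := fun v => f v - (g : C(ι → unitInterval, ℝ)) v) (C := ε / 3) (.of_forall fun v => ?_)
    · rwa [probReal_univ, mul_one] at hle
    have := ((g : C(ι → unitInterval, ℝ)) - f.toContinuousMap).norm_coe_le_norm v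
    rw [norm_sub_rev]
    exact this.trans hg.le
  refine ⟨n, fun N hN => ?_⟩
  have h1 := hn N hN
  have h2 := hclose (P N)
  have h3 := hclose P'
  rw [Real.dist_eq] at h1 ⊢
  rw [abs_le] at h2 h3
  rw [abs_lt] at h1 ⊢
  constructor <;> linarith

variable {S : Type*}

theorem prod_mark_eq (J : ℕ → ℝ≥0∞) (y : ℕ → S) (L : List (ℕ × S)) :
    (L.map fun p => (code J y p : ℝ)).prod = ((L.map (mark J y)).prod).toReal := by
  induction L with
  | nil => simp
  | cons p L ih => simp only [List.map_cons, List.prod_cons, ENNReal.toReal_mul, ih]; rfl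

theorem prod_mark_le_one (J : ℕ → ℝ≥0∞) (y : ℕ → S) (L : List (ℕ × S)) :
    (L.map (mark J y)).prod ≤ 1 := by
  induction L with
  | nil => simp
  | cons p L ih =>
    rw [List.map_cons, List.prod_cons]
    exact (mul_le_mul' (mark_le_one J y p) ih).trans (one_mul _).le

theorem measurable_code [Countable S] {Ω : Type*} [MeasurableSpace Ω] {J : Ω → ℕ → ℝ≥0∞}
    {y : Ω → ℕ → S} (h : ∀ p, Measurable fun ω => mark (J ω) (y ω) p) :
    Measurable fun ω => code (J ω) (y ω) :=
  measurable_pi_lambda _ fun p => Measurable.subtype_mk (h p).ennreal_toReal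

theorem integral_code [Countable S] {Ω : Type*} [MeasurableSpace Ω] {P : Measure Ω}
    {J : Ω → ℕ → ℝ≥0∞} {y : Ω → ℕ → S} (h : ∀ p, Measurable fun ω => mark (J ω) (y ω) p)
    (L : List (ℕ × S)) :
    ∫ v, (L.map fun p => (v p : ℝ)).prod ∂P.map (fun ω => code (J ω) (y ω)) =
      (∫⁻ ω, (L.map (mark (J ω) (y ω))).prod ∂P).toReal := by
  have hc : Continuous fun v : ℕ × S → unitInterval => (L.map fun p => (v p : ℝ)).prod :=
    continuous_list_prod _ fun p _ => by fun_prop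
  rw [integral_map (measurable_code h).aemeasurable hc.aestronglyMeasurable]
  simp only [prod_mark_eq]
  refine integral_toReal (Measurable.aemeasurable ?_)
    (.of_forall fun ω => (prod_mark_le_one _ _ _).trans_lt ENNReal.one_lt_top)
  induction L with
  | nil => simp
  | cons p L ih =>
    simp only [List.map_cons, List.prod_cons]
    exact (h p).mul (ih (continuous_list_prod _ fun p _ => by fun_prop))

/-- The codes converge in law by their moments. An open set of trajectories and the associated open
set of codes have the same probability along the sequence and in the limit, so the portmanteau
inequality for open sets is transferred without a continuous map from codes to trajectories. -/
theorem tendstoInDistribution_of_follows [Finite S] {Ω : ℕ → Type*} [∀ N, MeasurableSpace (Ω N)]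
    {P : ∀ N, Measure (Ω N)} [∀ N, IsProbabilityMeasure (P N)] {Ω' : Type*} [MeasurableSpace Ω']
    {P' : Measure Ω'} [IsProbabilityMeasure P']
    {X : ∀ N, Ω N → SkorohodSpace (Option S)} {X' : Ω' → SkorohodSpace (Option S)}
    {J : ∀ N, Ω N → ℕ → ℝ≥0∞} {y : ∀ N, Ω N → ℕ → S} {J' : Ω' → ℕ → ℝ≥0∞} {y' : Ω' → ℕ → S}
    (hm : ∀ N p, Measurable fun ω => mark (J N ω) (y N ω) p)
    (hm' : ∀ p, Measurable fun ω => mark (J' ω) (y' ω) p)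
    (h : ∀ N, ∀ᵐ ω ∂P N, Follows (X N ω) (J N ω) (y N ω))
    (h' : ∀ᵐ ω ∂P', Follows (X' ω) (J' ω) (y' ω))
    (hmom : ∀ L : List (ℕ × S), Tendsto (fun N => ∫⁻ ω, (L.map (mark (J N ω) (y N ω))).prod ∂P N)
      atTop (𝓝 (∫⁻ ω, (L.map (mark (J' ω) (y' ω))).prod ∂P'))) :
    TendstoInDistribution X atTop X' P P' := by
  have hX : ∀ N, AEMeasurable (X N) (P N) := fun N =>
    aemeasurable_of_follows (measurable_code (hm N)) (h N)
  have hX' : AEMeasurable X' P' := aemeasurable_of_follows (measurable_code hm') h'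
  refine ⟨hX, hX', ?_⟩
  set C : ℕ → ProbabilityMeasure (ℕ × S → unitInterval) := fun N =>
    ⟨(P N).map fun ω => code (J N ω) (y N ω),
      Measure.isProbabilityMeasure_map (measurable_code (hm N)).aemeasurable⟩ with hC
  set C' : ProbabilityMeasure (ℕ × S → unitInterval) :=
    ⟨P'.map fun ω => code (J' ω) (y' ω),
      Measure.isProbabilityMeasure_map (measurable_code hm').aemeasurable⟩ with hC'
  have hconv : Tendsto C atTop (𝓝 C') := by
    refine tendsto_of_tendsto_moments fun L => ?_
    have hfin : ∫⁻ ω, (L.map (mark (J' ω) (y' ω))).prod ∂P' ≠ ∞ := by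
      refine ne_top_of_le_ne_top ENNReal.one_ne_top ?_
      exact (lintegral_mono fun ω => prod_mark_le_one _ _ L).trans (by simp)
    have h1 := (ENNReal.tendsto_toReal hfin).comp (hmom L)
    simp only [hC, hC', ProbabilityMeasure.coe_mk, integral_code (hm _), integral_code hm']
    exact h1
  refine tendsto_of_forall_isOpen_le_liminf' fun G hG => ?_
  obtain ⟨O, hO, hiff⟩ := exists_isOpen_mem_iff hG
  have h1 := ProbabilityMeasure.le_liminf_measure_open_of_tendsto hconv hO
  have h2 : (P'.map X') G = (C' : Measure _) O := by
    rw [Measure.map_apply_of_aemeasurable hX' hG.measurableSet]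
    simp only [hC', ProbabilityMeasure.coe_mk]
    rw [Measure.map_apply (measurable_code hm') hO.measurableSet]
    refine measure_congr ?_
    filter_upwards [h'] with ω hω
    exact propext (hiff _ _ _ hω)
  have h3 : ∀ N, ((P N).map (X N)) G = (C N : Measure _) O := by
    intro N
    rw [Measure.map_apply_of_aemeasurable (hX N) hG.measurableSet]
    simp only [hC, ProbabilityMeasure.coe_mk]
    rw [Measure.map_apply (measurable_code (hm N)) hO.measurableSet]
    refine measure_congr ?_
    filter_upwards [h N] with ω hω
    exact propext (hiff _ _ _ hω)
  simp only [ProbabilityMeasure.coe_mk, h2, h3]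
  exact h1

end Moments

/-! ### Renewal sequences -/

section Renewal

variable {Ω S : Type*}

/-- The sum of the first `n` durations, for the transformation `Θ`. -/
def renewalTime (T : Ω → ℝ≥0∞) (Θ : Ω → Ω) (ω : Ω) (n : ℕ) : ℝ≥0∞ :=
  ∑ j ∈ Finset.range n, T (Θ^[j] ω)

theorem renewalTime_succ (T : Ω → ℝ≥0∞) (Θ : Ω → Ω) (ω : Ω) (n : ℕ) :
    renewalTime T Θ ω (n + 1) = renewalTime T Θ ω n + T (Θ^[n] ω) := Finset.sum_range_succ _ _

theorem renewalTime_succ' (T : Ω → ℝ≥0∞) (Θ : Ω → Ω) (ω : Ω) (n : ℕ) :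
    renewalTime T Θ ω (n + 1) = T ω + renewalTime T Θ (Θ ω) n := by
  rw [renewalTime, Finset.sum_range_succ', add_comm]
  rfl

/-- The products of coordinates of the renewal sequence with labels `ℓ`. -/
def moment (T : Ω → ℝ≥0∞) (Θ : Ω → Ω) (ℓ : Ω → S) (L : List (ℕ × S)) (ω : Ω) : ℝ≥0∞ :=
  (L.map (mark (renewalTime T Θ ω) fun n => ℓ (Θ^[n] ω))).prod

/-- The coordinates after the first renewal. -/
def tailList (L : List (ℕ × S)) : List (ℕ × S) :=
  L.filterMap fun p => if p.1 = 0 then none else some (p.1 - 1, p.2)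

open Classical in
/-- The contribution of the first label. -/
def startFactor (L : List (ℕ × S)) (x : S) : ℝ≥0∞ :=
  (L.map fun p => if p.1 = 0 ∧ x ≠ p.2 then 0 else 1).prod

theorem startFactor_le_one (L : List (ℕ × S)) (x : S) : startFactor L x ≤ 1 := by
  unfold startFactor
  induction L with
  | nil => simp
  | cons p L ih =>
    rw [List.map_cons, List.prod_cons]
    refine (mul_le_mul' ?_ ih).trans (one_mul _).le
    split_ifs <;> simp

/-- Entries of index zero only test the first label, since the zeroth time is zero. Every other
entry contributes one factor `exp (-T)` for the first duration and then refers to the sequence after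
the first renewal, so the number of these entries is the exponent of the Laplace transform. -/
theorem moment_eq (T : Ω → ℝ≥0∞) (Θ : Ω → Ω) (ℓ : Ω → S) (L : List (ℕ × S)) (ω : Ω) :
    moment T Θ ℓ L ω = startFactor L (ℓ ω) *
      (en ((tailList L).length * T ω) * moment T Θ ℓ (tailList L) (Θ ω)) := by
  induction L with
  | nil => simp [moment, tailList, startFactor]
  | cons p L ih =>
    obtain ⟨n, y⟩ := p
    have h1 : moment T Θ ℓ ((n, y) :: L) ω =
        mark (renewalTime T Θ ω) (fun n => ℓ (Θ^[n] ω)) (n, y) * moment T Θ ℓ L ω := by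
      simp [moment]
    rw [h1, ih]
    cases n with
    | zero =>
      have h2 : tailList ((0, y) :: L) = tailList L := by simp [tailList]
      have h3 : startFactor ((0, y) :: L) (ℓ ω) =
          mark (renewalTime T Θ ω) (fun n => ℓ (Θ^[n] ω)) (0, y) * startFactor L (ℓ ω) := by
        by_cases h : ℓ ω = y <;> simp [startFactor, mark, renewalTime, h]
      rw [h2, h3, mul_assoc]
    | succ n =>
      have h2 : tailList ((n + 1, y) :: L) = (n, y) :: tailList L := by simp [tailList]
      have h3 : startFactor ((n + 1, y) :: L) (ℓ ω) = startFactor L (ℓ ω) := by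
        simp [startFactor]
      have h4 : mark (renewalTime T Θ ω) (fun n => ℓ (Θ^[n] ω)) (n + 1, y) =
          en (T ω) * mark (renewalTime T Θ (Θ ω)) (fun m => ℓ (Θ^[m] (Θ ω))) (n, y) := by
        by_cases h : ℓ (Θ^[n] (Θ ω)) = y
        · have h' : ℓ (Θ^[n + 1] ω) = y := h
          rw [mark, mark, if_pos h', if_pos h, renewalTime_succ', en_add]
        · have h' : ¬ ℓ (Θ^[n + 1] ω) = y := h
          rw [mark, mark, if_neg h', if_neg h, mul_zero]
      have h5 : moment T Θ ℓ ((n, y) :: tailList L) (Θ ω) =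
          mark (renewalTime T Θ (Θ ω)) (fun m => ℓ (Θ^[m] (Θ ω))) (n, y) *
            moment T Θ ℓ (tailList L) (Θ ω) := by simp [moment]
      rw [h2, h3, h4, h5, List.length_cons, Nat.cast_succ, add_mul, one_mul, en_add]
      ring

theorem moment_eq_startFactor (T : Ω → ℝ≥0∞) (Θ : Ω → Ω) (ℓ : Ω → S) {L : List (ℕ × S)}
    (hL : tailList L = []) (ω : Ω) : moment T Θ ℓ L ω = startFactor L (ℓ ω) := by
  rw [moment_eq, hL]; simp [moment]

theorem moment_le_one (T : Ω → ℝ≥0∞) (Θ : Ω → Ω) (ℓ : Ω → S) (L : List (ℕ × S)) (ω : Ω) :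
    moment T Θ ℓ L ω ≤ 1 := prod_mark_le_one _ _ _

theorem lt_of_mem_tailList {L : List (ℕ × S)} {n : ℕ} (h : ∀ p ∈ L, p.1 < n + 1) :
    ∀ p ∈ tailList L, p.1 < n := by
  intro p hp
  obtain ⟨q, hq, hqp⟩ := List.mem_filterMap.mp hp
  have := h q hq
  split_ifs at hqp with h0
  obtain rfl := Option.some_injective _ hqp
  change q.1 - 1 < n
  omega

variable [MeasurableSpace Ω] [MeasurableSpace S] [DiscreteMeasurableSpace S]

theorem measurable_mark_renewalTime {T : Ω → ℝ≥0∞} {Θ : Ω → Ω} {ℓ : Ω → S} (hT : Measurable T)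
    (hΘ : Measurable Θ) (hℓ : Measurable ℓ) (p : ℕ × S) :
    Measurable fun ω => mark (renewalTime T Θ ω) (fun n => ℓ (Θ^[n] ω)) p := by
  refine Measurable.ite ?_ ?_ measurable_const
  · exact (hℓ.comp (hΘ.iterate p.1)) (.of_discrete (s := {p.2}))
  · exact measurable_en.comp (Finset.measurable_sum _ fun j _ => hT.comp (hΘ.iterate j))

theorem measurable_moment {T : Ω → ℝ≥0∞} {Θ : Ω → Ω} {ℓ : Ω → S} (hT : Measurable T)
    (hΘ : Measurable Θ) (hℓ : Measurable ℓ) (L : List (ℕ × S)) :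
    Measurable (moment T Θ ℓ L) := by
  unfold moment
  induction L with
  | nil => simp
  | cons p L ih =>
    simp only [List.map_cons, List.prod_cons]
    exact (measurable_mark_renewalTime hT hΘ hℓ p).mul ih

end Renewal

/-! ### Changes of well -/

section Change

variable {E : Type*} [MeasurableSpace E] [DiscreteMeasurableSpace E] [Countable E]
  {Q : RateMatrix E} {S : Type*}

theorem label_eq {W : S → Set E} (hW : Pairwise fun x y => Disjoint (W x) (W y)) {x : S} {η : E}
    (hη : η ∈ W x) : label W η = some x := by
  have h : ∃ x, η ∈ W x := ⟨x, hη⟩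
  rw [label, dif_pos h]
  congr 1
  by_contra hcon
  exact Set.disjoint_left.mp (hW hcon) h.choose_spec hη

open Classical in
/-- The label of the well that contains `η`, with an arbitrary value outside the wells. -/
def wellOf [Nonempty S] (W : S → Set E) (η : E) : S := (label W η).getD (Classical.arbitrary S)

theorem wellOf_eq [Nonempty S] {W : S → Set E} (hW : Pairwise fun x y => Disjoint (W x) (W y))
    {x : S} {η : E} (hη : η ∈ W x) : wellOf W η = x := by
  rw [wellOf, label_eq hW hη]; rfl

variable [Nonempty S]

/-- The first index at which the jump chain is in a well different from the initial one. -/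
def changeIndex (W : S → Set E) (ω : (ℕ → E) × (ℕ → ℝ)) : ℕ :=
  sInf {n | ω.1 n ∈ otherWells W (wellOf W (ω.1 0))}

/-- The trajectory after the first change of well. -/
def afterChange (W : S → Set E) (ω : (ℕ → E) × (ℕ → ℝ)) : (ℕ → E) × (ℕ → ℝ) :=
  shift^[changeIndex W ω] ω

variable (Q) in
/-- The time spent in the wells before step `n` of the jump chain. -/
def RateMatrix.wellTime (W : S → Set E) (n : ℕ) (ω : (ℕ → E) × (ℕ → ℝ)) : ℝ≥0∞ :=
  ∑ i ∈ Finset.range n, (wells W).indicator 1 (ω.1 i) * Q.holding ω i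

variable (Q) in
/-- The time spent in the wells before the first change of well. -/
def RateMatrix.sojourn (W : S → Set E) (ω : (ℕ → E) × (ℕ → ℝ)) : ℝ≥0∞ :=
  Q.wellTime W (changeIndex W ω) ω

theorem measurable_changeIndex (W : S → Set E) : Measurable (changeIndex W) := by
  have hp : ∀ n, MeasurableSet {ω : (ℕ → E) × (ℕ → ℝ) | ω.1 n ∈ otherWells W (wellOf W (ω.1 0))} := by
    intro n
    exact ((measurable_coord n).prodMk (measurable_coord 0))
      (.of_discrete (s := {q : E × E | q.1 ∈ otherWells W (wellOf W q.2)}))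
  refine measurable_to_countable' fun n => ?_
  -- The last set accounts for trajectories without any change of well, for which the infimum of the
  -- empty set is zero.
  have heq : changeIndex W ⁻¹' {n} =
      ({ω | ω.1 n ∈ otherWells W (wellOf W (ω.1 0))} ∩
        ⋂ i, ⋂ (_ : i < n), {ω | ω.1 i ∈ otherWells W (wellOf W (ω.1 0))}ᶜ) ∪
      ((⋂ i, {ω | ω.1 i ∈ otherWells W (wellOf W (ω.1 0))}ᶜ) ∩ {_ω | n = 0}) := by
    ext ω
    simp only [mem_preimage, mem_singleton_iff, mem_union, mem_inter_iff, mem_iInter,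
      mem_compl_iff, mem_ofPred_eq]
    constructor
    · intro h
      by_cases hex : ∃ n, ω.1 n ∈ otherWells W (wellOf W (ω.1 0))
      · have h1 : changeIndex W ω ∈ {n | ω.1 n ∈ otherWells W (wellOf W (ω.1 0))} := Nat.sInf_mem hex
        rw [h] at h1
        exact Or.inl ⟨h1, fun i hi => Nat.notMem_of_lt_sInf (s := {n | ω.1 n ∈ otherWells W (wellOf W (ω.1 0))}) (by rw [← h] at hi; exact hi)⟩
      · push Not at hex
        refine Or.inr ⟨hex, ?_⟩
        rw [← h, changeIndex, Nat.sInf_eq_zero]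
        right
        ext i
        simp [hex i]
    · rintro (⟨h1, h2⟩ | ⟨h1, rfl⟩)
      · refine le_antisymm (Nat.sInf_le h1) ?_
        by_contra hcon
        push Not at hcon
        exact h2 _ hcon (Nat.sInf_mem (s := {n | ω.1 n ∈ otherWells W (wellOf W (ω.1 0))}) ⟨n, h1⟩)
      · rw [changeIndex, Nat.sInf_eq_zero]
        right
        ext i
        simp [h1 i]
  rw [heq]
  exact ((hp n).inter (.iInter fun i => .iInter fun _ => (hp i).compl)).union
    ((MeasurableSet.iInter fun i => (hp i).compl).inter (.const _))

theorem measurable_comp_changeIndex (W : S → Set E) {β : Type*} [MeasurableSpace β]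
    {F : ℕ → (ℕ → E) × (ℕ → ℝ) → β} (hF : ∀ n, Measurable (F n)) :
    Measurable fun ω => F (changeIndex W ω) ω :=
  (measurable_from_prod_countable_right (f := fun p : ℕ × ((ℕ → E) × (ℕ → ℝ)) => F p.1 p.2) hF).comp
    ((measurable_changeIndex W).prodMk measurable_id)

theorem measurable_afterChange (W : S → Set E) : Measurable (afterChange W) :=
  measurable_comp_changeIndex W fun n => measurable_shift.iterate n

theorem measurable_wellTime (W : S → Set E) (n : ℕ) : Measurable (Q.wellTime W n) :=
  Finset.measurable_sum _ fun i _ => (measurable_comp_coord _ i).mul (measurable_holding i)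

theorem measurable_sojourn (W : S → Set E) : Measurable (Q.sojourn W) :=
  measurable_comp_changeIndex W fun n => measurable_wellTime W n

theorem measurable_wellOf [MeasurableSpace S] (W : S → Set E) :
    Measurable fun ω : (ℕ → E) × (ℕ → ℝ) => wellOf W (ω.1 0) :=
  (Measurable.of_discrete (f := wellOf W)).comp (measurable_coord 0)

theorem changeIndex_spec {W : S → Set E} {ω : (ℕ → E) × (ℕ → ℝ)}
    (h : ∃ n, ω.1 n ∈ otherWells W (wellOf W (ω.1 0))) :
    ω.1 (changeIndex W ω) ∈ otherWells W (wellOf W (ω.1 0)) :=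
  Nat.sInf_mem (s := {n | ω.1 n ∈ otherWells W (wellOf W (ω.1 0))}) h

theorem notMem_of_lt_changeIndex {W : S → Set E} {ω : (ℕ → E) × (ℕ → ℝ)} {i : ℕ}
    (h : i < changeIndex W ω) : ω.1 i ∉ otherWells W (wellOf W (ω.1 0)) :=
  Nat.notMem_of_lt_sInf (s := {n | ω.1 n ∈ otherWells W (wellOf W (ω.1 0))}) h

/-- The strong Markov property at the first change of well. -/
theorem mean_afterChange [Fintype S] [DecidableEq S] (hirr : Q.IsIrreducible)
    (hrec : Q.IsRecurrent) {W : S → Set E} (hW : Pairwise fun x y => Disjoint (W x) (W y)) {x : S}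
    {α : ℝ≥0} (hα : 0 < α) {b : E} (hb : b ∈ otherWells W x)
    {Ψ : (ℕ → E) × (ℕ → ℝ) → ℝ≥0∞} (hΨ : Measurable Ψ) {η : E} (hη : η ∈ W x) :
    Q.mean (fun ω => en (α * Q.sojourn W ω) * Ψ (afterChange W ω)) η =
      ∑ y ∈ Finset.univ.erase x,
        Q.pot (Q.escWeight W x α) ((W y).indicator (Q.mean Ψ)) η := by
  set D := otherWells W x with hD
  -- The weight is one outside the wells, the discount of the holding time in the well of `x`, and
  -- zero in the other wells. In the sum over steps only the first change of well survives: earlier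
  -- terms lack the indicator of `D`, later ones contain the zero weight.
  set w : E → ℝ → ℝ≥0∞ := fun ζ t => (outside W).indicator 1 ζ +
    (W x).indicator 1 ζ * en (α * (ENNReal.ofReal t / ENNReal.ofReal (Q.hold ζ))) with hw
  have hmt : ∀ ζ, Measurable fun t : ℝ => en (α * (ENNReal.ofReal t / ENNReal.ofReal (Q.hold ζ))) :=
    fun ζ => measurable_en.comp ((ENNReal.measurable_ofReal.div_const _).const_mul _)
  have hwm : ∀ ζ, Measurable (w ζ) := fun ζ => ((hmt ζ).const_mul _).const_add _
  have hwi : (fun ζ => ∫⁻ t, w ζ t ∂expMeasure 1) = Q.escWeight W x α := by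
    funext ζ
    simp only [hw]
    rw [lintegral_add_left measurable_const, lintegral_const_mul _ (hmt ζ),
      lintegral_expMeasure_en (Q.hold_nonneg ζ) hα, lintegral_const, measure_univ, mul_one,
      RateMatrix.escWeight]
    congr 1
    by_cases hζ : ζ ∈ W x
    · rw [indicator_of_mem hζ, indicator_of_mem hζ, Pi.one_apply, one_mul]; rfl
    · rw [indicator_of_notMem hζ, indicator_of_notMem hζ, zero_mul]
  set Φ : (ℕ → E) × (ℕ → ℝ) → ℝ≥0∞ := fun ω => D.indicator 1 (ω.1 0) * Ψ ω with hΦ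
  have hΦm : Measurable Φ := (measurable_comp_coord _ 0).mul hΨ
  have hΦe : Q.mean Φ = ∑ y ∈ Finset.univ.erase x, (W y).indicator (Q.mean Ψ) := by
    funext ζ
    have h1 : Q.mean Φ ζ = D.indicator 1 ζ * Q.mean Ψ ζ := by
      rw [RateMatrix.mean, RateMatrix.mean, ← lintegral_const_mul _ hΨ]
      refine lintegral_congr_ae ?_
      filter_upwards [ae_start Q ζ] with ω hω
      simp only [hΦ, hω]
    rw [h1, hD, indicator_otherWells hW, Finset.sum_apply, Finset.sum_apply, Finset.sum_mul]
    refine Finset.sum_congr rfl fun y _ => ?_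
    by_cases h : ζ ∈ W y
    · rw [indicator_of_mem h, indicator_of_mem h, Pi.one_apply, one_mul]
    · rw [indicator_of_notMem h, indicator_of_notMem h, zero_mul]
  rw [← Finset.sum_apply, ← pot_finset_sum, ← hΦe, ← hwi, ← mean_pot hwm hΦm]
  refine lintegral_congr_ae ?_
  filter_upwards [ae_start Q η, ae_frequently_visits hirr hrec η b] with ω h0 hvis
  have hwell : wellOf W (ω.1 0) = x := by rw [h0]; exact wellOf_eq hW hη
  have hex : ∃ n, ω.1 n ∈ otherWells W (wellOf W (ω.1 0)) := by
    obtain ⟨k, _, hk⟩ := hvis 0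
    exact ⟨k, by rw [hk, hwell]; exact hb⟩
  have hk := changeIndex_spec hex
  have hlt : ∀ i < changeIndex W ω, ω.1 i ∉ D := fun i hi => by
    have := notMem_of_lt_changeIndex hi
    rwa [hwell] at this
  rw [hwell] at hk
  rw [tsum_eq_single (changeIndex W ω)]
  · simp only [hΦ, shift_iterate_fst, add_zero]
    rw [indicator_of_mem hk, Pi.one_apply, one_mul]
    change _ * Ψ (shift^[changeIndex W ω] ω) = _
    congr 1
    rw [RateMatrix.sojourn, RateMatrix.wellTime, Finset.mul_sum, en_sum]
    refine Finset.prod_congr rfl fun i hi => ?_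
    have hi := hlt i (Finset.mem_range.mp hi)
    simp only [hw]
    rcases mem_cases W x (ω.1 i) with h | h | h
    · rw [indicator_of_notMem h.2.2, indicator_of_mem h.1,
        indicator_of_mem (show ω.1 i ∈ wells W from mem_iUnion.mpr ⟨x, h.1⟩)]
      simp only [Pi.one_apply, one_mul, zero_add]
      rfl
    · exact absurd h.2.1 hi
    · rw [indicator_of_mem h.2.2, indicator_of_notMem h.1, indicator_of_notMem h.2.2]
      simp
  · intro n hn
    rcases lt_or_gt_of_ne hn with h | h
    · simp only [hΦ, shift_iterate_fst, add_zero]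
      rw [indicator_of_notMem (hlt n h)]; simp
    · rw [Finset.prod_eq_zero (Finset.mem_range.mpr h), zero_mul]
      simp only [hw]
      rw [indicator_of_notMem hk.2, indicator_of_notMem (show _ ∉ outside W from fun h' => h' hk.1)]
      simp

end Change

/-! ### The projected trace as a renewal sequence -/

section Projected

variable {E : Type*} [MeasurableSpace E] [DiscreteMeasurableSpace E] [Countable E]
  {Q : RateMatrix E}

variable (Q) in
/-- The mean discount of one step at unit rate of the time spent in `A`. -/
def RateMatrix.discount (A : Set E) (η : E) : ℝ≥0∞ :=
  Aᶜ.indicator 1 η + A.indicator (fun η => Q.lam η / (Q.lam η + 1)) η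

/-- The mean of `exp` of minus the time spent in `A` during `n` steps is the weighted mass in the
hypothesis. In the limit `exp` of minus the total time has mean zero, so that time is infinite. -/
theorem ae_iSup_eq_top (A : Set E) {η : E}
    (hlim : Tendsto (fun n => (Q.wavg (Q.discount A))^[n] 1 η) atTop (𝓝 0)) :
    ∀ᵐ ω ∂Q.law η, ⨆ n, ∑ i ∈ Finset.range n, A.indicator 1 (ω.1 i) * Q.holding ω i = ∞ := by
  set w : E → ℝ → ℝ≥0∞ := fun ζ t => Aᶜ.indicator 1 ζ +
    A.indicator 1 ζ * en ((1 : ℝ≥0) * (ENNReal.ofReal t / ENNReal.ofReal (Q.hold ζ))) with hw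
  have hmt : ∀ ζ, Measurable fun t : ℝ =>
      en ((1 : ℝ≥0) * (ENNReal.ofReal t / ENNReal.ofReal (Q.hold ζ))) :=
    fun ζ => measurable_en.comp ((ENNReal.measurable_ofReal.div_const _).const_mul _)
  have hwm : ∀ ζ, Measurable (w ζ) := fun ζ => ((hmt ζ).const_mul _).const_add _
  have hwi : (fun ζ => ∫⁻ t, w ζ t ∂expMeasure 1) = Q.discount A := by
    funext ζ
    simp only [hw]
    rw [lintegral_add_left measurable_const, lintegral_const_mul _ (hmt ζ),
      lintegral_expMeasure_en (Q.hold_nonneg ζ) one_pos, lintegral_const, measure_univ, mul_one,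
      RateMatrix.discount]
    congr 1
    by_cases hζ : ζ ∈ A
    · rw [indicator_of_mem hζ, indicator_of_mem hζ, Pi.one_apply, one_mul]; rfl
    · rw [indicator_of_notMem hζ, indicator_of_notMem hζ, zero_mul]
  set C : ℕ → (ℕ → E) × (ℕ → ℝ) → ℝ≥0∞ := fun n ω =>
    ∑ i ∈ Finset.range n, A.indicator 1 (ω.1 i) * Q.holding ω i with hC
  have hCm : ∀ n, Measurable (C n) := fun n =>
    Finset.measurable_sum _ fun i _ => (measurable_comp_coord _ i).mul (measurable_holding i)
  have hmean : ∀ n, ∫⁻ ω, en (C n ω) ∂Q.law η = (Q.wavg (Q.discount A))^[n] 1 η := by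
    intro n
    have h1 := congrFun (mean_prod_mul_shift Q hwm (Ψ := fun _ => 1) measurable_const n) η
    have h2 : Q.mean (fun _ => 1) = 1 := by funext ζ; simp [RateMatrix.mean]
    rw [hwi, h2] at h1
    rw [← h1]
    refine lintegral_congr fun ω => ?_
    rw [mul_one, hC, en_sum]
    refine Finset.prod_congr rfl fun i _ => ?_
    simp only [hw]
    by_cases h : ω.1 i ∈ A
    · rw [indicator_of_mem h, indicator_of_notMem (show ω.1 i ∉ Aᶜ from fun h' => h' h)]
      simp only [Pi.one_apply, one_mul, zero_add, ENNReal.coe_one]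
      rfl
    · rw [indicator_of_notMem h, indicator_of_mem (show ω.1 i ∈ Aᶜ from h)]; simp
  have hzero : ∫⁻ ω, en (⨆ n, C n ω) ∂Q.law η = 0 := by
    refine le_antisymm (ge_of_tendsto' hlim fun n => ?_) zero_le
    rw [← hmean n]
    exact lintegral_mono fun ω => en_antitone (le_iSup (fun n => C n ω) n)
  have hm : Measurable fun ω => en (⨆ n, C n ω) := measurable_en.comp (Measurable.iSup hCm)
  rw [lintegral_eq_zero_iff hm] at hzero
  filter_upwards [hzero] with ω hω
  refine en_strictAnti.injective ?_
  rw [en_top]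
  exact hω

variable {S : Type*} [Nonempty S]

/-- The index of the `n`-th change of well. -/
def changeCount (W : S → Set E) (ω : (ℕ → E) × (ℕ → ℝ)) (n : ℕ) : ℕ :=
  ∑ j ∈ Finset.range n, changeIndex W ((afterChange W)^[j] ω)

theorem changeCount_succ (W : S → Set E) (ω : (ℕ → E) × (ℕ → ℝ)) (n : ℕ) :
    changeCount W ω (n + 1) = changeCount W ω n + changeIndex W ((afterChange W)^[n] ω) :=
  Finset.sum_range_succ _ _

theorem afterChange_iterate (W : S → Set E) (ω : (ℕ → E) × (ℕ → ℝ)) (n : ℕ) :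
    (afterChange W)^[n] ω = shift^[changeCount W ω n] ω := by
  induction n with
  | zero => rfl
  | succ n ih =>
    rw [Function.iterate_succ_apply', afterChange, changeCount_succ, Nat.add_comm,
      Function.iterate_add_apply, ← ih]

theorem holding_shift_iterate (ω : (ℕ → E) × (ℕ → ℝ)) (m i : ℕ) :
    Q.holding (shift^[m] ω) i = Q.holding ω (m + i) := by
  simp only [RateMatrix.holding, shift_iterate_fst, shift_iterate_snd]

theorem wellTime_add (W : S → Set E) (ω : (ℕ → E) × (ℕ → ℝ)) (m n : ℕ) :
    Q.wellTime W (m + n) ω = Q.wellTime W m ω + Q.wellTime W n (shift^[m] ω) := by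
  simp only [RateMatrix.wellTime, Finset.sum_range_add, shift_iterate_fst, holding_shift_iterate]

theorem renewalTime_sojourn (W : S → Set E) (ω : (ℕ → E) × (ℕ → ℝ)) (n : ℕ) :
    renewalTime (Q.sojourn W) (afterChange W) ω n = Q.wellTime W (changeCount W ω n) ω := by
  induction n with
  | zero => simp [renewalTime, RateMatrix.wellTime, changeCount]
  | succ n ih =>
    rw [renewalTime_succ, ih, changeCount_succ, wellTime_add, ← afterChange_iterate]
    rfl

theorem clock_eq_wellTime (hpos : ∀ η, 0 < Q.hold η) (W : S → Set E) (ω : (ℕ → E) × (ℕ → ℝ))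
    (n : ℕ) : JumpPath.clock (Q.jumpTime ω) ω.1 (wells W) n = Q.wellTime W n ω :=
  Finset.sum_congr rfl fun i _ => by rw [jumpTime_succ_sub hpos]

/-- The trajectory starts in a well, visits the complement of each well among the wells infinitely
often, and spends an infinite time in the wells. -/
structure ChangesOften (Q : RateMatrix E) (W : S → Set E) (ω : (ℕ → E) × (ℕ → ℝ)) : Prop where
  regular : Q.Regular ω
  start : ω.1 0 ∈ wells W
  visits : ∀ x n, ∃ k ≥ n, ω.1 k ∈ otherWells W x
  top : ⨆ n, Q.wellTime W n ω = ∞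

theorem ChangesOften.exists_mem {W : S → Set E} {ω : (ℕ → E) × (ℕ → ℝ)}
    (h : ChangesOften Q W ω) (n : ℕ) :
    ∃ k, ((afterChange W)^[n] ω).1 k ∈ otherWells W (wellOf W (((afterChange W)^[n] ω).1 0)) := by
  rw [afterChange_iterate]
  obtain ⟨k, hk, hmem⟩ := h.visits (wellOf W ((shift^[changeCount W ω n] ω).1 0)) (changeCount W ω n)
  refine ⟨k - changeCount W ω n, ?_⟩
  rw [shift_iterate_fst _ (k - changeCount W ω n), Nat.add_sub_cancel' hk]
  exact hmem

theorem ChangesOften.mem_wells {W : S → Set E} {ω : (ℕ → E) × (ℕ → ℝ)}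
    (h : ChangesOften Q W ω) (n : ℕ) : ((afterChange W)^[n] ω).1 0 ∈ wells W := by
  cases n with
  | zero => exact h.start
  | succ n =>
    rw [Function.iterate_succ_apply', afterChange, shift_iterate_fst, Nat.add_zero]
    exact (changeIndex_spec (h.exists_mem n)).1

theorem ChangesOften.mem_wellOf {W : S → Set E} (hW : Pairwise fun x y => Disjoint (W x) (W y))
    {ω : (ℕ → E) × (ℕ → ℝ)} (h : ChangesOften Q W ω) (n : ℕ) :
    ((afterChange W)^[n] ω).1 0 ∈ W (wellOf W (((afterChange W)^[n] ω).1 0)) := by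
  obtain ⟨x, hx⟩ := mem_iUnion.mp (h.mem_wells n)
  rwa [wellOf_eq hW hx]

theorem ChangesOften.changeIndex_pos {W : S → Set E}
    (hW : Pairwise fun x y => Disjoint (W x) (W y)) {ω : (ℕ → E) × (ℕ → ℝ)}
    (h : ChangesOften Q W ω) (n : ℕ) : 0 < changeIndex W ((afterChange W)^[n] ω) := by
  by_contra hcon
  have h0 : changeIndex W ((afterChange W)^[n] ω) = 0 := by omega
  have h1 := changeIndex_spec (h.exists_mem n)
  rw [h0] at h1
  exact h1.2 (h.mem_wellOf hW n)

/-- Between two changes the chain is either in the current well or outside the wells, and the clock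
of the wells stands still outside. The projected trace is thus constant there, and it jumps when the
clock has accumulated the sojourns. -/
theorem ChangesOften.strictJumpPath {W : S → Set E}
    (hW : Pairwise fun x y => Disjoint (W x) (W y)) (hpos : ∀ η, 0 < Q.hold η)
    {ω : (ℕ → E) × (ℕ → ℝ)} (h : ChangesOften Q W ω) {θ : ℝ≥0} (hθ : 0 < θ) :
    StrictJumpPath (fun t => projTrace W (Q.path ω) (t * θ))
      (renewalTime (fun ω => Q.sojourn W ω / θ) (afterChange W) ω)
      (fun n => some (wellOf W (((afterChange W)^[n] ω).1 0))) := by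
  have hθ0 : (θ : ℝ≥0∞) ≠ 0 := by exact_mod_cast hθ.ne'
  have hclock := clock_eq_wellTime (Q := Q) hpos W ω
  have htrace := (path_jumpPath Q h.regular.2).tracePath_jumpPath (jumpTime_lt hpos h.regular)
    (wells W) (by simp only [hclock]; exact h.top)
  have hcle : ∀ n, n ≤ changeCount W ω n := by
    intro n
    induction n with
    | zero => exact Nat.zero_le _
    | succ n ih =>
      rw [changeCount_succ]
      have := h.changeIndex_pos hW n
      omega
  have hwm : Monotone fun n => Q.wellTime W n ω := by
    intro m n hmn
    simpa only [hclock] using htrace.mono hmn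
  have hren : ∀ n, renewalTime (fun ω => Q.sojourn W ω / θ) (afterChange W) ω n =
      Q.wellTime W (changeCount W ω n) ω / θ := by
    intro n
    rw [← renewalTime_sojourn]
    simp only [renewalTime, div_eq_mul_inv, Finset.sum_mul]
  have hbase : StrictJumpPath (fun t => projTrace W (Q.path ω) t)
      (fun n => Q.wellTime W (changeCount W ω n) ω)
      (fun n => some (wellOf W (((afterChange W)^[n] ω).1 0))) := by
    refine ⟨⟨?_, ?_, ?_, ?_⟩, ?_⟩
    · simp [changeCount, RateMatrix.wellTime]
    · refine monotone_nat_of_le_succ fun n => hwm ?_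
      rw [changeCount_succ]; omega
    · refine le_antisymm le_top ?_
      rw [← h.top]
      exact iSup_mono fun n => hwm (hcle n)
    · intro n t h1 h2
      obtain ⟨m, h3, h4⟩ := htrace.exists_index t
      rw [hclock] at h3 h4
      have hm1 : changeCount W ω n ≤ m := by
        by_contra hcon
        push Not at hcon
        exact absurd (h4.trans_le (hwm (show m + 1 ≤ changeCount W ω n by omega)))
          (not_lt.mpr h1)
      have hm2 : m < changeCount W ω (n + 1) := by
        by_contra hcon
        push Not at hcon
        exact absurd (h2.trans_le (hwm hcon)) (not_lt.mpr h3)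
      have hY : ω.1 m ∈ wells W := by
        by_contra hcon
        have : Q.wellTime W (m + 1) ω = Q.wellTime W m ω := by
          rw [RateMatrix.wellTime, Finset.sum_range_succ, indicator_of_notMem hcon, zero_mul,
            add_zero]
          rfl
        rw [this] at h4
        exact absurd h4 (not_lt.mpr h3)
      have hnot : ω.1 m ∉ otherWells W (wellOf W (((afterChange W)^[n] ω).1 0)) := by
        have h5 : m - changeCount W ω n < changeIndex W ((afterChange W)^[n] ω) := by
          rw [changeCount_succ] at hm2; omega
        have h6 := notMem_of_lt_changeIndex h5
        have h7 : ((afterChange W)^[n] ω).1 (m - changeCount W ω n) = ω.1 m := by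
          rw [afterChange_iterate, shift_iterate_fst, Nat.add_sub_cancel' hm1]
        rwa [h7] at h6
      have hmem : ω.1 m ∈ W (wellOf W (((afterChange W)^[n] ω).1 0)) := by
        by_contra hcon
        exact hnot ⟨hY, hcon⟩
      change (tracePath (Q.path ω) (wells W) t).bind (label W) = _
      rw [htrace.eq m t (by rw [hclock]; exact h3) (by rw [hclock]; exact h4), Option.bind_some,
        label_eq hW hmem]
    -- At a change the chain is in a well, and its positive holding time there advances the clock
    -- before the next change.
    · intro n hfin
      refine lt_of_lt_of_le (ENNReal.lt_add_right hfin
        (holding_pos (Q := Q) ω (h.regular.1 (changeCount W ω n))).ne') ?_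
      have h5 : changeCount W ω n + 1 ≤ changeCount W ω (n + 1) := by
        have := h.changeIndex_pos hW n
        rw [changeCount_succ]; omega
      refine le_trans (le_of_eq ?_) (hwm h5)
      have h6 := h.mem_wells n
      rw [afterChange_iterate, shift_iterate_fst, Nat.add_zero] at h6
      change _ = Q.wellTime W (changeCount W ω n + 1) ω
      rw [RateMatrix.wellTime, RateMatrix.wellTime, Finset.sum_range_succ, indicator_of_mem h6,
        Pi.one_apply, one_mul]
  have hs := hbase.toJumpPath.scale hθ
  rw [show renewalTime (fun ω => Q.sojourn W ω / θ) (afterChange W) ω = fun n =>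
      Q.wellTime W (changeCount W ω n) ω / θ from funext hren]
  refine ⟨hs, fun n hfin => ?_⟩
  refine ENNReal.div_lt_div_right hθ0 ENNReal.coe_ne_top (hbase.lt n ?_)
  intro hcon
  exact hfin (by rw [hcon]; exact ENNReal.top_div_coe)

theorem discount_le_one (A : Set E) : Q.discount A ≤ 1 := by
  intro η
  by_cases h : η ∈ A
  · rw [RateMatrix.discount, indicator_of_mem h,
      indicator_of_notMem (show η ∉ Aᶜ from fun h' => h' h), zero_add]
    exact ENNReal.div_le_of_le_mul (by rw [Pi.one_apply, one_mul]; exact le_self_add)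
  · rw [RateMatrix.discount, indicator_of_notMem h, indicator_of_mem (show η ∈ Aᶜ from h), add_zero]

theorem lam_div_lt_one (η : E) : Q.lam η / (Q.lam η + 1) < 1 := by
  rw [ENNReal.div_lt_iff (by simp) (by simp [lam_ne_top]), one_mul]
  exact ENNReal.lt_add_right (lam_ne_top η) one_ne_zero

theorem ae_changesOften [Finite S] (hirr : Q.IsIrreducible)
    (hne : Q.NonExplosive) (hrec : Q.IsRecurrent) {W : S → Set E}
    (hother : ∀ x, (otherWells W x).Nonempty) {η : E} (hη : η ∈ wells W) :
    ∀ᵐ ω ∂Q.law η, ChangesOften Q W ω := by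
  have h1 : ∀ᵐ ω ∂Q.law η, ∀ x n, ∃ k ≥ n, ω.1 k ∈ otherWells W x := by
    rw [ae_all_iff]
    intro x
    obtain ⟨b, hb⟩ := hother x
    filter_upwards [ae_frequently_visits hirr hrec η b] with ω hω n
    obtain ⟨k, hk, h⟩ := hω n
    exact ⟨k, hk, h ▸ hb⟩
  have h2 := ae_iSup_eq_top (Q := Q) (wells W)
    (tendsto_iterate_one_of_lt hirr hrec (a := η) (discount_le_one _) (by
      rw [RateMatrix.discount, indicator_of_mem hη,
        indicator_of_notMem (show η ∉ (wells W)ᶜ from fun h' => h' hη), zero_add]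
      exact lam_div_lt_one η) η)
  filter_upwards [h1, h2, ae_regular hne η, ae_start Q η] with ω e1 e2 e3 e4
  exact ⟨e3, by rw [e4]; exact hη, e1, e2⟩

theorem ofFun_follows {e : ℝ≥0 → Option S} {J : ℕ → ℝ≥0∞} {y : ℕ → S}
    (h : StrictJumpPath e J fun n => some (y n)) : Follows (SkorohodSpace.ofFun e) J y := by
  have h1 : SkorohodSpace.ofFun e = ⟨e, h.isCadlag⟩ := dif_pos h.isCadlag
  rw [h1]
  exact h

end Projected

/-! ### Chains on a finite set -/

section FiniteChain

variable {S : Type*} [Finite S] [MeasurableSpace S] [DiscreteMeasurableSpace S] {r : RateMatrix S}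

/-- On a finite set the one-step discounts `λ / (λ + 1)` have a maximum below one, so the weighted
mass decays geometrically. Irreducibility is not available for `r`, which may have absorbing states.
-/
theorem ae_tsum_holding (x : S) : ∀ᵐ ω ∂r.law x, ∑' n, r.holding ω n = ∞ := by
  have : Nonempty S := ⟨x⟩
  obtain ⟨z, hz⟩ := Finite.exists_max fun y => r.lam y / (r.lam y + 1)
  set c := r.lam z / (r.lam z + 1) with hc
  have hc1 : c < 1 := lam_div_lt_one z
  have hle : ∀ n, (r.wavg (r.discount univ))^[n] 1 ≤ fun _ => c ^ n := by
    intro n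
    induction n with
    | zero => intro y; simp
    | succ n ih =>
      intro y
      rw [Function.iterate_succ_apply', RateMatrix.wavg, pow_succ']
      refine mul_le_mul' ?_ (avg_le_const r ih y)
      simp only [RateMatrix.discount, compl_univ, indicator_empty, indicator_univ, zero_add]
      exact hz y
  have hlim : Tendsto (fun n => (r.wavg (r.discount univ))^[n] 1 x) atTop (𝓝 0) :=
    tendsto_of_tendsto_of_tendsto_of_le_of_le tendsto_const_nhds
      (ENNReal.tendsto_pow_atTop_nhds_zero_of_lt_one hc1) (fun _ => zero_le) fun n => hle n x
  filter_upwards [ae_iSup_eq_top (Q := r) univ hlim] with ω hω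
  rw [ENNReal.tsum_eq_iSup_nat, ← hω]
  simp

theorem jumpTime_eq_renewalTime (ω : (ℕ → S) × (ℕ → ℝ)) (n : ℕ) :
    r.jumpTime ω n = renewalTime (fun ω => r.holding ω 0) shift ω n :=
  Finset.sum_congr rfl fun i _ => (holding_shift_iterate (Q := r) ω i 0).symm

theorem ae_follows_path (x : S) :
    ∀ᵐ ω ∂r.law x, Follows (SkorohodSpace.ofFun fun t => some (r.path ω t))
      (renewalTime (fun ω => r.holding ω 0) shift ω) (fun n => (shift^[n] ω).1 0) := by
  have : Nonempty S := ⟨x⟩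
  filter_upwards [ae_tsum_holding x, ae_pos (Q := r) x] with ω h1 h2
  have h3 := path_jumpPath r h1
  rw [← show r.jumpTime ω = renewalTime (fun ω => r.holding ω 0) shift ω from
    funext (jumpTime_eq_renewalTime ω)]
  refine ofFun_follows ⟨⟨h3.zero, h3.mono, h3.top, fun n t e1 e2 => ?_⟩, fun n hn => ?_⟩
  · rw [h3.eq n t e1 e2, shift_iterate_fst, Nat.add_zero]
  · rw [jumpTime_succ]
    exact ENNReal.lt_add_right hn (holding_pos ω (h2 n)).ne'

end FiniteChain

/-! ### Sequences with the same limits -/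

section Near

/-- The difference of the sequences converges to zero. -/
def Near (a b : ℕ → ℝ≥0∞) : Prop :=
  ∀ ε, 0 < ε → ∀ᶠ N in atTop, a N ≤ b N + ε ∧ b N ≤ a N + ε

variable {a b c d : ℕ → ℝ≥0∞}

theorem near_const_iff {l : ℝ≥0∞} (hl : l ≠ ∞) : Near a (fun _ => l) ↔ Tendsto a atTop (𝓝 l) := by
  rw [ENNReal.tendsto_nhds hl]
  refine forall_congr' fun ε => forall_congr' fun _ => eventually_congr (.of_forall fun N => ?_)
  rw [mem_Icc, tsub_le_iff_right, and_comm]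

theorem Near.refl (a : ℕ → ℝ≥0∞) : Near a a := fun _ _ => .of_forall fun _ =>
  ⟨le_self_add, le_self_add⟩

theorem Near.symm (h : Near a b) : Near b a := fun ε hε => (h ε hε).mono fun _ => And.symm

theorem Near.trans (h : Near a b) (h' : Near b c) : Near a c := by
  intro ε hε
  filter_upwards [h (ε / 2) (ENNReal.half_pos hε.ne'), h' (ε / 2) (ENNReal.half_pos hε.ne')]
    with N h1 h2
  rw [← ENNReal.add_halves ε, ← add_assoc, ← add_assoc]
  refine ⟨h1.1.trans ?_, h2.2.trans ?_⟩
  · rw [add_right_comm]; exact add_le_add_left h2.1 _ |>.trans_eq (by ring)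
  · exact (add_le_add_left h1.2 _).trans_eq (by ring)

theorem Near.add (h : Near a b) (h' : Near c d) : Near (fun N => a N + c N) fun N => b N + d N := by
  intro ε hε
  filter_upwards [h (ε / 2) (ENNReal.half_pos hε.ne'), h' (ε / 2) (ENNReal.half_pos hε.ne')]
    with N h1 h2
  rw [← ENNReal.add_halves ε]
  exact ⟨(add_le_add h1.1 h2.1).trans_eq (by ring), (add_le_add h1.2 h2.2).trans_eq (by ring)⟩

theorem Near.sum {ι : Type*} (s : Finset ι) {f g : ι → ℕ → ℝ≥0∞} (h : ∀ i ∈ s, Near (f i) (g i)) :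
    Near (fun N => ∑ i ∈ s, f i N) fun N => ∑ i ∈ s, g i N := by
  classical
  induction s using Finset.induction_on with
  | empty => simpa using Near.refl _
  | insert i s hi ih =>
    simp only [Finset.sum_insert hi]
    exact (h i (Finset.mem_insert_self i s)).add
      (ih fun j hj => h j (Finset.mem_insert_of_mem hj))

theorem Near.mul_bounded (h : Near a b) {C : ℝ≥0∞} (hC : C ≠ ∞) (hc : ∀ N, c N ≤ C) :
    Near (fun N => a N * c N) fun N => b N * c N := by
  intro ε hε
  have hpos : 0 < ε / (C + 1) := ENNReal.div_pos hε.ne' (by simp [hC])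
  filter_upwards [h _ hpos] with N hN
  have h1 : ε / (C + 1) * c N ≤ ε := by
    refine (mul_le_mul' le_rfl ((hc N).trans (le_self_add (b := 1)))).trans ?_
    rw [mul_comm]; exact ENNReal.mul_div_le
  refine ⟨(mul_le_mul' hN.1 le_rfl).trans ?_, (mul_le_mul' hN.2 le_rfl).trans ?_⟩ <;>
  · rw [add_mul]
    exact add_le_add le_rfl h1

theorem Near.tendsto (h : Near a b) {l : ℝ≥0∞} (hl : l ≠ ∞) (hb : Tendsto b atTop (𝓝 l)) :
    Tendsto a atTop (𝓝 l) :=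
  (near_const_iff hl).mp (h.trans ((near_const_iff hl).mpr hb))

/-- A property that holds eventually along every sequence of points of nonempty sets holds
eventually at all points. -/
theorem eventually_forall_mem {E : ℕ → Type*} {A : ∀ N, Set (E N)} (hA : ∀ N, (A N).Nonempty)
    {p : ∀ N, E N → Prop}
    (h : ∀ η : ∀ N, E N, (∀ N, η N ∈ A N) → ∀ᶠ N in atTop, p N (η N)) :
    ∀ᶠ N in atTop, ∀ η ∈ A N, p N η := by
  classical
  -- In each set the chosen point is a counterexample whenever there is one.
  have hch : ∀ N, ∃ η ∈ A N, p N η → ∀ ζ ∈ A N, p N ζ := by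
    intro N
    by_cases hN : ∃ ζ ∈ A N, ¬ p N ζ
    · obtain ⟨ζ, h1, h2⟩ := hN
      exact ⟨ζ, h1, fun h3 => absurd h3 h2⟩
    · push Not at hN
      obtain ⟨ζ, hζ⟩ := hA N
      exact ⟨ζ, hζ, fun _ => hN⟩
  choose η h1 h2 using hch
  exact (h η h1).mono fun N hN => h2 N hN

end Near

/-! ### One step of the projected process -/

section OneStep

variable {S : Type*} [Fintype S] [DecidableEq S]

/-- A nonexplosive recurrent chain with an invariant probability measure, disjoint wells and one
point in each well. -/
structure HasWells {E : Type*} [MeasurableSpace E] [DiscreteMeasurableSpace E] [Countable E]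
    (Q : RateMatrix E) (μ : Measure E) (W : S → Set E) (a : S → E) : Prop where
  pos : ∀ η, 0 < Q.hold η
  irr : Q.IsIrreducible
  ne : Q.NonExplosive
  recur : Q.IsRecurrent
  inv : Q.IsInvariant μ
  disj : Pairwise fun x y => Disjoint (W x) (W y)
  mem : ∀ x, a x ∈ W x

theorem lam_eq_sum (r : RateMatrix S) (x : S) :
    r.lam x = ∑ y ∈ Finset.univ.erase x, ENNReal.ofReal (r.rate x y) := by
  have h1 := (hasSum_fintype (r.rate x)).unique (r.hasSum_rate x)
  rw [← Finset.add_sum_erase _ _ (Finset.mem_univ x)] at h1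
  rw [← ENNReal.ofReal_sum_of_nonneg fun y hy => r.rate_nonneg x y (Finset.ne_of_mem_erase hy).symm,
    RateMatrix.lam, RateMatrix.hold]
  congr 1
  linarith

section Single

variable {E : Type*} [MeasurableSpace E] [DiscreteMeasurableSpace E] [Countable E]
  {Q : RateMatrix E} {μ : Measure E} {W : S → Set E} {a : S → E}

theorem HasWells.mem_other (h : HasWells Q μ W a) {x y : S} (hyx : y ≠ x) : a y ∈ otherWells W x :=
  mem_otherWells h.disj hyx (h.mem y)

theorem HasWells.sum_pot_add [Nontrivial S] (h : HasWells Q μ W a) (x : S) {α : ℝ≥0} (hα : 0 < α)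
    (η : E) : ∑ y ∈ Finset.univ.erase x, Q.pot (Q.escWeight W x α) ((W y).indicator 1) η +
      α * Q.escMean W x α 1 η = 1 := by
  obtain ⟨y, hy⟩ := exists_ne x
  have h1 := pot_other_add_escMean h.irr h.recur hα (h.mem_other hy) η
  rwa [indicator_otherWells h.disj, pot_finset_sum, Finset.sum_apply] at h1

theorem HasWells.pot_le_one [Nontrivial S] (h : HasWells Q μ W a) {x y : S} (hyx : y ≠ x) {α : ℝ≥0}
    (hα : 0 < α) (η : E) : Q.pot (Q.escWeight W x α) ((W y).indicator 1) η ≤ 1 := by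
  rw [← h.sum_pot_add x hα η]
  exact (Finset.single_le_sum
    (f := fun y => Q.pot (Q.escWeight W x α) ((W y).indicator 1) η) (fun _ _ => zero_le)
    (Finset.mem_erase.mpr ⟨hyx, Finset.mem_univ y⟩)).trans le_self_add

end Single

variable {E : ℕ → Type*} [∀ N, MeasurableSpace (E N)] [∀ N, DiscreteMeasurableSpace (E N)]
  [∀ N, Countable (E N)] {Q : ∀ N, RateMatrix (E N)} {μ : ∀ N, Measure (E N)}
  [∀ N, IsProbabilityMeasure (μ N)]
  {W : ∀ N, S → Set (E N)} {ξ : S → ∀ N, E N} {θ : ℕ → ℝ≥0} {r : RateMatrix S}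

theorem eventually_hitMean_exitRate_le
    (h : ∀ N, HasWells (Q N) (μ N) (W N) fun x => ξ x N) {x : S}
    (hC2 : CondC2 Q W x (ξ x)) {ε : ℝ≥0∞} (hε : 0 < ε) :
    ∀ᶠ N in atTop, ∀ η ∈ W N x,
      (Q N).hitMean (W N) x (ξ x N) (exitRate (Q N) (W N) x) η ≤ ε := by
  refine eventually_forall_mem (fun N => ⟨ξ x N, (h N).mem x⟩) fun η hη => ?_
  filter_upwards [(ENNReal.tendsto_nhds_zero.mp (hC2 η hη)) ε hε] with N hN
  rwa [mean_timeIntegral_hitTime (h N).pos (h N).ne] at hN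

theorem eventually_hitMean_one_le
    (h : ∀ N, HasWells (Q N) (μ N) (W N) fun x => ξ x N) {x : S}
    (hC3 : CondC3 Q μ W x (ξ x)) {ε : ℝ≥0∞} (hε : 0 < ε) :
    ∀ᶠ N in atTop, ∀ η ∈ W N x,
      meanExitRate (Q N) (μ N) (W N) x * (Q N).hitMean (W N) x (ξ x N) 1 η ≤ ε := by
  refine eventually_forall_mem (fun N => ⟨ξ x N, (h N).mem x⟩) fun η hη => ?_
  filter_upwards [(ENNReal.tendsto_nhds_zero.mp (hC3 η hη)) ε hε] with N hN
  simp only [occupation] at hN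
  rwa [mean_timeIntegral_hitTime (h N).pos (h N).ne] at hN

/-- The discounted probabilities of the first change of well converge. -/
theorem tendsto_pot_escWeight [Nontrivial S] [MeasurableSpace S] [DiscreteMeasurableSpace S]
    (h : ∀ N, HasWells (Q N) (μ N) (W N) fun x => ξ x N) {x : S}
    (hC2 : CondC2 Q W x (ξ x)) (hC3 : CondC3 Q μ W x (ξ x)) (hθ : ∀ N, 0 < θ N)
    (hH0 : CondH0 Q μ W θ r) {k : ℝ≥0} (hk : 0 < k) {η : ∀ N, E N} (hη : ∀ N, η N ∈ W N x)
    {y : S} (hyx : y ≠ x) :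
    Tendsto (fun N => (Q N).pot ((Q N).escWeight (W N) x (k / θ N)) ((W N y).indicator 1) (η N))
      atTop (𝓝 (ENNReal.ofReal (r.rate x y) / (r.lam x + k))) := by
  have hθ0 : ∀ N, (θ N : ℝ≥0∞) ≠ 0 := fun N => by exact_mod_cast (hθ N).ne'
  have hk0 : (k : ℝ≥0∞) ≠ 0 := by exact_mod_cast hk.ne'
  have hα : ∀ N, 0 < k / θ N := fun N => div_pos hk (hθ N)
  set u : S → ℕ → ℝ≥0∞ := fun y N =>
    (Q N).pot ((Q N).escWeight (W N) x (k / θ N)) ((W N y).indicator 1) (η N) with hu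
  set w : ℕ → ℝ≥0∞ := fun N => (Q N).escMean (W N) x (k / θ N) 1 (η N) with hw
  set v : ℕ → ℝ≥0∞ := fun N => w N / θ N with hv
  set ρ : S → ℕ → ℝ≥0∞ := fun y N => θ N * meanRate (Q N) (μ N) (W N) x y with hρ
  -- The conservation law, with `α = k / θ` absorbed into the normalization `v = G 1 / θ`.
  have hsum : ∀ N, ∑ y ∈ Finset.univ.erase x, u y N + k * v N = 1 := by
    intro N
    rw [← (h N).sum_pot_add x (hα N) (η N), hv, hw, hu]
    congr 1
    simp only [ENNReal.coe_div (hθ N).ne']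
    rw [← mul_div_assoc, ENNReal.mul_div_right_comm]
  have hvle : ∀ N, v N ≤ 1 / k := by
    intro N
    rw [ENNReal.le_div_iff_mul_le (Or.inl hk0) (Or.inl ENNReal.coe_ne_top), mul_comm, ← hsum N]
    exact le_add_self
  have hvC : (1 : ℝ≥0∞) / k ≠ ∞ := ENNReal.div_ne_top ENNReal.one_ne_top hk0
  have hρv : ∀ y N, ρ y N * v N = meanRate (Q N) (μ N) (W N) x y * w N := by
    intro y N
    rw [hρ, hv]
    simp only
    rw [mul_comm (θ N : ℝ≥0∞), mul_assoc, ENNReal.mul_div_cancel (hθ0 N) ENNReal.coe_ne_top]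
  have hnear1 : ∀ y, y ≠ x → Near (u y) fun N => ρ y N * v N := by
    intro y hy ε hε
    -- The error in `escape_bounds` has to be finite and enters twice.
    have hε' : 0 < min ε 1 / 2 := ENNReal.half_pos (lt_min hε one_pos).ne'
    have hε'' : min ε 1 / 2 ≠ ∞ :=
      ENNReal.div_ne_top (ne_top_of_le_ne_top ENNReal.one_ne_top (min_le_right _ _)) two_ne_zero
    filter_upwards [eventually_hitMean_exitRate_le h hC2 hε', eventually_hitMean_one_le h hC3 hε']
      with N h2 h3
    have h4 := escape_bounds (h N).pos (h N).irr (h N).ne (h N).recur (h N).inv (h N).disj (hα N)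
      ((h N).mem x) hy ((h N).mem y) hε'' h2 h3 (hη N)
    have h5 : 2 * (min ε 1 / 2) ≤ ε := by
      rw [ENNReal.mul_div_cancel two_ne_zero ENNReal.ofNat_ne_top]; exact min_le_left _ _
    rw [hρv]
    exact ⟨h4.1.trans (add_le_add le_rfl h5), h4.2.trans (add_le_add le_rfl h5)⟩
  -- The rates `θ r_N(x,y)` may be replaced by their limits because `v` stays below `1 / k`.
  have hnear2 : ∀ y, y ≠ x → Near (u y) fun N => ENNReal.ofReal (r.rate x y) * v N := by
    intro y hy
    refine (hnear1 y hy).trans (Near.mul_bounded ?_ hvC hvle)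
    exact (near_const_iff ENNReal.ofReal_ne_top).mpr (hH0 x y hy.symm)
  have hlk0 : r.lam x + k ≠ 0 := lam_add_ne_zero hk x
  have hlkt : r.lam x + k ≠ ∞ := lam_add_ne_top x
  -- Summed over `y`, the approximations turn the conservation law into `(λ(x) + k) v ≈ 1`.
  have hvlim : Tendsto v atTop (𝓝 (r.lam x + k)⁻¹) := by
    have h1 : Near (fun N => (r.lam x + k) * v N) fun _ => 1 := by
      have h2 := (Near.sum (Finset.univ.erase x) fun y hy =>
        hnear2 y (Finset.ne_of_mem_erase hy)).add (Near.refl fun N => k * v N)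
      simp only [hsum, ← Finset.sum_mul, ← lam_eq_sum, ← add_mul] at h2
      exact h2.symm
    have h3 := ENNReal.Tendsto.const_mul (a := (r.lam x + k)⁻¹)
      ((near_const_iff ENNReal.one_ne_top).mp h1) (Or.inr (ENNReal.inv_ne_top.mpr hlk0))
    rw [mul_one] at h3
    refine h3.congr fun N => ?_
    rw [← mul_assoc, ENNReal.inv_mul_cancel hlk0 hlkt, one_mul]
  refine (hnear2 y hyx).tendsto (ENNReal.div_ne_top ENNReal.ofReal_ne_top hlk0) ?_
  exact ENNReal.Tendsto.const_mul hvlim (Or.inr ENNReal.ofReal_ne_top)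

end OneStep

/-! ### Convergence of the moments -/

section MomentLimit

variable {S : Type*} [Fintype S] [DecidableEq S]

/-- In this product form the identity also covers absorbing states, where both sides vanish. -/
theorem lam_mul_avg [MeasurableSpace S] [DiscreteMeasurableSpace S] (r : RateMatrix S) (f : S → ℝ≥0∞)
    (x : S) :
    r.lam x * r.avg f x = ∑ y ∈ Finset.univ.erase x, ENNReal.ofReal (r.rate x y) * f y := by
  by_cases h0 : r.hold x = 0
  · have h1 : r.lam x = 0 := by rw [RateMatrix.lam, h0, ENNReal.ofReal_zero]
    rw [h1, zero_mul]
    rw [lam_eq_sum, Finset.sum_eq_zero_iff] at h1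
    exact (Finset.sum_eq_zero fun y hy => by rw [h1 y hy, zero_mul]).symm
  · have hpos : 0 < r.hold x := lt_of_le_of_ne (r.hold_nonneg x) (Ne.symm h0)
    rw [avg_eq_tsum, tsum_fintype, ← Finset.add_sum_erase _ _ (Finset.mem_univ x), mul_add,
      Finset.mul_sum, jumpKernel_singleton r h0]
    have h2 : r.jumpProb x x = 0 := if_pos rfl
    rw [h2, ENNReal.ofReal_zero, mul_zero, mul_zero, zero_add]
    refine Finset.sum_congr rfl fun y hy => ?_
    have h3 : r.jumpProb x y = r.rate x y / r.hold x := if_neg (Finset.ne_of_mem_erase hy)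
    rw [jumpKernel_singleton r h0, h3, ENNReal.ofReal_div_of_pos hpos, mul_left_comm]
    change f y * (r.lam x * (_ / r.lam x)) = _
    rw [ENNReal.mul_div_cancel (show r.lam x ≠ 0 from (ENNReal.ofReal_pos.mpr hpos).ne')
      (lam_ne_top x), mul_comm]

theorem mean_holding_shift [MeasurableSpace S] [DiscreteMeasurableSpace S] (r : RateMatrix S)
    {Ψ : (ℕ → S) × (ℕ → ℝ) → ℝ≥0∞} (hΨ : Measurable Ψ) {k : ℝ≥0} (hk : 0 < k) (x : S) :
    r.mean (fun ω => en (k * r.holding ω 0) * Ψ (shift ω)) x =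
      ∑ y ∈ Finset.univ.erase x, ENNReal.ofReal (r.rate x y) / (r.lam x + k) * r.mean Ψ y := by
  have hmt : ∀ ζ, Measurable fun t : ℝ => en (k * (ENNReal.ofReal t / ENNReal.ofReal (r.hold ζ))) :=
    fun ζ => measurable_en.comp ((ENNReal.measurable_ofReal.div_const _).const_mul _)
  have h1 := congrFun (mean_mul_shift r (w := fun ζ t =>
    en (k * (ENNReal.ofReal t / ENNReal.ofReal (r.hold ζ)))) hmt hΨ) x
  refine h1.trans ?_
  rw [RateMatrix.wavg, lintegral_expMeasure_en (r.hold_nonneg x) hk]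
  change r.lam x / (r.lam x + k) * r.avg (r.mean Ψ) x = _
  rw [div_eq_mul_inv, mul_right_comm, lam_mul_avg, Finset.sum_mul]
  exact Finset.sum_congr rfl fun y _ => by rw [div_eq_mul_inv]; ring

variable [MeasurableSpace S] [DiscreteMeasurableSpace S] [Nontrivial S]
  {E : ℕ → Type*} [∀ N, MeasurableSpace (E N)] [∀ N, DiscreteMeasurableSpace (E N)]
  [∀ N, Countable (E N)] {Q : ∀ N, RateMatrix (E N)} {μ : ∀ N, Measure (E N)}
  [∀ N, IsProbabilityMeasure (μ N)]
  {W : ∀ N, S → Set (E N)} {ξ : S → ∀ N, E N} {θ : ℕ → ℝ≥0} {r : RateMatrix S}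

/-- Induction on a bound for the indices in `L`. The strong Markov property at the first change
replaces `L` by its tail, evaluated at an uncontrolled point of the next well. The induction
hypothesis holds along every sequence of starting points, hence uniformly on the wells by
`eventually_forall_mem`. -/
theorem tendsto_moment (h : ∀ N, HasWells (Q N) (μ N) (W N) fun x => ξ x N)
    (hC2 : ∀ x, CondC2 Q W x (ξ x)) (hC3 : ∀ x, CondC3 Q μ W x (ξ x)) (hθ : ∀ N, 0 < θ N)
    (hH0 : CondH0 Q μ W θ r) (n : ℕ) {L : List (ℕ × S)} (hL : ∀ p ∈ L, p.1 < n) {x : S}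
    {η : ∀ N, E N} (hη : ∀ N, η N ∈ W N x) :
    Tendsto (fun N => (Q N).mean (moment (fun ω => (Q N).sojourn (W N) ω / θ N)
        (afterChange (W N)) (fun ω => wellOf (W N) (ω.1 0)) L) (η N)) atTop
      (𝓝 (r.mean (moment (fun ω => r.holding ω 0) shift (fun ω => ω.1 0) L) x)) := by
  set m : ∀ (L : List (ℕ × S)) (N : ℕ), (ℕ → E N) × (ℕ → ℝ) → ℝ≥0∞ := fun L N =>
    moment (fun ω => (Q N).sojourn (W N) ω / θ N)
        (afterChange (W N)) (fun ω => wellOf (W N) (ω.1 0)) L with hm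
  set m' : ∀ (L : List (ℕ × S)), (ℕ → S) × (ℕ → ℝ) → ℝ≥0∞ := fun L =>
    moment (fun ω => r.holding ω 0) shift (fun ω => ω.1 0) L with hm'
  have hmm : ∀ L N, Measurable (m L N) := fun L N =>
    measurable_moment ((measurable_sojourn _).div_const _) (measurable_afterChange _)
      (measurable_wellOf _) L
  have hmm' : ∀ L, Measurable (m' L) := fun L =>
    measurable_moment (measurable_holding 0) measurable_shift (measurable_coord 0) L
  induction n generalizing L x η with
  | zero =>
    have : L = [] := List.eq_nil_iff_forall_not_mem.mpr fun p hp => absurd (hL p hp) (by omega)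
    subst this
    simp [moment, RateMatrix.mean]
  | succ n ih =>
    have ih' : ∀ y, ∀ ε, 0 < ε → ∀ᶠ N in atTop, ∀ ζ ∈ W N y,
        (Q N).mean (m (tailList L) N) ζ ≤ r.mean (m' (tailList L)) y + ε ∧
        r.mean (m' (tailList L)) y ≤ (Q N).mean (m (tailList L) N) ζ + ε := by
      intro y ε hε
      refine eventually_forall_mem (fun N => ⟨ξ y N, (h N).mem y⟩) fun ζ hζ => ?_
      refine (near_const_iff ?_).mpr (ih (lt_of_mem_tailList hL) hζ) ε hε
      refine ne_top_of_le_ne_top ENNReal.one_ne_top ?_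
      exact (lintegral_mono fun ω => moment_le_one _ _ _ _ ω).trans (by simp)
    -- With an empty tail the moment depends on the first label only. This case is separate because
    -- the Laplace exponent must be positive.
    by_cases htail : tailList L = []
    · have h1 : ∀ N, (Q N).mean (m L N) (η N) = startFactor L x := by
        intro N
        rw [RateMatrix.mean, lintegral_congr_ae (g := fun _ => startFactor L x)]
        · simp
        · filter_upwards [ae_start (Q N) (η N)] with ω hω
          rw [hm]
          simp only
          rw [moment_eq_startFactor _ _ _ htail, hω, wellOf_eq (h N).disj (hη N)]
      have h2 : r.mean (m' L) x = startFactor L x := by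
        rw [RateMatrix.mean, lintegral_congr_ae (g := fun _ => startFactor L x)]
        · simp
        · filter_upwards [ae_start r x] with ω hω
          rw [hm']
          simp only
          rw [moment_eq_startFactor _ _ _ htail, hω]
      change Tendsto (fun N => (Q N).mean (m L N) (η N)) atTop (𝓝 (r.mean (m' L) x))
      simp only [h1, h2]
      exact tendsto_const_nhds
    · set k : ℝ≥0 := ((tailList L).length : ℝ≥0) with hkdef
      have hk : 0 < k := by
        rw [hkdef]
        exact_mod_cast List.length_pos_iff.mpr htail
      have hkc : (k : ℝ≥0∞) = ((tailList L).length : ℝ≥0∞) := by simp [hkdef]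
      have hα : ∀ N, 0 < k / θ N := fun N => div_pos hk (hθ N)
      have h1 : ∀ N, (Q N).mean (m L N) (η N) = startFactor L x *
          ∑ y ∈ Finset.univ.erase x, (Q N).pot ((Q N).escWeight (W N) x (k / θ N))
            ((W N y).indicator ((Q N).mean (m (tailList L) N))) (η N) := by
        intro N
        obtain ⟨y, hy⟩ := exists_ne x
        rw [← mean_afterChange (h N).irr (h N).recur (h N).disj (hα N) ((h N).mem_other hy)
          (hmm _ N) (hη N), RateMatrix.mean, RateMatrix.mean, ← lintegral_const_mul]
        · refine lintegral_congr_ae ?_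
          filter_upwards [ae_start (Q N) (η N)] with ω hω
          rw [hm]
          simp only
          rw [moment_eq, hω, wellOf_eq (h N).disj (hη N), ← hkc, ENNReal.coe_div (hθ N).ne',
            ← mul_div_assoc, ENNReal.mul_div_right_comm]
        · exact (measurable_en.comp ((measurable_sojourn _).const_mul _)).mul
            ((hmm _ N).comp (measurable_afterChange _))
      have h2 : r.mean (m' L) x = startFactor L x * ∑ y ∈ Finset.univ.erase x,
          ENNReal.ofReal (r.rate x y) / (r.lam x + k) * r.mean (m' (tailList L)) y := by
        rw [← mean_holding_shift r (hmm' _) hk, RateMatrix.mean, RateMatrix.mean,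
          ← lintegral_const_mul]
        · refine lintegral_congr_ae ?_
          filter_upwards [ae_start r x] with ω hω
          rw [hm']
          simp only
          rw [moment_eq, hω, hkc]
        · exact (measurable_en.comp ((measurable_holding 0).const_mul _)).mul
            ((hmm' _).comp measurable_shift)
      change Tendsto (fun N => (Q N).mean (m L N) (η N)) atTop (𝓝 (r.mean (m' L) x))
      simp only [h1, h2]
      have hMfin : ∀ y, r.mean (m' (tailList L)) y ≠ ∞ := fun y =>
        ne_top_of_le_ne_top ENNReal.one_ne_top
          ((lintegral_mono fun ω => moment_le_one _ _ _ _ ω).trans (by simp))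
      refine ENNReal.Tendsto.const_mul (tendsto_finsetSum _ fun y hy => ?_)
        (Or.inr (ne_top_of_le_ne_top ENNReal.one_ne_top (startFactor_le_one L x)))
      have hyx := Finset.ne_of_mem_erase hy
      have hu := tendsto_pot_escWeight h (hC2 x) (hC3 x) hθ hH0 hk hη hyx
      have hnear : Near (fun N => (Q N).pot ((Q N).escWeight (W N) x (k / θ N))
            ((W N y).indicator ((Q N).mean (m (tailList L) N))) (η N))
          (fun N => (Q N).pot ((Q N).escWeight (W N) x (k / θ N)) ((W N y).indicator 1) (η N) *
            r.mean (m' (tailList L)) y) := by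
        intro ε hε
        filter_upwards [ih' y ε hε] with N hN
        set M := r.mean (m' (tailList L)) y
        set f := (Q N).mean (m (tailList L) N)
        have hu1 := (h N).pot_le_one hyx (hα N) (η N)
        constructor
        · have e1 : (W N y).indicator f ≤ fun ζ => (M + ε) * (W N y).indicator 1 ζ := by
            intro ζ
            by_cases hζ : ζ ∈ W N y
            · simp only [indicator_of_mem hζ, Pi.one_apply, mul_one]; exact (hN ζ hζ).1
            · simp [indicator_of_notMem hζ]
          refine (pot_mono (Q N) le_rfl e1 (η N)).trans ?_
          rw [pot_const_mul, add_mul, mul_comm M]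
          exact add_le_add le_rfl ((mul_le_mul' le_rfl hu1).trans (mul_one _).le)
        · have e1 : (fun ζ => M * (W N y).indicator 1 ζ) ≤
              (W N y).indicator f + fun ζ => ε * (W N y).indicator 1 ζ := by
            intro ζ
            by_cases hζ : ζ ∈ W N y
            · simp only [Pi.add_apply, indicator_of_mem hζ, Pi.one_apply, mul_one]
              exact (hN ζ hζ).2
            · simp [indicator_of_notMem hζ]
          have e2 := pot_mono (Q N) (le_refl ((Q N).escWeight (W N) x (k / θ N))) e1 (η N)
          rw [pot_const_mul, pot_add, Pi.add_apply, pot_const_mul, mul_comm M] at e2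
          exact e2.trans (add_le_add le_rfl ((mul_le_mul' le_rfl hu1).trans (mul_one _).le))
      have hlk0 : r.lam x + k ≠ 0 := lam_add_ne_zero hk x
      have hufin : ENNReal.ofReal (r.rate x y) / (r.lam x + k) ≠ ∞ :=
        ENNReal.div_ne_top ENNReal.ofReal_ne_top hlk0
      refine hnear.tendsto (ENNReal.mul_ne_top hufin (hMfin y)) ?_
      exact ENNReal.Tendsto.mul_const hu (Or.inr (hMfin y))

end MomentLimit

/-! ### The time spent outside the wells -/

section Elementary

theorem one_sub_en_le (d : ℝ≥0∞) : 1 - en d ≤ d := by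
  induction d with
  | top => exact le_top
  | coe d =>
    rw [en_coe, ← ENNReal.ofReal_one, ← ENNReal.ofReal_sub _ (Real.exp_pos _).le,
      ← ENNReal.ofReal_coe_nnreal]
    refine ENNReal.ofReal_le_ofReal ?_
    have := Real.add_one_le_exp (-(d : ℝ))
    linarith

theorem en_sub_en_add_le (a d : ℝ≥0∞) : en a - en (a + d) ≤ d := by
  rw [en_add]
  calc en a - en a * en d = en a * (1 - en d) := by
        rw [ENNReal.mul_sub fun _ _ => en_ne_top a, mul_one]
    _ ≤ 1 * (1 - en d) := mul_le_mul' (en_le_one a) le_rfl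
    _ ≤ d := by rw [one_mul]; exact one_sub_en_le d

theorem en_sub_en_le {a b : ℝ≥0∞} (h : a ≤ b) : en a - en b ≤ b - a := by
  conv_lhs => rw [← add_tsub_cancel_of_le h]
  exact en_sub_en_add_le a (b - a)

/-- On `[0, t]` the density `exp (-s)` of the discounted time is at least `exp (-t)`. -/
theorem min_sub_min_le {a b : ℝ≥0∞} (h : a ≤ b) (t : ℝ≥0) :
    min b t - min a t ≤ ENNReal.ofReal (Real.exp t) * (en a - en b) := by
  rcases le_total (t : ℝ≥0∞) a with ht | ht
  · rw [min_eq_right ht, min_eq_right (ht.trans h), tsub_self]; exact zero_le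
  · rw [min_eq_left ht]
    have hb1 : a ≤ min b t := le_min h ht
    refine le_trans ?_ (mul_le_mul' le_rfl (tsub_le_tsub_left (en_antitone (min_le_left b t)) _))
    have hbt : min b t ≤ t := min_le_right _ _
    generalize min b (t : ℝ≥0∞) = b' at hb1 hbt
    lift b' to ℝ≥0 using ne_top_of_le_ne_top ENNReal.coe_ne_top hbt
    lift a to ℝ≥0 using ne_top_of_le_ne_top ENNReal.coe_ne_top hb1
    have h1 : (a : ℝ) ≤ b' := by exact_mod_cast hb1
    have h2 : (b' : ℝ) ≤ t := by exact_mod_cast hbt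
    rw [en_coe, en_coe, ← ENNReal.ofReal_sub _ (Real.exp_pos _).le,
      ← ENNReal.ofReal_mul (Real.exp_pos _).le, ← ENNReal.ofReal_coe_nnreal,
      ← ENNReal.ofReal_coe_nnreal, ← ENNReal.ofReal_sub _ (NNReal.coe_nonneg a)]
    refine ENNReal.ofReal_le_ofReal ?_
    have h3 : Real.exp t * (Real.exp (-a) - Real.exp (-b')) =
        Real.exp (t - b') * (Real.exp (b' - a) - 1) := by
      rw [mul_sub, mul_sub, ← Real.exp_add, ← Real.exp_add, ← Real.exp_add, mul_one]
      ring_nf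
    rw [h3]
    have h4 := Real.add_one_le_exp ((b' : ℝ) - a)
    have h5 := Real.one_le_exp (sub_nonneg.mpr h2)
    nlinarith

/-- The part of `[a, b]` before `t` is bounded by its length; the part after `t` keeps its
discounted length. -/
theorem en_sub_en_le_min {a b : ℝ≥0∞} (h : a ≤ b) (t : ℝ≥0∞) :
    en a - en b ≤ (min b t - min a t) + (en (max a t) - en (max b t)) := by
  rcases le_total t a with ht | ht
  · rw [max_eq_left ht, max_eq_left (ht.trans h)]
    exact le_add_self
  · rw [min_eq_left ht, max_eq_right ht]
    rcases le_total b t with hb | hb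
    · rw [min_eq_left hb]
      exact (en_sub_en_le h).trans le_self_add
    · rw [min_eq_right hb, max_eq_left hb]
      exact (tsub_le_tsub_add_tsub (b := en t)).trans (add_le_add (en_sub_en_le ht) le_rfl)

theorem sum_sub_le {c : ℕ → ℝ≥0∞} (hc : Antitone c) (n : ℕ) :
    ∑ i ∈ Finset.range n, (c i - c (i + 1)) ≤ c 0 := by
  have : ∑ i ∈ Finset.range n, (c i - c (i + 1)) + c n ≤ c 0 := by
    induction n with
    | zero => simp
    | succ n ih =>
      rw [Finset.sum_range_succ, add_assoc, tsub_add_cancel_of_le (hc (Nat.le_succ n))]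
      exact ih
  exact le_self_add.trans this

theorem tsum_sub_le {c : ℕ → ℝ≥0∞} (hc : Antitone c) : ∑' i, (c i - c (i + 1)) ≤ c 0 := by
  rw [ENNReal.tsum_eq_iSup_nat]
  exact iSup_le fun n => sum_sub_le hc n

theorem exists_en_le {ε : ℝ≥0∞} (hε : 0 < ε) : ∃ t : ℝ≥0, 0 < t ∧ en t ≤ ε := by
  have h1 : Tendsto (fun t : ℝ => ENNReal.ofReal (Real.exp (-t))) atTop (𝓝 0) := by
    have := ENNReal.tendsto_ofReal Real.tendsto_exp_neg_atTop_nhds_zero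
    rwa [ENNReal.ofReal_zero] at this
  obtain ⟨t, h2, h3⟩ := ((ENNReal.tendsto_nhds_zero.mp h1 ε hε).and (eventually_gt_atTop 0)).exists
  refine ⟨t.toNNReal, Real.toNNReal_pos.mpr h3, ?_⟩
  rw [en_coe, Real.coe_toNNReal t h3.le]
  exact h2

end Elementary

/-! ### The discounted time spent outside the wells. -/

section Outside

variable {E : Type*} [MeasurableSpace E] [DiscreteMeasurableSpace E] [Countable E]
  {Q : RateMatrix E}

variable (Q) in
/-- The time spent in `A`, discounted at the rate `1 / θ`. -/
def RateMatrix.discTime (A : Set E) (θ : ℝ≥0) (ω : (ℕ → E) × (ℕ → ℝ)) : ℝ≥0∞ :=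
  ∑' n, A.indicator 1 (ω.1 n) * (en (Q.jumpTime ω n / θ) - en (Q.jumpTime ω (n + 1) / θ))

theorem measurable_jumpTime (n : ℕ) : Measurable fun ω => Q.jumpTime ω n :=
  Finset.measurable_sum _ fun i _ => measurable_holding i

theorem measurable_discTime (A : Set E) (θ : ℝ≥0) : Measurable (Q.discTime A θ) :=
  Measurable.tsum fun n => (measurable_comp_coord _ n).mul
    ((measurable_en.comp ((measurable_jumpTime n).div_const _)).sub
      (measurable_en.comp ((measurable_jumpTime (n + 1)).div_const _)))

theorem antitone_en_jumpTime (θ : ℝ≥0) (ω : (ℕ → E) × (ℕ → ℝ)) :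
    Antitone fun n => en (Q.jumpTime ω n / θ) := fun _ _ hmn =>
  en_antitone (ENNReal.div_le_div_right (jumpTime_mono Q ω hmn) _)

theorem discTime_le_one (A : Set E) (θ : ℝ≥0) (ω : (ℕ → E) × (ℕ → ℝ)) : Q.discTime A θ ω ≤ 1 := by
  refine (ENNReal.tsum_le_tsum fun n => ?_).trans
    ((tsum_sub_le (antitone_en_jumpTime (Q := Q) θ ω)).trans (en_le_one _))
  exact (mul_le_mul' (indicator_le_one A _) le_rfl).trans (one_mul _).le

theorem mean_discTime_le_one (A : Set E) (θ : ℝ≥0) (η : E) : Q.mean (Q.discTime A θ) η ≤ 1 :=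
  (lintegral_mono fun ω => discTime_le_one A θ ω).trans (by simp)

theorem jumpTime_shift (ω : (ℕ → E) × (ℕ → ℝ)) (m n : ℕ) :
    Q.jumpTime ω (m + n) = Q.jumpTime ω m + Q.jumpTime (shift^[m] ω) n := by
  simp only [RateMatrix.jumpTime, Finset.sum_range_add, holding_shift_iterate]

theorem discTime_eq (A : Set E) (θ : ℝ≥0) (ω : (ℕ → E) × (ℕ → ℝ)) (m : ℕ) :
    Q.discTime A θ ω = ∑ n ∈ Finset.range m, A.indicator 1 (ω.1 n) *
        (en (Q.jumpTime ω n / θ) - en (Q.jumpTime ω (n + 1) / θ)) +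
      en (Q.jumpTime ω m / θ) * Q.discTime A θ (shift^[m] ω) := by
  rw [RateMatrix.discTime, ← ENNReal.summable.sum_add_tsum_nat_add' (k := m), RateMatrix.discTime,
    ← ENNReal.tsum_mul_left]
  congr 1
  refine tsum_congr fun n => ?_
  rw [shift_iterate_fst, add_comm n m, add_assoc m n 1, jumpTime_shift, jumpTime_shift,
    ENNReal.add_div, ENNReal.add_div, en_add, en_add,
    ← ENNReal.mul_sub fun _ _ => en_ne_top _]
  ring

theorem occupation_scale {ω : (ℕ → E) × (ℕ → ℝ)} (hω : Q.Regular ω) {θ : ℝ≥0} (hθ : 0 < θ)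
    (A : Set E) (t : ℝ≥0∞) :
    occupation (fun s => Q.path ω (s * θ)) A t = ∑' n, A.indicator 1 (ω.1 n) *
      (min (Q.jumpTime ω (n + 1) / θ) t - min (Q.jumpTime ω n / θ) t) :=
  ((path_jumpPath Q hω.2).scale hθ).timeIntegral_eq _ _

/-- With the converse estimate `mean_discTime_le`, property (M3) becomes the vanishing of the
discounted time. That quantity is bounded by one and factorizes at changes of well, as the
contraction argument requires. -/
theorem mean_occupation_le (hne : Q.NonExplosive) {θ : ℝ≥0} (hθ : 0 < θ) (A : Set E) (t : ℝ≥0)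
    (η : E) :
    ∫⁻ ω, occupation (fun s => Q.path ω (s * θ)) A t ∂Q.law η ≤
      ENNReal.ofReal (Real.exp t) * Q.mean (Q.discTime A θ) η := by
  rw [RateMatrix.mean, ← lintegral_const_mul _ (measurable_discTime A θ)]
  refine lintegral_mono_ae ?_
  filter_upwards [ae_regular hne η] with ω hω
  rw [occupation_scale hω hθ, RateMatrix.discTime, ← ENNReal.tsum_mul_left]
  refine ENNReal.tsum_le_tsum fun n => ?_
  rw [mul_left_comm]
  exact mul_le_mul' le_rfl (min_sub_min_le
    (ENNReal.div_le_div_right (jumpTime_mono Q ω (Nat.le_succ n)) _) t)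

theorem mean_discTime_le (hne : Q.NonExplosive) {θ : ℝ≥0} (hθ : 0 < θ) (A : Set E) (t : ℝ≥0)
    (η : E) :
    Q.mean (Q.discTime A θ) η ≤
      ∫⁻ ω, occupation (fun s => Q.path ω (s * θ)) A t ∂Q.law η + en t := by
  have h1 : ∫⁻ ω, occupation (fun s => Q.path ω (s * θ)) A t ∂Q.law η + en t =
      ∫⁻ ω, (occupation (fun s => Q.path ω (s * θ)) A t + en t) ∂Q.law η := by
    rw [lintegral_add_right _ measurable_const]; simp
  rw [h1]
  refine lintegral_mono_ae ?_
  filter_upwards [ae_regular hne η] with ω hω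
  rw [occupation_scale hω hθ, RateMatrix.discTime]
  have hc : Antitone fun n => en (max (Q.jumpTime ω n / θ) t) := fun m n hmn =>
    en_antitone (max_le_max (ENNReal.div_le_div_right (jumpTime_mono Q ω hmn) _) le_rfl)
  have h2 : ∑' n, (en (max (Q.jumpTime ω n / θ) t) - en (max (Q.jumpTime ω (n + 1) / θ) t)) ≤ en t :=
    (tsum_sub_le hc).trans (en_antitone (le_max_right _ _))
  refine le_trans ?_ (add_le_add le_rfl h2)
  rw [← ENNReal.tsum_add]
  refine ENNReal.tsum_le_tsum fun n => ?_
  refine (mul_le_mul' le_rfl (en_sub_en_le_min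
    (ENNReal.div_le_div_right (jumpTime_mono Q ω (Nat.le_succ n)) _) t)).trans ?_
  rw [mul_add]
  exact add_le_add le_rfl ((mul_le_mul' (indicator_le_one A _) le_rfl).trans (one_mul _).le)

variable {S : Type*} [Fintype S] [DecidableEq S] [Nontrivial S] {μ : Measure E} {W : S → Set E}
  {a : S → E}

/-- The discounted time spent outside the wells is the part before the first change of well and
the part after it. -/
theorem HasWells.mean_discTime_le (h : HasWells Q μ W a) {θ : ℝ≥0} (hθ : 0 < θ) {x : S} {η : E}
    (hη : η ∈ W x) (δ : ℝ≥0) :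
    Q.mean (Q.discTime (outside W) θ) η ≤ (δ + Q.law η {ω | (δ : ℝ≥0∞) <
        occupation (Q.path ω) (outside W) (hitTime (Q.path ω) (otherWells W x)) / θ}) +
      ∑ y ∈ Finset.univ.erase x, Q.pot (Q.escWeight W x (1 / θ))
        ((W y).indicator (Q.mean (Q.discTime (outside W) θ))) η := by
  obtain ⟨y, hy⟩ := exists_ne x
  have hb := h.mem_other hy
  have hα : 0 < 1 / θ := div_pos one_pos hθ
  have hθ0 : (θ : ℝ≥0∞) ≠ 0 := by exact_mod_cast hθ.ne'
  set B : Set ((ℕ → E) × (ℕ → ℝ)) := {ω | (δ : ℝ≥0∞) <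
        occupation (Q.path ω) (outside W) (hitTime (Q.path ω) (otherWells W x)) / θ} with hB
  rw [← mean_afterChange h.irr h.recur h.disj hα hb (measurable_discTime _ θ) hη]
  have hm : Measurable fun ω => en ((1 / θ : ℝ≥0) * Q.sojourn W ω) *
      Q.discTime (outside W) θ (afterChange W ω) :=
    (measurable_en.comp ((measurable_sojourn W).const_mul _)).mul
      ((measurable_discTime _ θ).comp (measurable_afterChange W))
  have hle : ∫⁻ ω, ((δ + B.indicator 1 ω) + en ((1 / θ : ℝ≥0) * Q.sojourn W ω) *
      Q.discTime (outside W) θ (afterChange W ω)) ∂Q.law η ≤ (δ + Q.law η B) +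
      Q.mean (fun ω => en ((1 / θ : ℝ≥0) * Q.sojourn W ω) *
        Q.discTime (outside W) θ (afterChange W ω)) η := by
    rw [lintegral_add_right _ hm]
    refine add_le_add ?_ le_rfl
    rw [lintegral_add_left measurable_const]
    refine add_le_add (by simp) ?_
    exact lintegral_indicator_one_le B
  refine le_trans (lintegral_mono_ae ?_) hle
  filter_upwards [ae_regular h.ne η, ae_start Q η, ae_frequently_visits h.irr h.recur η (a y)]
    with ω hω h0 hvis
  have hwell : wellOf W (ω.1 0) = x := by rw [h0]; exact wellOf_eq h.disj hη
  have hex : ∃ n, ω.1 n ∈ otherWells W (wellOf W (ω.1 0)) := by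
    obtain ⟨k, _, hk⟩ := hvis 0
    exact ⟨k, by rw [hk, hwell]; exact hb⟩
  have hk := changeIndex_spec hex
  have hlt : ∀ i < changeIndex W ω, ω.1 i ∉ otherWells W x := fun i hi => by
    have := notMem_of_lt_changeIndex hi
    rwa [hwell] at this
  rw [hwell] at hk
  rw [discTime_eq _ θ ω (changeIndex W ω)]
  -- The discount by the whole elapsed time is at most the discount by the time in the wells alone,
  -- for which the escape estimates are available.
  refine add_le_add ?_ (mul_le_mul' (en_antitone ?_) le_rfl)
  -- On `B` the discounted time is at most one; off `B` even the undiscounted time, on the scale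
  -- `θ`, is at most `δ`.
  · by_cases hωB : ω ∈ B
    · rw [indicator_of_mem hωB]
      refine le_trans ?_ le_add_self
      refine le_trans (Finset.sum_le_sum fun n _ => ?_)
        ((sum_sub_le (antitone_en_jumpTime (Q := Q) θ ω) (changeIndex W ω)).trans (en_le_one _))
      exact (mul_le_mul' (indicator_le_one _ _) le_rfl).trans (one_mul _).le
    · rw [indicator_of_notMem hωB, add_zero]
      have h1 : occupation (Q.path ω) (outside W) (hitTime (Q.path ω) (otherWells W x)) / θ ≤ δ :=
        not_lt.mp hωB
      refine le_trans ?_ h1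
      have hJ := path_jumpPath Q hω.2
      rw [hJ.hitTime_eq (jumpTime_lt h.pos hω) hk hlt, occupation, hJ.timeIntegral_index,
        div_eq_mul_inv, Finset.sum_mul]
      refine Finset.sum_le_sum fun n _ => ?_
      rw [mul_assoc, jumpTime_succ_sub h.pos, ← div_eq_mul_inv, jumpTime_succ, ENNReal.add_div]
      exact mul_le_mul' le_rfl (en_sub_en_add_le _ _)
  · rw [ENNReal.coe_div hθ.ne', ENNReal.coe_one, one_div, mul_comm, ← div_eq_mul_inv]
    refine ENNReal.div_le_div_right (Finset.sum_le_sum fun i _ => ?_) _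
    exact (mul_le_mul' (indicator_le_one _ _) le_rfl).trans (one_mul _).le

end Outside

/-! ### The three properties -/

section Properties

variable {S : Type*} [Fintype S] [DecidableEq S] [Nontrivial S]
  [MeasurableSpace S] [DiscreteMeasurableSpace S]
  {E : ℕ → Type*} [∀ N, MeasurableSpace (E N)] [∀ N, DiscreteMeasurableSpace (E N)]
  [∀ N, Countable (E N)] {Q : ∀ N, RateMatrix (E N)} {μ : ∀ N, Measure (E N)}
  [∀ N, IsProbabilityMeasure (μ N)]
  {W : ∀ N, S → Set (E N)} {ξ : S → ∀ N, E N} {θ : ℕ → ℝ≥0} {r : RateMatrix S}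

theorem propM3_of_discTime (hne : ∀ N, (Q N).NonExplosive) (hθ : ∀ N, 0 < θ N) {x : S}
    (h : ∀ ε : ℝ≥0∞, 0 < ε → ∀ᶠ N in atTop, ∀ η ∈ W N x,
      (Q N).mean ((Q N).discTime (outside (W N)) (θ N)) η ≤ ε) : PropM3 Q W θ x := by
  intro t _
  rw [ENNReal.tendsto_nhds_zero]
  intro ε hε
  filter_upwards [h (ε / ENNReal.ofReal (Real.exp t))
    (ENNReal.div_pos hε.ne' ENNReal.ofReal_ne_top)] with N hN
  refine iSup₂_le fun η hη => (mean_occupation_le (hne N) (hθ N) _ t η).trans ?_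
  exact (mul_le_mul' le_rfl (hN η hη)).trans ENNReal.mul_div_le

theorem discTime_of_propM3 (hne : ∀ N, (Q N).NonExplosive) (hθ : ∀ N, 0 < θ N) {x : S}
    (h : PropM3 Q W θ x) {ε : ℝ≥0∞} (hε : 0 < ε) :
    ∀ᶠ N in atTop, ∀ η ∈ W N x,
      (Q N).mean ((Q N).discTime (outside (W N)) (θ N)) η ≤ ε := by
  have hε2 : 0 < ε / 2 := ENNReal.half_pos hε.ne'
  obtain ⟨t, ht, hent⟩ := exists_en_le hε2
  filter_upwards [ENNReal.tendsto_nhds_zero.mp (h t ht) (ε / 2) hε2] with N hN η hη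
  refine (mean_discTime_le (hne N) (hθ N) _ t η).trans ?_
  rw [← ENNReal.add_halves ε]
  exact add_le_add ((le_iSup₂ (f := fun η (_ : η ∈ W N x) => ∫⁻ ω, occupation
    (fun s => (Q N).path ω (s * θ N)) (outside (W N)) t ∂(Q N).law η) η hη).trans hN) hent

/-- At `k = 1` the total weight of a change of well tends to `λ(x) / (λ(x) + 1)`, and these values
stay away from one because `S` is finite. -/
theorem exists_eventually_sum_pot_le (h : ∀ N, HasWells (Q N) (μ N) (W N) fun x => ξ x N)
    (hC2 : ∀ x, CondC2 Q W x (ξ x)) (hC3 : ∀ x, CondC3 Q μ W x (ξ x)) (hθ : ∀ N, 0 < θ N)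
    (hH0 : CondH0 Q μ W θ r) :
    ∃ c < (1 : ℝ≥0∞), ∀ᶠ N in atTop, ∀ x, ∀ η ∈ W N x, ∑ y ∈ Finset.univ.erase x,
      (Q N).pot ((Q N).escWeight (W N) x (1 / θ N)) ((W N y).indicator 1) η ≤ c := by
  obtain ⟨z, hz⟩ := Finite.exists_max fun x => r.lam x / (r.lam x + 1)
  obtain ⟨c, hc0, hc1⟩ := exists_between (lam_div_lt_one (Q := r) z)
  refine ⟨c, hc1, eventually_all.mpr fun x => ?_⟩
  refine eventually_forall_mem (fun N => ⟨ξ x N, (h N).mem x⟩) fun η hη => ?_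
  have h1 := tendsto_finsetSum (Finset.univ.erase x) fun y hy =>
    tendsto_pot_escWeight h (hC2 x) (hC3 x) hθ hH0 one_pos hη (Finset.ne_of_mem_erase hy)
  have h2 : ∑ y ∈ Finset.univ.erase x, ENNReal.ofReal (r.rate x y) / (r.lam x + (1 : ℝ≥0)) =
      r.lam x / (r.lam x + 1) := by
    simp only [div_eq_mul_inv, ← Finset.sum_mul, ← lam_eq_sum, ENNReal.coe_one]
  rw [h2] at h1
  exact (h1.eventually_lt_const ((hz x).trans_lt hc0)).mono fun _ => le_of_lt

/-- A contraction argument: the supremum `s` of the discounted time over the non-absorbing wells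
satisfies `s ≤ 3 * δ + s * c` with `c < 1`. The absorbing wells enter as data that are already
small. -/
theorem propM3 (h : ∀ N, HasWells (Q N) (μ N) (W N) fun x => ξ x N)
    (hC2 : ∀ x, CondC2 Q W x (ξ x)) (hC3 : ∀ x, CondC3 Q μ W x (ξ x)) (hθ : ∀ N, 0 < θ N)
    (hH0 : CondH0 Q μ W θ r) (hM3 : ∀ x, IsAbsorbing r x → PropM3 Q W θ x)
    (hC1 : ∀ x, ¬ IsAbsorbing r x → CondC1 Q W θ x) (x : S) : PropM3 Q W θ x := by
  by_cases hx : IsAbsorbing r x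
  · exact hM3 x hx
  refine propM3_of_discTime (fun N => (h N).ne) hθ fun ε hε => ?_
  obtain ⟨c, hc1, hc⟩ := exists_eventually_sum_pot_le h hC2 hC3 hθ hH0
  have h1c : 1 - c ≠ 0 := (tsub_pos_of_lt hc1).ne'
  have h1c' : 1 - c ≠ ∞ := ne_top_of_le_ne_top ENNReal.one_ne_top tsub_le_self
  have hcfin : c ≠ ∞ := hc1.ne_top
  -- This choice makes `3 * δ / (1 - c)` at most `ε`.
  obtain ⟨δ, hδ0, hδ⟩ := ENNReal.lt_iff_exists_nnreal_btwn.mp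
    (show 0 < ε * (1 - c) / 3 from ENNReal.div_pos (mul_ne_zero hε.ne' h1c) (by simp))
  have hδ0' : 0 < δ := by exact_mod_cast hδ0
  have habs : ∀ᶠ N in atTop, ∀ y, IsAbsorbing r y → ∀ η ∈ W N y,
      (Q N).mean ((Q N).discTime (outside (W N)) (θ N)) η ≤ δ :=
    eventually_all.mpr fun y => by
      by_cases hy : IsAbsorbing r y
      · exact (discTime_of_propM3 (fun N => (h N).ne) hθ (hM3 y hy) hδ0).mono fun N hN _ => hN
      · exact .of_forall fun N hy' => absurd hy' hy
  have hnon : ∀ᶠ N in atTop, ∀ y, ¬ IsAbsorbing r y → ∀ η ∈ W N y, (Q N).law η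
      {ω | (δ : ℝ≥0∞) < occupation ((Q N).path ω) (outside (W N))
        (hitTime ((Q N).path ω) (otherWells (W N) y)) / (θ N : ℝ≥0∞)} ≤ δ :=
    eventually_all.mpr fun y => by
      by_cases hy : IsAbsorbing r y
      · exact .of_forall fun N hy' => absurd hy hy'
      · refine (ENNReal.tendsto_nhds_zero.mp (hC1 y hy δ hδ0') δ hδ0).mono fun N hN _ η hη => ?_
        exact (le_iSup₂ (f := fun η (_ : η ∈ W N y) => (Q N).law η
          {ω | (δ : ℝ≥0∞) < occupation ((Q N).path ω) (outside (W N))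
            (hitTime ((Q N).path ω) (otherWells (W N) y)) / (θ N : ℝ≥0∞)}) η hη).trans hN
  filter_upwards [hc, habs, hnon] with N e1 e2 e3
  set z := (Q N).mean ((Q N).discTime (outside (W N)) (θ N)) with hz
  set s : ℝ≥0∞ := ⨆ (y : S) (_ : ¬ IsAbsorbing r y) (η : E N) (_ : η ∈ W N y), z η with hs
  have hzs : ∀ y, ¬ IsAbsorbing r y → ∀ η ∈ W N y, z η ≤ s := fun y hy η hη =>
    le_iSup_of_le y (le_iSup_of_le hy (le_iSup_of_le η (le_iSup_of_le hη le_rfl)))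
  -- Finiteness of `s` allows `s * c` to be cancelled below.
  have hs1 : s ≤ 1 := iSup₂_le fun _ _ => iSup₂_le fun η _ => mean_discTime_le_one _ _ η
  -- The three errors are the threshold in (C1), the probability of exceeding it, and the discounted
  -- time after a change to an absorbing well.
  have hsc : s ≤ 3 * δ + s * c := by
    refine iSup₂_le fun y hy => iSup₂_le fun η hη => ?_
    refine ((h N).mean_discTime_le (hθ N) hη δ).trans ?_
    have h4 : ∑ v ∈ Finset.univ.erase y, (Q N).pot ((Q N).escWeight (W N) y (1 / θ N))
        ((W N v).indicator z) η ≤ (δ + s) * c := by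
      refine le_trans (Finset.sum_le_sum (g := fun v => (δ + s) * (Q N).pot
        ((Q N).escWeight (W N) y (1 / θ N)) ((W N v).indicator 1) η) fun v _ => ?_) ?_
      · rw [← pot_const_mul]
        refine pot_mono (Q N) le_rfl (fun ζ => ?_) η
        by_cases hζ : ζ ∈ W N v
        · simp only [indicator_of_mem hζ, Pi.one_apply, mul_one]
          by_cases hv : IsAbsorbing r v
          · exact (e2 v hv ζ hζ).trans le_self_add
          · exact (hzs v hv ζ hζ).trans le_add_self
        · simp [indicator_of_notMem hζ]
      · rw [← Finset.mul_sum]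
        exact mul_le_mul' le_rfl (e1 y η hη)
    calc _ ≤ ((δ : ℝ≥0∞) + δ) + (δ + s) * c := add_le_add (add_le_add le_rfl (e3 y hy η hη)) h4
      _ ≤ (δ + δ) + (δ + s * c) := by
        rw [add_mul]
        exact add_le_add le_rfl (add_le_add ((mul_le_mul' le_rfl hc1.le).trans (mul_one _).le) le_rfl)
      _ = 3 * δ + s * c := by ring
  intro η hη
  refine (hzs x hx η hη).trans ?_
  have h5 : s * (1 - c) ≤ 3 * δ := by
    have h6 : s * (1 - c) + s * c ≤ 3 * δ + s * c := by
      rw [← mul_add, tsub_add_cancel_of_le hc1.le, mul_one]; exact hsc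
    exact ENNReal.le_of_add_le_add_right
      (ENNReal.mul_ne_top (ne_top_of_le_ne_top ENNReal.one_ne_top hs1) hcfin) h6
  have h7 : (3 : ℝ≥0∞) * δ ≤ ε * (1 - c) := by
    refine (mul_le_mul' le_rfl hδ.le).trans ENNReal.mul_div_le
  exact (ENNReal.mul_le_mul_iff_left h1c h1c').mp (h5.trans h7)

theorem propM1 (h : ∀ N, HasWells (Q N) (μ N) (W N) fun x => ξ x N) {x : S}
    (hC2 : CondC2 Q W x (ξ x)) : PropM1 Q W x (ξ x) := by
  rw [PropM1, ENNReal.tendsto_nhds ENNReal.one_ne_top]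
  intro ε hε
  filter_upwards [eventually_hitMean_exitRate_le h hC2 hε] with N hN
  refine ⟨le_iInf₂ fun η hη => ?_, ?_⟩
  · exact one_sub_le_law_hitTime (h N).pos (h N).irr (h N).ne (h N).recur (h N).disj
      ((h N).mem x) hη (hN η hη)
  · exact (iInf₂_le (ξ x N) ((h N).mem x)).trans (prob_le_one.trans le_self_add)

theorem propM2 (h : ∀ N, HasWells (Q N) (μ N) (W N) fun x => ξ x N)
    (hC2 : ∀ x, CondC2 Q W x (ξ x)) (hC3 : ∀ x, CondC3 Q μ W x (ξ x)) (hθ : ∀ N, 0 < θ N)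
    (hH0 : CondH0 Q μ W θ r) (x : S) : PropM2 Q W θ r x := by
  intro η hη
  refine tendstoInDistribution_of_follows
    (J := fun N => renewalTime (fun ω => (Q N).sojourn (W N) ω / θ N) (afterChange (W N)))
    (y := fun N ω n => wellOf (W N) (((afterChange (W N))^[n] ω).1 0))
    (J' := renewalTime (fun ω => r.holding ω 0) shift) (y' := fun ω n => (shift^[n] ω).1 0)
    ?_ ?_ ?_ (ae_follows_path x) ?_
  · exact fun N => measurable_mark_renewalTime ((measurable_sojourn _).div_const _)
      (measurable_afterChange _) (measurable_wellOf _)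
  · exact measurable_mark_renewalTime (measurable_holding 0) measurable_shift (measurable_coord 0)
  · intro N
    have hother : ∀ x, (otherWells (W N) x).Nonempty := fun x => by
      obtain ⟨y, hy⟩ := exists_ne x
      exact ⟨_, (h N).mem_other hy⟩
    filter_upwards [ae_changesOften (h N).irr (h N).ne (h N).recur hother
      (mem_iUnion.mpr ⟨x, hη N⟩)] with ω hω
    exact ofFun_follows (hω.strictJumpPath (h N).disj (h N).pos (hθ N))
  · intro L
    obtain ⟨n, hn⟩ : ∃ n, ∀ p ∈ L, p.1 < n := by
      refine ⟨(L.map Prod.fst).sum + 1, fun p hp => ?_⟩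
      have := List.single_le_sum (l := L.map Prod.fst) (by simp) p.1 (List.mem_map_of_mem hp)
      omega
    exact tendsto_moment h hC2 hC3 hθ hH0 n hn hη

end Properties

end Tunnel

end

/-! ### The theorem. -/

theorem theorem2p7 {E : ℕ → Type*} [∀ N, MeasurableSpace (E N)]
    [∀ N, DiscreteMeasurableSpace (E N)] [∀ N, Countable (E N)]
    {S : Type*} [Fintype S] [DecidableEq S] [Nontrivial S]
    [MeasurableSpace S] [DiscreteMeasurableSpace S]
    (Q : ∀ N, RateMatrix (E N))
    (hirr : ∀ N, (Q N).IsIrreducible)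
    (hne : ∀ N, (Q N).NonExplosive)
    (hpos : ∀ N, (Q N).IsPositiveRecurrent)
    (μ : ∀ N, Measure (E N)) [∀ N, IsProbabilityMeasure (μ N)]
    (hμ : ∀ N, (Q N).IsInvariant (μ N))
    (W : ∀ N, S → Set (E N))
    (hW : ∀ N, Pairwise fun x y => Disjoint (W N x) (W N y))
    (ξ : S → ∀ N, E N) (hξ : ∀ x N, ξ x N ∈ W N x)
    (hC2 : ∀ x, CondC2 Q W x (ξ x))
    (hC3 : ∀ x, CondC3 Q μ W x (ξ x))
    (θ : ℕ → ℝ≥0) (hθ : ∀ N, 0 < θ N)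
    (r : RateMatrix S)
    (hH0 : CondH0 Q μ W θ r)
    (hM3 : ∀ x, IsAbsorbing r x → PropM3 Q W θ x)
    (hC1 : ∀ x, ¬ IsAbsorbing r x → CondC1 Q W θ x) :
    ExhibitsTunneling Q θ W ξ r := by
  have h : ∀ N, HasWells (Q N) (μ N) (W N) fun x => ξ x N := by
    intro N
    obtain ⟨x, y, hxy⟩ := exists_pair_ne S
    -- Two disjoint nonempty wells provide two distinct states, and irreducibility then makes every
    -- holding rate positive.
    have : Nontrivial (E N) := ⟨ξ x N, ξ y N, fun heq =>
      Set.disjoint_left.mp (hW N hxy) (hξ x N) (heq ▸ hξ y N)⟩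
    have hhold := hold_pos_of_irreducible (hirr N)
    exact ⟨hhold, hirr N, hne N, isRecurrent hhold (hne N) (hpos N), hμ N, hW N, fun x => hξ x N⟩
  exact ⟨fun x => propM1 h (hC2 x), fun x => propM2 h hC2 hC3 hθ hH0 x,
    fun x => propM3 h hC2 hC3 hθ hH0 hM3 hC1 x⟩
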